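/- Let $\Sigma$ be a finite set of propositions and $\Gamma = 2^\Sigma\setminus\{\emptyset\}$. A timed word is a nonempty finite sequence $(\sigma_1,\tau_1)\dots(\sigma_n,\tau_n)$ with $\sigma_i\in\Gamma$ and $0=\tau_1\le\tau_2\le\dots\le\tau_n$ real. Intervals $I$ are open, half-open or closed with end points in $\mathbb N\cup\{\infty\}$; $I$ is punctual if it is $[a,a]$ with $a\in\mathbb N$. *Automata.* A 1-clock alternating timed automaton (1-ATA) $(\Gamma,S,s_0,F,\delta)$ has a finite set $S$ of locations, $s_0\in S$, $F\subseteq S$, and a transition function $\delta$ from $S\times\Gamma$ to the formulas $\varphi::=\top\mid\bot\mid\varphi\wedge\varphi\mid\varphi\vee\varphi\mid s\mid g\mid x.\varphi$, where $s\in S$, $g$ is a clock constraint $x\in I$ or $x\notin I$, and $x.\varphi$ resets the clock $x$ to $0$. A run starts in the configuration $\{(s_0,0)\}$ and alternates time elapse with discrete transitions, in which every state $(s,\nu)$ of the configuration is replaced by the states of a disjunct, satisfied at $\nu$, of the disjunctive normal form of $\delta(s,a)$; a word is accepted if some run on it ends in a configuration all of whose locations are in $F$. A location occurring in a transition is bound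 if it occurs in the scope of a reset, and free otherwise. - The automaton is *conjunctive-disjunctive* (C⊕D) if $S$ is partitioned into $S_\wedge$ and $S_\vee$ such that for $s\in S_\wedge$ each $\delta(s,a)$ is a conjunction of clauses $q\vee\beta$, $g\vee\beta$ or $\beta$ with $q\in S_\wedge$, and for $s\in S_\vee$ each $\delta(s,a)$ is a disjunction of clauses $q\wedge\beta$, $g\wedge\beta$ or $\beta$ with $q\in S_\vee$; here $g$ is a clock constraint and $\beta$ is a positive Boolean combination (with true and false) of expressions $x.p$, $p\in S$. - It has *loop-free resets* (lfr) if $S$ is partitioned into islands, each with a header location, such that $s_0$ is a header, bound locations are headers, the free locations in $\delta(s,a)$ are non-header locations of the island of $s$, and, for some partial order, $x.q$ occurs in a transition from an island only if $q$ is strictly below the header of that island. - It is *partially ordered* (PO) if there is a partial order $\prec$ on $S$ such that every location occurring in $\delta(s,a)$ is $s$ or $\prec s$, and $s$ is not bound in $\delta(s,a)$. *Logics.* The formulas of $\mathsf{FRatMTL}$ are $\varphi::=a\,(a\in\Sigma)\mid true\mid\varphi\wedge\varphi\mid\neg\varphi\mid\varphi\,\mathsf U_I\varphi\mid\mathsf{FRat}_{I,\mathsf{re}}\varphi$,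 where $\mathsf{re}$ is a rational expression whose letters are formulas. Here $\rho,i\models\varphi\,\mathsf U_I\psi$ iff there is $j>i$ with $\rho,j\models\psi$, $\tau_j-\tau_i\in I$ and $\rho,k\models\varphi$ for all $i<k<j$; and $\rho,i\models\mathsf{FRat}_{I,\mathsf{re}}\varphi$ iff there is $j>i$ with $\rho,j\models\varphi$, $\tau_j-\tau_i\in I$ and a word $\psi_{i+1}\dots\psi_{j-1}\in L(\mathsf{re})$ with $\rho,k\models\psi_k$ for all $i<k<j$. The language of $\varphi$ is the set of timed words $\rho$ with $\rho,1\models\varphi$. $\mathsf{FSfrMTL}$ consists of the formulas in which every rational expression $\mathsf{re}$, with set of letters $\mathsf S$, is equivalent to a star-free expression: there is a star-free language $K$ over the alphabet $2^{\mathsf S}$ such that for all timed words and positions $i<j$, the word marking each position $k$, $i<k<j$, with the set of formulas of $\mathsf S$ true at $k$ belongs to $K$ iff some word $\psi_{i+1}\dots\psi_{j-1}\in L(\mathsf{re})$ has $\rho,k\models\psi_k$ for all $i<k<j$. $\mathsf{FRatMITL}$ and $\mathsf{FSfrMITL}$ are the restrictions of $\mathsf{FRatMTL}$ and $\mathsf{FSfrMTL}$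 to formulas without punctual intervals. **Theorem.** The following classes are expressively equivalent, i.e. each language of timed words over $\Sigma$ defined by a member of one is defined by a member of the other: 1. C⊕D 1-ATA with loop-free resets, and $\mathsf{FRatMTL}$; 2. partially ordered C⊕D 1-ATA, and $\mathsf{FSfrMTL}$; 3. C⊕D 1-ATA with loop-free resets in whose clock constraints no interval is punctual, and $\mathsf{FRatMITL}$; 4. partially ordered C⊕D 1-ATA in whose clock constraints no interval is punctual, and $\mathsf{FSfrMITL}$. -/

import Mathlib

namespace ATA

/-! ### Intervals, timed words -/

/-- Open, half-open and closed time intervals with end points in `ℕ ∪ {∞}`. -/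
inductive Interval where
  | cc (a b : ℕ)
  | co (a b : ℕ)
  | oc (a b : ℕ)
  | oo (a b : ℕ)
  | ci (a : ℕ)
  | oi (a : ℕ)

/-- The set of reals denoted by an interval: `[a,b]`, `[a,b)`, `(a,b]`, `(a,b)`, `[a,∞)`, `(a,∞)`. -/
def Interval.toSet : Interval → Set ℝ
  | .cc a b => Set.Icc (a : ℝ) (b : ℝ)
  | .co a b => Set.Ico (a : ℝ) (b : ℝ)
  | .oc a b => Set.Ioc (a : ℝ) (b : ℝ)
  | .oo a b => Set.Ioo (a : ℝ) (b : ℝ)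
  | .ci a => Set.Ici (a : ℝ)
  | .oi a => Set.Ioi (a : ℝ)

/-- An interval is punctual if it has the form `[a,a]`. -/
def Interval.Punctual (I : Interval) : Prop := ∃ a : ℕ, I = .cc a a

/-- The symbols read by the automata: nonempty sets of propositions. -/
abbrev Letter (P : Type*) := {A : Set P // A.Nonempty}

/-- Finite (nonempty, weakly monotonic) timed words over the propositions `P`, with first time
stamp `0`. The positions are `0, …, last`. -/
structure TimedWord (P : Type*) where
  last : ℕ
  letter : Fin (last + 1) → Letter P
  time : Fin (last + 1) → ℝ
  time_mono : Monotone time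
  time_zero : time 0 = 0

/-- The time that elapses before the symbol at a position is read. -/
def TimedWord.delay {P : Type*} (ρ : TimedWord P) (k : Fin (ρ.last + 1)) : ℝ :=
  Fin.cases (motive := fun _ => ℝ) (ρ.time 0)
    (fun m : Fin ρ.last => ρ.time m.succ - ρ.time m.castSucc) k

/-! ### One-clock alternating timed automata -/

/-- Clock constraints: `x ∈ I` and its negation `x ∉ I`. -/
inductive Guard where
  | mem (I : Interval)
  | notMem (I : Interval)

/-- The interval of a clock constraint. -/
def Guard.interval : Guard → Interval
  | .mem I => I
  | .notMem I => I

/-- A clock value satisfies a clock constraint. -/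
def Guard.Holds : Guard → ℝ → Prop
  | .mem I, v => v ∈ I.toSet
  | .notMem I, v => v ∉ I.toSet

/-- Transition formulas over the locations `S`; `reset φ` is the binding construct `x.φ`. -/
inductive TForm (S : Type) where
  | top
  | bot
  | conj (φ ψ : TForm S)
  | disj (φ ψ : TForm S)
  | loc (s : S)
  | guard (g : Guard)
  | reset (φ : TForm S)

namespace TForm

variable {S : Type}

/-- The sets of states that a state with clock value `v` may be replaced with: each is obtained by
choosing one satisfied disjunct of the disjunctive normal form of the formula. -/
def outcomes : TForm S → ℝ → Set (Set (S × ℝ))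
  | top, _ => {∅}
  | bot, _ => ∅
  | conj φ ψ, v => {M | ∃ A ∈ φ.outcomes v, ∃ B ∈ ψ.outcomes v, M = A ∪ B}
  | disj φ ψ, v => φ.outcomes v ∪ ψ.outcomes v
  | loc s, v => {{(s, v)}}
  | guard g, v => {M | M = ∅ ∧ g.Holds v}
  | reset φ, _ => φ.outcomes 0

/-- The locations that occur outside the scope of a reset. -/
def freeLocs : TForm S → Set S
  | top => ∅
  | bot => ∅
  | conj φ ψ => φ.freeLocs ∪ ψ.freeLocs
  | disj φ ψ => φ.freeLocs ∪ ψ.freeLocs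
  | loc s => {s}
  | guard _ => ∅
  | reset _ => ∅

/-- The locations that occur in the scope of a reset. -/
def boundLocs : TForm S → Set S
  | top => ∅
  | bot => ∅
  | conj φ ψ => φ.boundLocs ∪ ψ.boundLocs
  | disj φ ψ => φ.boundLocs ∪ ψ.boundLocs
  | loc _ => ∅
  | guard _ => ∅
  | reset φ => φ.freeLocs ∪ φ.boundLocs

/-- The clock constraints that occur in a formula. -/
def guards : TForm S → Set Guard
  | top => ∅
  | bot => ∅
  | conj φ ψ => φ.guards ∪ ψ.guards
  | disj φ ψ => φ.guards ∪ ψ.guards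
  | loc _ => ∅
  | guard g => {g}
  | reset φ => φ.guards

/-- Positive Boolean combinations of the atoms `x.q`. -/
inductive IsResetCombination : TForm S → Prop
  | top : IsResetCombination top
  | bot : IsResetCombination bot
  | atom (q : S) : IsResetCombination (reset (loc q))
  | conj {β γ : TForm S} :
      IsResetCombination β → IsResetCombination γ → IsResetCombination (conj β γ)
  | disj {β γ : TForm S} :
      IsResetCombination β → IsResetCombination γ → IsResetCombination (disj β γ)

/-- Conjunctions of clauses, each of which is `q' ∨ β`, `g ∨ β` or `β`, where `q' ∈ Q`, `g` is a
clock constraint and `β` is a positive Boolean combination of the atoms `x.q`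
(the part `∨ β` may be missing). -/
inductive IsConjunctive (Q : Set S) : TForm S → Prop
  | loc {q : S} : q ∈ Q → IsConjunctive Q (loc q)
  | locOr {q : S} {β : TForm S} :
      q ∈ Q → IsResetCombination β → IsConjunctive Q (disj (loc q) β)
  | guard (g : Guard) : IsConjunctive Q (guard g)
  | guardOr (g : Guard) {β : TForm S} :
      IsResetCombination β → IsConjunctive Q (disj (guard g) β)
  | resets {β : TForm S} : IsResetCombination β → IsConjunctive Q β
  | conj {φ ψ : TForm S} : IsConjunctive Q φ → IsConjunctive Q ψ → IsConjunctive Q (conj φ ψ)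

/-- Disjunctions of clauses, each of which is `q' ∧ β`, `g ∧ β` or `β`, where `q' ∈ Q`, `g` is a
clock constraint and `β` is a positive Boolean combination of the atoms `x.q`
(the part `∧ β` may be missing). -/
inductive IsDisjunctive (Q : Set S) : TForm S → Prop
  | loc {q : S} : q ∈ Q → IsDisjunctive Q (loc q)
  | locAnd {q : S} {β : TForm S} :
      q ∈ Q → IsResetCombination β → IsDisjunctive Q (conj (loc q) β)
  | guard (g : Guard) : IsDisjunctive Q (guard g)
  | guardAnd (g : Guard) {β : TForm S} :
      IsResetCombination β → IsDisjunctive Q (conj (guard g) β)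
  | resets {β : TForm S} : IsResetCombination β → IsDisjunctive Q β
  | disj {φ ψ : TForm S} : IsDisjunctive Q φ → IsDisjunctive Q ψ → IsDisjunctive Q (disj φ ψ)

end TForm

/-- One-clock alternating timed automata over the propositions `P`. -/
structure OneATA (P : Type*) where
  Loc : Type
  finite_loc : Finite Loc
  init : Loc
  final : Set Loc
  δ : Loc → Letter P → TForm Loc

namespace OneATA

variable {P : Type*} (A : OneATA P)

/-- A configuration is a set of states, i.e. of locations with a clock value. -/
abbrev Config := Set (A.Loc × ℝ)

variable {A} in
/-- The configuration reached after `t` time units. -/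
def Config.elapse (C : A.Config) (t : ℝ) : A.Config :=
  (fun p : A.Loc × ℝ => (p.1, p.2 + t)) '' C

/-- Discrete transitions: each state is replaced according to the transition function. -/
def Step (a : Letter P) (C C' : A.Config) : Prop :=
  ∃ M : A.Loc × ℝ → A.Config,
    (∀ p ∈ C, M p ∈ (A.δ p.1 a).outcomes p.2) ∧ C' = ⋃ p ∈ C, M p

/-- A run on a timed word: from `{(s₀, 0)}`, time elapses and discrete transitions alternate. -/
def IsRun (ρ : TimedWord P) (C : Fin (ρ.last + 2) → A.Config) : Prop :=
  C 0 = {(A.init, 0)} ∧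
    ∀ k : Fin (ρ.last + 1),
      A.Step (ρ.letter k) (Config.elapse (C k.castSucc) (ρ.delay k)) (C k.succ)

/-- The timed words with a run whose last configuration has final locations only. -/
def language : Set (TimedWord P) :=
  {ρ | ∃ C, A.IsRun ρ C ∧ ∀ p ∈ C (Fin.last _), p.1 ∈ A.final}

/-- The automaton is in normal form, with islands given by `header`: `header s` is the header
location of the island of `s`, the islands being the fibres of `header` and the reset locations
being the headers. The initial location is a reset location, resets lead to reset locations only,
and every other transition stays in its island and does not lead to the header. -/
structure IsNormalForm (header : A.Loc → A.Loc) : Prop where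
  header_header : ∀ s, header (header s) = header s
  header_init : header A.init = A.init
  bound : ∀ s a, ∀ q ∈ (A.δ s a).boundLocs, header q = q
  free : ∀ s a, ∀ p ∈ (A.δ s a).freeLocs, header p = header s ∧ p ≠ header s

/-- Loop-free resets: the automaton is in normal form, and every reset in an island leads to a
reset location that is strictly below the header of the island, for some partial order. -/
def HasLoopFreeResets : Prop :=
  ∃ (header : A.Loc → A.Loc) (lt : A.Loc → A.Loc → Prop),
    A.IsNormalForm header ∧ IsStrictOrder A.Loc lt ∧
      ∀ p a, ∀ q ∈ (A.δ p a).boundLocs, lt q (header p)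

/-- Partially ordered automata. -/
def IsPartiallyOrdered : Prop :=
  ∃ lt : A.Loc → A.Loc → Prop, IsStrictOrder A.Loc lt ∧
    ∀ s a,
      (∀ p ∈ (A.δ s a).freeLocs ∪ (A.δ s a).boundLocs, p = s ∨ lt p s) ∧
        s ∉ (A.δ s a).boundLocs

/-- Conjunctive-disjunctive automata: the locations are partitioned into conjunctive ones
(those in `Q`) and disjunctive ones. -/
def IsConjunctiveDisjunctive : Prop :=
  ∃ Q : Set A.Loc, ∀ s a,
    (s ∈ Q → (A.δ s a).IsConjunctive Q) ∧ (s ∉ Q → (A.δ s a).IsDisjunctive Qᶜ)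

/-- No punctual interval is used in a clock constraint. -/
def IsNonPunctual : Prop :=
  ∀ s a, ∀ g ∈ (A.δ s a).guards, ¬ g.interval.Punctual

end OneATA

/-! ### The logics -/

/-- Rational expressions over an alphabet. -/
inductive RatExp (α : Type*) where
  | eps
  | letter (a : α)
  | cat (r s : RatExp α)
  | alt (r s : RatExp α)
  | star (r : RatExp α)

namespace RatExp

variable {α : Type*}

/-- The language of a rational expression. -/
def lang : RatExp α → Language α
  | eps => 1
  | letter a => {[a]}
  | cat r s => r.lang * s.lang
  | alt r s => r.lang + s.lang
  | star r => KStar.kstar r.lang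

/-- The letters that occur in a rational expression. -/
def letters : RatExp α → Set α
  | eps => ∅
  | letter a => {a}
  | cat r s => r.letters ∪ s.letters
  | alt r s => r.letters ∪ s.letters
  | star r => r.letters

theorem sizeOf_lt_of_mem_letters [SizeOf α] (r : RatExp α) {a : α}
    (ha : a ∈ r.letters) : sizeOf a < sizeOf r := by
  induction r with
  | eps => exact absurd ha (Set.notMem_empty a)
  | letter b =>
    simp only [letters, Set.mem_singleton_iff] at ha
    subst ha
    simp
  | cat r s ihr ihs =>
    simp only [cat.sizeOf_spec]
    rcases ha with h | h
    · have := ihr h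
      omega
    · have := ihs h
      omega
  | alt r s ihr ihs =>
    simp only [alt.sizeOf_spec]
    rcases ha with h | h
    · have := ihr h
      omega
    · have := ihs h
      omega
  | star r ih =>
    simp only [star.sizeOf_spec]
    have := ih ha
    omega

theorem mem_letters_of_mem_lang (r : RatExp α) {w : List α}
    (hw : w ∈ r.lang) {a : α} (ha : a ∈ w) : a ∈ r.letters := by
  induction r generalizing w with
  | eps =>
    cases (Language.mem_one w).1 hw
    simp at ha
  | letter b =>
    cases (show w = [b] from hw)
    simpa [letters] using ha
  | cat r s ihr ihs =>
    obtain ⟨u, hu, v, hv, rfl⟩ := Language.mem_mul.1 hw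
    rcases List.mem_append.1 ha with h | h
    · exact Or.inl (ihr hu h)
    · exact Or.inr (ihs hv h)
  | alt r s ihr ihs =>
    rcases hw with h | h
    · exact Or.inl (ihr h ha)
    · exact Or.inr (ihs h ha)
  | star r ih =>
    obtain ⟨L, rfl, hL⟩ := Language.mem_kstar.1 hw
    obtain ⟨u, hu, hau⟩ := List.mem_flatten.1 ha
    exact ih (hL u hu) hau

end RatExp

/-- The formulas of metric temporal logic extended with the modality `FRat`:
`frat I re φ` is the formula `FRat_{I, re} φ`, where `re` is a rational expression over formulas. -/
inductive Formula (P : Type*) where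
  | atom (a : P)
  | tru
  | and (φ ψ : Formula P)
  | neg (φ : Formula P)
  | until (I : Interval) (φ ψ : Formula P)
  | frat (I : Interval) (re : RatExp (Formula P)) (φ : Formula P)

variable {P : Type*}

/-- `Sat ρ φ i`: the formula `φ` holds at the position `i` of `ρ`. For `FRat_{I, re} φ` there is a
later position `j` with `φ` and with its delay in `I`, and a word `w` in the language of `re`
such that the positions strictly between `i` and `j` satisfy the successive letters of `w`. -/
def Sat (ρ : TimedWord P) : Formula P → Fin (ρ.last + 1) → Prop
  | .atom a, i => a ∈ (ρ.letter i).1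
  | .tru, _ => True
  | .and φ ψ, i => Sat ρ φ i ∧ Sat ρ ψ i
  | .neg φ, i => ¬ Sat ρ φ i
  | .until I φ ψ, i =>
      ∃ j, i < j ∧ Sat ρ ψ j ∧ ρ.time j - ρ.time i ∈ I.toSet ∧
        ∀ k, i < k → k < j → Sat ρ φ k
  | .frat I re φ, i =>
      ∃ j, i < j ∧ Sat ρ φ j ∧ ρ.time j - ρ.time i ∈ I.toSet ∧
        ∃ (w : List (Formula P)) (_ : w ∈ re.lang) (_ : i.1 + 1 + w.length = j.1),
          ∀ (m : ℕ) (_ : m < w.length), Sat ρ w[m] ⟨i.1 + 1 + m, by omega⟩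
termination_by φ => sizeOf φ
decreasing_by
  all_goals simp_wf
  all_goals try omega
  have h := re.sizeOf_lt_of_mem_letters
    (re.mem_letters_of_mem_lang (by assumption) (List.getElem_mem (by assumption)))
  omega

/-- The timed words that satisfy a formula at their first position. -/
def Formula.language (φ : Formula P) : Set (TimedWord P) := {ρ | Sat ρ φ 0}

/-- `seg ρ S i j` is the word over the subsets of `S` that marks the positions strictly between
`i` and `j` with the formulas of `S` which hold there. -/
def seg (ρ : TimedWord P) (S : Set (Formula P)) (i j : Fin (ρ.last + 1)) : List (Set S) :=
  List.ofFn fun m : Fin (j.1 - i.1 - 1) =>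
    {ψ : S | Sat ρ ψ.1 ⟨i.1 + 1 + m.1, by omega⟩}

/-- The words obtained from a word of sets by choosing one element of each set. -/
def single {α : Type*} {S : Set α} (u : List (Set S)) : Language α :=
  {w | List.Forall₂ (fun a X => ∃ h : a ∈ S, (⟨a, h⟩ : S) ∈ X) w u}

/-- Star-free languages. -/
inductive IsStarFree {α : Type*} : Language α → Prop
  | zero : IsStarFree 0
  | one : IsStarFree 1
  | char (a : α) : IsStarFree {[a]}
  | add {K L : Language α} : IsStarFree K → IsStarFree L → IsStarFree (K + L)
  | mul {K L : Language α} : IsStarFree K → IsStarFree L → IsStarFree (K * L)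
  | compl {L : Language α} : IsStarFree L → IsStarFree Lᶜ

/-- A rational expression over a set `S` of formulas is equivalent to a star-free one over the
subsets of `S`: some star-free language contains the marking `seg ρ S i j` of a segment if and
only if the segment matches the rational expression. -/
def HasStarFreeEquivalent (re : RatExp (Formula P)) : Prop :=
  ∃ K : Language (Set re.letters), IsStarFree K ∧
    ∀ (ρ : TimedWord P) (i j : Fin (ρ.last + 1)), i < j →
      (seg ρ re.letters i j ∈ K ↔ ∃ w, w ∈ single (seg ρ re.letters i j) ∧ w ∈ re.lang)

/-- All rational expressions in the formula have star-free equivalents. -/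
inductive Formula.IsSfr : Formula P → Prop
  | atom (a : P) : IsSfr (.atom a)
  | tru : IsSfr .tru
  | and {φ ψ : Formula P} : IsSfr φ → IsSfr ψ → IsSfr (.and φ ψ)
  | neg {φ : Formula P} : IsSfr φ → IsSfr (.neg φ)
  | until {I : Interval} {φ ψ : Formula P} : IsSfr φ → IsSfr ψ → IsSfr (.until I φ ψ)
  | frat {I : Interval} {re : RatExp (Formula P)} {φ : Formula P} :
      HasStarFreeEquivalent re → (∀ ψ ∈ re.letters, IsSfr ψ) → IsSfr φ → IsSfr (.frat I re φ)

/-- All intervals in the formula are non-punctual. -/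
inductive Formula.IsNonPunctual : Formula P → Prop
  | atom (a : P) : IsNonPunctual (.atom a)
  | tru : IsNonPunctual .tru
  | and {φ ψ : Formula P} : IsNonPunctual φ → IsNonPunctual ψ → IsNonPunctual (.and φ ψ)
  | neg {φ : Formula P} : IsNonPunctual φ → IsNonPunctual (.neg φ)
  | until {I : Interval} {φ ψ : Formula P} :
      ¬ I.Punctual → IsNonPunctual φ → IsNonPunctual ψ → IsNonPunctual (.until I φ ψ)
  | frat {I : Interval} {re : RatExp (Formula P)} {φ : Formula P} :
      ¬ I.Punctual → (∀ ψ ∈ re.letters, IsNonPunctual ψ) → IsNonPunctual φ →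
        IsNonPunctual (.frat I re φ)

/-! ### The classes and their comparison -/

/-- Conjunctive-disjunctive automata with loop-free resets. -/
def CDLfr (P : Type*) : Set (OneATA P) :=
  {A | A.IsConjunctiveDisjunctive ∧ A.HasLoopFreeResets}

/-- Partially ordered conjunctive-disjunctive automata. -/
def CDPO (P : Type*) : Set (OneATA P) :=
  {A | A.IsConjunctiveDisjunctive ∧ A.IsPartiallyOrdered}

/-- Automata all of whose clock constraints are non-punctual. -/
def NPAutomata (P : Type*) : Set (OneATA P) := {A | A.IsNonPunctual}

/-- The logic `FRatMTL`. -/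
def FRatMTL (P : Type*) : Set (Formula P) := Set.univ

/-- The logic `FSfrMTL`. -/
def FSfrMTL (P : Type*) : Set (Formula P) := {φ | φ.IsSfr}

/-- The logic `FRatMITL`. -/
def FRatMITL (P : Type*) : Set (Formula P) := {φ | φ.IsNonPunctual}

/-- The logic `FSfrMITL`. -/
def FSfrMITL (P : Type*) : Set (Formula P) := {φ | φ.IsSfr ∧ φ.IsNonPunctual}

/-- A class of automata and a class of formulas are expressively equivalent: each language of the
one class is a language of the other. -/
def ExpressivelyEquivalent (F : Set (OneATA P)) (G : Set (Formula P)) : Prop :=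
  (∀ A ∈ F, ∃ φ ∈ G, A.language = φ.language) ∧
    (∀ φ ∈ G, ∃ A ∈ F, φ.language = A.language)

end ATA

/-!
The states of a configuration evolve independently of each other, and whether a location accepts the
rest of a word depends only on the time at which its clock was last reset.

*From automata to logic.* In a disjunctive island the clock keeps its reset time, and a run from the
header is a path of free locations that ends either at an accepting location or at a clause without
free location. By recursion on the order of the headers, a reset location amounts to a formula, so
the labels of the paths are formulas, the paths form a rational expression (Kleene's algorithm), and
the clock constraint of the last clause becomes the interval of an `FRat` modality. Conjunctive
islands are dual. For partially ordered automata a path can only loop at single locations, so that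
the expression applies the star to single letters only.

*From logic to automata.* The islands are the position automata (Glushkov) of the expressions. If
only single letters are starred, then the position automaton can loop at single positions only, and
the resulting automaton is partially ordered.

*Star-free expressions.* A star-free language is regular and aperiodic, hence recognised by a
counter-free action. If a letter `c` acts nontrivially then its image is a smaller set of states, on
which the blocks between consecutive occurrences of `c` act as new letters; these letters are again
expressed by formulas. Induction on the number of states and the set of letters turns the action
into expressions in which only single letters are starred, at the price of richer formulas as
letters.
-/

namespace ATA

universe u

variable {P : Type*}

/-! ### Satisfaction at natural-number positions -/

/-- The position `n`, or the last position if there is no position `n`. -/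
def TimedWord.pos (ρ : TimedWord P) (n : ℕ) : Fin (ρ.last + 1) := ⟨min n ρ.last, by omega⟩

/-- The time stamp of the position `n`. -/
def TimedWord.timeAt (ρ : TimedWord P) (n : ℕ) : ℝ := ρ.time (ρ.pos n)

/-- The symbol at the position `n`. -/
def TimedWord.letterAt (ρ : TimedWord P) (n : ℕ) : Letter P := ρ.letter (ρ.pos n)

theorem TimedWord.val_pos (ρ : TimedWord P) {n : ℕ} (h : n ≤ ρ.last) : (ρ.pos n).1 = n :=
  min_eq_left h

theorem TimedWord.pos_eq (ρ : TimedWord P) {n : ℕ} (h : n < ρ.last + 1) : ρ.pos n = ⟨n, h⟩ :=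
  Fin.ext (ρ.val_pos (Nat.le_of_lt_succ h))

theorem TimedWord.pos_val (ρ : TimedWord P) (i : Fin (ρ.last + 1)) : ρ.pos i.1 = i :=
  ρ.pos_eq i.2

theorem TimedWord.timeAt_mono (ρ : TimedWord P) : Monotone ρ.timeAt := by
  intro i j h
  apply ρ.time_mono
  simp only [TimedWord.pos, Fin.mk_le_mk]
  omega

theorem TimedWord.timeAt_zero (ρ : TimedWord P) : ρ.timeAt 0 = 0 := by
  rw [TimedWord.timeAt, ← ρ.time_zero]
  congr 1

/-- Satisfaction at the position `n`. -/
def SatAt (ρ : TimedWord P) (φ : Formula P) (n : ℕ) : Prop := Sat ρ φ (ρ.pos n)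

/-- The positions from `i` on satisfy the formulas of the successive letters of a word. -/
def Labelled {Δ : Type*} (ρ : TimedWord P) (χ : Δ → Formula P) : ℕ → List Δ → Prop
  | _, [] => True
  | i, a :: v => SatAt ρ (χ a) i ∧ Labelled ρ χ (i + 1) v

/-- The positions `i, …, j - 1` satisfy the successive letters of a word of the expression. -/
def Match (ρ : TimedWord P) (re : RatExp (Formula P)) (i j : ℕ) : Prop :=
  ∃ w ∈ re.lang, i + w.length = j ∧ Labelled ρ id i w

section Labelled

variable {Δ : Type*} {ρ : TimedWord P} {χ : Δ → Formula P}

theorem labelled_append {i : ℕ} {u v : List Δ} :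
    Labelled ρ χ i (u ++ v) ↔ Labelled ρ χ i u ∧ Labelled ρ χ (i + u.length) v := by
  induction u generalizing i with
  | nil => simp [Labelled]
  | cons a u ih => simp [Labelled, ih, and_assoc, add_assoc, add_comm 1]

theorem labelled_iff_getElem {i : ℕ} {v : List Δ} :
    Labelled ρ χ i v ↔ ∀ (m : ℕ) (h : m < v.length), SatAt ρ (χ v[m]) (i + m) := by
  induction v generalizing i with
  | nil => simp [Labelled]
  | cons a v ih =>
    rw [Labelled, ih]
    constructor
    · rintro ⟨hhead, htail⟩ (_ | m) hm
      · exact hhead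
      · rw [← add_assoc, add_right_comm]
        exact htail m (by simpa using hm)
    · refine fun h => ⟨h 0 (by simp), fun m hm => ?_⟩
      rw [add_right_comm, add_assoc]
      exact h (m + 1) (by simpa using hm)

end Labelled

section SatAt

variable {ρ : TimedWord P} {φ ψ : Formula P} {n : ℕ}

@[simp] theorem satAt_atom {a : P} : SatAt ρ (.atom a) n ↔ a ∈ (ρ.letterAt n).1 := by
  simp only [SatAt, Sat, TimedWord.letterAt]

@[simp] theorem satAt_tru : SatAt ρ .tru n := by
  simp only [SatAt, Sat]

@[simp] theorem satAt_and : SatAt ρ (.and φ ψ) n ↔ SatAt ρ φ n ∧ SatAt ρ ψ n := by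
  simp only [SatAt, Sat]

@[simp] theorem satAt_neg : SatAt ρ (.neg φ) n ↔ ¬ SatAt ρ φ n := by
  simp only [SatAt, Sat]

theorem satAt_until {I : Interval} (hn : n ≤ ρ.last) :
    SatAt ρ (.until I φ ψ) n ↔ ∃ j, n < j ∧ j ≤ ρ.last ∧ SatAt ρ ψ j ∧
      ρ.timeAt j - ρ.timeAt n ∈ I.toSet ∧ ∀ k, n < k → k < j → SatAt ρ φ k := by
  simp only [SatAt, Sat, TimedWord.timeAt, Fin.lt_def, ρ.val_pos hn]
  constructor
  · rintro ⟨j, hnj, hψ, hI, hφ⟩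
    refine ⟨j, hnj, by omega, by rwa [ρ.pos_val], by rwa [ρ.pos_val], fun k hnk hkj => hφ _ ?_ ?_⟩
    all_goals rwa [ρ.val_pos (by omega)]
  · rintro ⟨j, hnj, hj, hψ, hI, hφ⟩
    refine ⟨ρ.pos j, by rwa [ρ.val_pos hj], hψ, hI, fun k hnk hkj => ?_⟩
    rw [ρ.val_pos hj] at hkj
    exact ρ.pos_val k ▸ hφ k hnk hkj

theorem satAt_frat {I : Interval} {re : RatExp (Formula P)} (hn : n ≤ ρ.last) :
    SatAt ρ (.frat I re φ) n ↔ ∃ j, n < j ∧ j ≤ ρ.last ∧ SatAt ρ φ j ∧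
      ρ.timeAt j - ρ.timeAt n ∈ I.toSet ∧ Match ρ re (n + 1) j := by
  have pos_add : ∀ m (h : (ρ.pos n).1 + 1 + m < ρ.last + 1),
      (⟨(ρ.pos n).1 + 1 + m, h⟩ : Fin _) = ρ.pos (n + 1 + m) := fun m h => by
    rw [ρ.val_pos hn] at h
    simp only [ρ.val_pos hn, ρ.pos_eq h]
  simp only [SatAt, Sat, TimedWord.timeAt, Match, labelled_iff_getElem, id, Fin.lt_def, pos_add]
  constructor
  · rintro ⟨j, hnj, hφ, hI, w, hw, hlen, hlab⟩
    rw [ρ.val_pos hn] at hnj hlen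
    exact ⟨j, hnj, by omega, by rwa [ρ.pos_val], by rwa [ρ.pos_val], w, hw, hlen, hlab⟩
  · rintro ⟨j, hnj, hj, hφ, hI, w, hw, hlen, hlab⟩
    exact ⟨ρ.pos j, by rwa [ρ.val_pos hn, ρ.val_pos hj], hφ, hI, w, hw,
      by rwa [ρ.val_pos hn, ρ.val_pos hj], hlab⟩

end SatAt

theorem Formula.mem_language {φ : Formula P} {ρ : TimedWord P} :
    ρ ∈ φ.language ↔ SatAt ρ φ 0 := by
  simp only [Formula.language, Set.mem_ofPred_eq, SatAt]
  rw [ρ.pos_eq (Nat.succ_pos _)]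
  rfl

/-! ### Matching rational expressions -/

section Match

variable {ρ : TimedWord P} {r s : RatExp (Formula P)} {i j : ℕ}

@[simp] theorem match_eps : Match ρ .eps i j ↔ i = j := by
  simp only [Match, RatExp.lang]
  constructor
  · rintro ⟨w, hw, hl, -⟩
    cases (Language.mem_one w).1 hw
    simpa using hl
  · rintro rfl
    exact ⟨[], (Language.mem_one _).2 rfl, rfl, trivial⟩

@[simp] theorem match_letter {φ : Formula P} :
    Match ρ (.letter φ) i j ↔ i + 1 = j ∧ SatAt ρ φ i := by
  simp only [Match, RatExp.lang]
  constructor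
  · rintro ⟨w, hw, hl, h⟩
    cases (show w = [φ] from hw)
    exact ⟨hl, h.1⟩
  · rintro ⟨rfl, h⟩
    exact ⟨[φ], rfl, rfl, h, trivial⟩

@[simp] theorem match_alt : Match ρ (.alt r s) i j ↔ Match ρ r i j ∨ Match ρ s i j := by
  simp only [Match, RatExp.lang, Language.mem_add, or_and_right, exists_or]

@[simp] theorem match_cat :
    Match ρ (.cat r s) i j ↔ ∃ k, Match ρ r i k ∧ Match ρ s k j := by
  simp only [Match, RatExp.lang]
  constructor
  · rintro ⟨w, hw, hl, h⟩
    obtain ⟨u, hu, v, hv, rfl⟩ := Language.mem_mul.1 hw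
    obtain ⟨hlu, hlv⟩ := labelled_append.1 h
    rw [List.length_append, ← add_assoc] at hl
    exact ⟨i + u.length, ⟨u, hu, rfl, hlu⟩, v, hv, hl, hlv⟩
  · rintro ⟨k, ⟨u, hu, rfl, hlu⟩, v, hv, rfl, hlv⟩
    exact ⟨u ++ v, Language.mem_mul.2 ⟨u, hu, v, hv, rfl⟩, by rw [List.length_append, add_assoc],
      labelled_append.2 ⟨hlu, hlv⟩⟩

theorem match_star :
    Match ρ (.star r) i j ↔ Relation.ReflTransGen (Match ρ r) i j := by
  constructor
  · rintro ⟨w, hw, hl, h⟩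
    obtain ⟨L, rfl, hL⟩ := Language.mem_kstar.1 hw
    clear hw
    induction L generalizing i with
    | nil =>
      obtain rfl : i = j := by simpa using hl
      exact .refl
    | cons u L ih =>
      rw [List.flatten_cons] at hl h
      rw [List.length_append, ← add_assoc] at hl
      obtain ⟨hu, hrest⟩ := labelled_append.1 h
      exact .head ⟨u, hL u (by simp), rfl, hu⟩ (ih (fun y hy => hL y (by simp [hy])) hl hrest)
  · intro h
    induction h using Relation.ReflTransGen.head_induction_on with
    | refl => exact ⟨[], Language.nil_mem_kstar _, rfl, trivial⟩
    | head hr _ ih =>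
      obtain ⟨u, hu, rfl, hlu⟩ := hr
      obtain ⟨v, hv, rfl, hlv⟩ := ih
      obtain ⟨L, rfl, hL⟩ := Language.mem_kstar.1 hv
      refine ⟨u ++ L.flatten, Language.mem_kstar.2 ⟨u :: L, by simp, ?_⟩,
        by rw [List.length_append, add_assoc], labelled_append.2 ⟨hlu, hlv⟩⟩
      simpa using ⟨hu, hL⟩

theorem Match.le (h : Match ρ r i j) : i ≤ j := by
  obtain ⟨w, -, rfl, -⟩ := h
  omega

theorem match_star_letter {φ : Formula P} :
    Match ρ (.star (.letter φ)) i j ↔ i ≤ j ∧ ∀ k, i ≤ k → k < j → SatAt ρ φ k := by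
  rw [match_star]
  constructor
  · intro h
    induction h using Relation.ReflTransGen.head_induction_on with
    | refl => exact ⟨le_rfl, fun k _ _ => by omega⟩
    | head hmatch _ ih =>
      obtain ⟨rfl, hφ⟩ := match_letter.1 hmatch
      refine ⟨by omega, fun k hk hkj => ?_⟩
      rcases Nat.eq_or_lt_of_le hk with rfl | hk
      · exact hφ
      · exact ih.2 k hk hkj
  · rintro ⟨hij, h⟩
    obtain ⟨d, rfl⟩ := Nat.exists_eq_add_of_le hij
    clear hij
    induction d with
    | zero => exact .refl
    | succ d ih =>
      refine .tail (ih fun k hk hkd => h k hk (by omega)) ?_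
      exact match_letter.2 ⟨by omega, h _ (by omega) (by omega)⟩

theorem satAt_until_iff_frat {I : Interval} {φ ψ : Formula P} (hi : i ≤ ρ.last) :
    SatAt ρ (.until I φ ψ) i ↔ SatAt ρ (.frat I (.star (.letter φ)) ψ) i := by
  rw [satAt_until hi, satAt_frat hi]
  simp only [match_star_letter]
  refine exists_congr fun j => and_congr_right fun hj => ?_
  refine and_congr_right fun _ => and_congr_right fun _ => and_congr_right fun _ => ?_
  exact ⟨fun h => ⟨hj, fun k hk => h k hk⟩, fun h k hk => h.2 k hk⟩

end Match

/-! ### Derived connectives -/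

/-- The formula that holds nowhere. -/
def Formula.fls : Formula P := .neg .tru

/-- Finite disjunctions. -/
def Formula.orList : List (Formula P) → Formula P
  | [] => .fls
  | φ :: l => .neg (.and (.neg φ) (.neg (Formula.orList l)))

/-- Finite conjunctions. -/
def Formula.andList : List (Formula P) → Formula P
  | [] => .tru
  | φ :: l => .and φ (Formula.andList l)

/-- Disjunctions over finite types. -/
noncomputable def Formula.iOr {ι : Type*} [Finite ι] (f : ι → Formula P) : Formula P :=
  have := Fintype.ofFinite ι
  .orList (Finset.univ.toList.map f)

/-- Conjunctions over finite types. -/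
noncomputable def Formula.iAnd {ι : Type*} [Finite ι] (f : ι → Formula P) : Formula P :=
  have := Fintype.ofFinite ι
  .andList (Finset.univ.toList.map f)

/-- There is no later position. -/
def Formula.atEnd : Formula P := .neg (.until (.ci 0) .tru .tru)

/-- There is no later position, or the next one has the same time stamp. -/
def Formula.nextSimul : Formula P := .neg (.until (.oi 0) .fls .tru)

section

variable {ρ : TimedWord P} {n : ℕ}

@[simp] theorem not_satAt_fls : ¬ SatAt ρ .fls n := by simp [Formula.fls]

@[simp] theorem satAt_orList {l : List (Formula P)} :
    SatAt ρ (.orList l) n ↔ ∃ φ ∈ l, SatAt ρ φ n := by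
  induction l with
  | nil => simp [Formula.orList]
  | cons φ l ih =>
    simp only [Formula.orList, satAt_neg, satAt_and, ih, List.exists_mem_cons_iff, not_and_or,
      not_not]

@[simp] theorem satAt_andList {l : List (Formula P)} :
    SatAt ρ (.andList l) n ↔ ∀ φ ∈ l, SatAt ρ φ n := by
  induction l with
  | nil => simp [Formula.andList]
  | cons φ l ih => simp [Formula.andList, ih]

@[simp] theorem satAt_iOr {ι : Type*} [Finite ι] {f : ι → Formula P} :
    SatAt ρ (.iOr f) n ↔ ∃ i, SatAt ρ (f i) n := by
  simp [Formula.iOr]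

@[simp] theorem satAt_iAnd {ι : Type*} [Finite ι] {f : ι → Formula P} :
    SatAt ρ (.iAnd f) n ↔ ∀ i, SatAt ρ (f i) n := by
  simp [Formula.iAnd]

theorem satAt_atEnd (hn : n ≤ ρ.last) : SatAt ρ .atEnd n ↔ n = ρ.last := by
  rw [Formula.atEnd, satAt_neg, satAt_until hn]
  constructor
  · intro h
    by_contra hne
    refine h ⟨n + 1, by omega, by omega, satAt_tru, ?_, fun _ _ _ => satAt_tru⟩
    have := ρ.timeAt_mono (Nat.le_succ n)
    simpa [Interval.toSet] using this
  · rintro rfl ⟨j, hlt, hle, -⟩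
    omega

theorem satAt_nextSimul (hn : n < ρ.last) :
    SatAt ρ .nextSimul n ↔ ρ.timeAt (n + 1) = ρ.timeAt n := by
  rw [Formula.nextSimul, satAt_neg, satAt_until hn.le]
  have hm := ρ.timeAt_mono (Nat.le_succ n)
  constructor
  · intro h
    by_contra hne
    refine h ⟨n + 1, by omega, by omega, satAt_tru, ?_, fun _ _ _ => by omega⟩
    simpa [Interval.toSet] using lt_of_le_of_ne hm (Ne.symm hne)
  · rintro h ⟨j, hnj, -, -, hI, hfls⟩
    obtain rfl : j = n + 1 := by
      by_contra hne
      exact not_satAt_fls (hfls (n + 1) (by omega) (by omega))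
    simp [Interval.toSet, h] at hI

end

/-! ### Formulas with restricted intervals and expressions -/

/-- All intervals of the formula satisfy `J` and all its rational expressions satisfy `R`. -/
inductive Formula.Within (J : Interval → Prop) (R : RatExp (Formula P) → Prop) : Formula P → Prop
  | atom (a : P) : Within J R (.atom a)
  | tru : Within J R .tru
  | and {φ ψ : Formula P} : Within J R φ → Within J R ψ → Within J R (.and φ ψ)
  | neg {φ : Formula P} : Within J R φ → Within J R (.neg φ)
  | until {I : Interval} {φ ψ : Formula P} :
      J I → Within J R φ → Within J R ψ → Within J R (.until I φ ψ)
  | frat {I : Interval} {re : RatExp (Formula P)} {φ : Formula P} :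
      J I → R re → (∀ ψ ∈ re.letters, Within J R ψ) → Within J R φ → Within J R (.frat I re φ)

namespace Formula.Within

variable {J J' : Interval → Prop} {R R' : RatExp (Formula P) → Prop}

theorem fls : Formula.Within J R (.fls : Formula P) := .neg .tru

theorem orList {l : List (Formula P)} (h : ∀ φ ∈ l, φ.Within J R) :
    (Formula.orList l).Within J R := by
  induction l with
  | nil => exact fls
  | cons φ l ih =>
    exact .neg (.and (.neg (h φ (by simp))) (.neg (ih fun ψ hψ => h ψ (by simp [hψ]))))

theorem orPair {φ ψ : Formula P} (hφ : φ.Within J R) (hψ : ψ.Within J R) :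
    (Formula.orList [φ, ψ]).Within J R :=
  .orList (by simp [hφ, hψ])

theorem andList {l : List (Formula P)} (h : ∀ φ ∈ l, φ.Within J R) :
    (Formula.andList l).Within J R := by
  induction l with
  | nil => exact .tru
  | cons φ l ih => exact .and (h φ (by simp)) (ih fun ψ hψ => h ψ (by simp [hψ]))

theorem iOr {ι : Type*} [Finite ι] {f : ι → Formula P} (h : ∀ i, (f i).Within J R) :
    (Formula.iOr f).Within J R :=
  orList fun φ hφ => by
    obtain ⟨i, -, rfl⟩ := List.mem_map.1 hφ
    exact h i

theorem iAnd {ι : Type*} [Finite ι] {f : ι → Formula P} (h : ∀ i, (f i).Within J R) :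
    (Formula.iAnd f).Within J R :=
  andList fun φ hφ => by
    obtain ⟨i, -, rfl⟩ := List.mem_map.1 hφ
    exact h i

theorem mono (hJ : ∀ I, J I → J' I) (hR : ∀ re, R re → R' re) {φ : Formula P}
    (h : φ.Within J R) : φ.Within J' R' := by
  induction h <;> constructor <;> solve_by_elim

theorem and_within {φ : Formula P} (h : φ.Within J R) (h' : φ.Within J' R') :
    φ.Within (fun I => J I ∧ J' I) fun re => R re ∧ R' re := by
  induction h with
  | frat hI hre _ _ ihre ihφ =>
    obtain _ | _ | _ | _ | _ | ⟨hI', hre', hl, hφ⟩ := h'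
    exact .frat ⟨hI, hI'⟩ ⟨hre, hre'⟩ (fun ψ hψ => ihre ψ hψ (hl ψ hψ)) (ihφ hφ)
  | _ => cases h'; constructor <;> solve_by_elim

end Formula.Within

theorem Formula.isNonPunctual_iff_within {φ : Formula P} :
    φ.IsNonPunctual ↔ φ.Within (fun I => ¬ I.Punctual) fun _ => True := by
  constructor <;> intro h <;> induction h <;> constructor <;> first | assumption | trivial

theorem Formula.isSfr_iff_within {φ : Formula P} :
    φ.IsSfr ↔ φ.Within (fun _ => True) HasStarFreeEquivalent := by
  constructor <;> intro h <;> induction h <;> constructor <;> first | assumption | trivial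

theorem Formula.within_true (φ : Formula P) : φ.Within (fun _ => True) fun _ => True := by
  match φ with
  | .atom a => exact .atom a
  | .tru => exact .tru
  | .and φ ψ => exact .and φ.within_true ψ.within_true
  | .neg φ => exact .neg φ.within_true
  | .until I φ ψ => exact .until trivial φ.within_true ψ.within_true
  | .frat I re φ => exact .frat trivial trivial (fun ψ _ => ψ.within_true) φ.within_true
termination_by sizeOf φ
decreasing_by
  all_goals simp_wf
  all_goals try omega
  have := re.sizeOf_lt_of_mem_letters ‹_›
  omega

theorem RatExp.finite_letters {α : Type*} (r : RatExp α) : r.letters.Finite := by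
  induction r with
  | eps => exact Set.finite_empty
  | letter a => exact Set.finite_singleton a
  | cat _ _ hr hs | alt _ _ hr hs => exact hr.union hs
  | star _ hr => exact hr

/-! ### Star-free languages -/

section StarFree

variable {α : Type*}

theorem IsStarFree.top : IsStarFree (⊤ : Language α) :=
  compl_bot (α := Language α) ▸ IsStarFree.zero.compl

/-- The words of one letter, which belongs to `A`. -/
def letterLang (A : Set α) : Language α := {w | ∃ a ∈ A, w = [a]}

/-- The words all of whose letters belong to `A`. -/
def starLang (A : Set α) : Language α := {w | ∀ a ∈ w, a ∈ A}

theorem isStarFree_letterLang {A : Set α} (hA : A.Finite) : IsStarFree (letterLang A) := by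
  induction A, hA using Set.Finite.induction_on with
  | empty =>
    have hzero : letterLang (∅ : Set α) = 0 := by
      ext w
      exact iff_of_false (by rintro ⟨_, ⟨⟩, -⟩) (Language.notMem_zero w)
    exact hzero ▸ .zero
  | @insert a s _ _ ih =>
    have hadd : letterLang (insert a s) = {[a]} + letterLang s := by
      ext w
      rw [Language.mem_add]
      exact Set.exists_mem_insert
    exact hadd ▸ (IsStarFree.char a).add ih

theorem starLang_eq_compl (A : Set α) : starLang A = (⊤ * letterLang Aᶜ * ⊤)ᶜ := by
  ext w
  change (∀ a ∈ w, a ∈ A) ↔ ¬ w ∈ ⊤ * letterLang Aᶜ * ⊤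
  rw [← not_iff_not, not_not]
  simp only [not_forall, exists_prop]
  constructor
  · rintro ⟨a, hw, ha⟩
    obtain ⟨u, v, rfl⟩ := List.append_of_mem hw
    exact Language.mem_mul.2 ⟨u ++ [a], Language.mem_mul.2 ⟨u, trivial, [a], ⟨a, ha, rfl⟩, rfl⟩,
      v, trivial, by simp⟩
  · intro hw
    obtain ⟨_, hmul, v, -, rfl⟩ := Language.mem_mul.1 hw
    obtain ⟨u, -, _, ⟨a, ha, rfl⟩, rfl⟩ := Language.mem_mul.1 hmul
    exact ⟨a, by simp, ha⟩

theorem isStarFree_starLang [Finite α] (A : Set α) : IsStarFree (starLang A) :=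
  starLang_eq_compl A ▸ ((IsStarFree.top.mul (isStarFree_letterLang Aᶜ.toFinite)).mul .top).compl

end StarFree

/-! ### Expressions in which only single letters are iterated -/

/-- The star is applied to single letters only. -/
inductive RatExp.IsLetterStar {α : Type*} : RatExp α → Prop
  | eps : IsLetterStar .eps
  | letter (a : α) : IsLetterStar (.letter a)
  | cat {r s : RatExp α} : IsLetterStar r → IsLetterStar s → IsLetterStar (.cat r s)
  | alt {r s : RatExp α} : IsLetterStar r → IsLetterStar s → IsLetterStar (.alt r s)
  | star (a : α) : IsLetterStar (.star (.letter a))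

namespace RatExp

variable {α : Type*} {S : Set α}

/-- The words of sets from which a word of the expression can be chosen. -/
def setLang (S : Set α) (r : RatExp α) : Language (Set S) :=
  {u | ∃ w, w ∈ single u ∧ w ∈ r.lang}

/-- The subsets of `S` that contain `a`; there are none if `a ∉ S`. -/
def containing (S : Set α) (a : α) : Set (Set S) := {X | ∃ h : a ∈ S, ⟨a, h⟩ ∈ X}

theorem setLang_eps : setLang S .eps = 1 := by
  ext u
  rw [Language.mem_one]
  constructor
  · rintro ⟨w, hwu, hw⟩
    cases (Language.mem_one w).1 hw
    exact List.forall₂_nil_left_iff.1 hwu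
  · rintro rfl
    exact ⟨[], .nil, (Language.mem_one _).2 rfl⟩

theorem setLang_letter (a : α) : setLang S (.letter a) = letterLang (containing S a) := by
  ext u
  constructor
  · rintro ⟨w, hwu, hw⟩
    cases (show w = [a] from hw)
    obtain ⟨X, _, hX, hnil, rfl⟩ := List.forall₂_cons_left_iff.1 hwu
    cases List.forall₂_nil_left_iff.1 hnil
    exact ⟨X, hX, rfl⟩
  · rintro ⟨X, hX, rfl⟩
    exact ⟨[a], .cons hX .nil, rfl⟩

theorem setLang_alt (r s : RatExp α) : setLang S (.alt r s) = setLang S r + setLang S s := by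
  ext u
  simp only [Language.mem_add, setLang, lang, and_or_left, exists_or]
  rfl

theorem setLang_cat (r s : RatExp α) : setLang S (.cat r s) = setLang S r * setLang S s := by
  ext u
  rw [Language.mem_mul]
  constructor
  · rintro ⟨w, hwu, hw⟩
    obtain ⟨w₁, hw₁, w₂, hw₂, rfl⟩ := Language.mem_mul.1 hw
    exact ⟨u.take w₁.length, ⟨w₁, (List.forall₂_take_append _ _ _ hwu.flip).flip, hw₁⟩,
      u.drop w₁.length, ⟨w₂, (List.forall₂_drop_append _ _ _ hwu.flip).flip, hw₂⟩,
      List.take_append_drop _ _⟩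
  · rintro ⟨u₁, ⟨w₁, hwu₁, hw₁⟩, u₂, ⟨w₂, hwu₂, hw₂⟩, rfl⟩
    exact ⟨w₁ ++ w₂, List.rel_append hwu₁ hwu₂, Language.mem_mul.2 ⟨w₁, hw₁, w₂, hw₂, rfl⟩⟩

theorem mem_lang_star_letter {a : α} {w : List α} :
    w ∈ (star (letter a)).lang ↔ ∀ b ∈ w, b = a := by
  constructor
  · intro hw b hb
    simpa [letters] using mem_letters_of_mem_lang (.star (.letter a)) hw hb
  · intro hw
    obtain ⟨n, rfl⟩ : ∃ n, w = List.replicate n a := ⟨_, List.eq_replicate_of_mem hw⟩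
    exact Language.mem_kstar.2
      ⟨List.replicate n [a], by simp, fun _ hy => List.eq_of_mem_replicate hy⟩

theorem setLang_star_letter (a : α) :
    setLang S (.star (.letter a)) = starLang (containing S a) := by
  ext u
  change (∃ w, w ∈ single u ∧ w ∈ (star (letter a)).lang) ↔ ∀ X ∈ u, X ∈ containing S a
  simp only [mem_lang_star_letter]
  constructor
  · rintro ⟨w, hwu, hw⟩
    induction hwu with
    | nil => simp
    | cons hX _ ih =>
      obtain rfl := hw _ List.mem_cons_self
      exact List.forall_mem_cons.2 ⟨hX, ih fun b hb => hw b (List.mem_cons_of_mem _ hb)⟩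
  · intro hu
    refine ⟨List.replicate u.length a, ?_, fun b hb => List.eq_of_mem_replicate hb⟩
    induction u with
    | nil => exact .nil
    | cons X u ih =>
      obtain ⟨hX, hu⟩ := List.forall_mem_cons.1 hu
      exact .cons hX (ih hu)

theorem IsLetterStar.isStarFree_setLang [Finite S] {r : RatExp α} (h : r.IsLetterStar) :
    IsStarFree (r.setLang S) := by
  induction h with
  | eps => exact setLang_eps ▸ .one
  | letter a => exact setLang_letter a ▸ isStarFree_letterLang (Set.toFinite _)
  | cat _ _ ihr ihs => exact setLang_cat _ _ ▸ ihr.mul ihs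
  | alt _ _ ihr ihs => exact setLang_alt _ _ ▸ ihr.add ihs
  | star a => exact setLang_star_letter a ▸ isStarFree_starLang _

theorem IsLetterStar.hasStarFreeEquivalent {r : RatExp (Formula P)}
    (h : r.IsLetterStar) : HasStarFreeEquivalent r :=
  have : Finite r.letters := r.finite_letters
  ⟨_, h.isStarFree_setLang, fun _ _ _ _ => Iff.rfl⟩

end RatExp

/-! ### Star-free languages are aperiodic -/

/-- The `n`-th power of a word. -/
def wpow {α : Type*} (n : ℕ) (w : List α) : List α := (List.replicate n w).flatten

section Aperiodic

variable {α : Type*}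

@[simp] theorem wpow_zero (w : List α) : wpow 0 w = [] := rfl

theorem wpow_succ (n : ℕ) (w : List α) : wpow (n + 1) w = w ++ wpow n w := by
  simp [wpow, List.replicate_succ]

theorem wpow_add (m n : ℕ) (w : List α) : wpow (m + n) w = wpow m w ++ wpow n w := by
  rw [wpow, ← List.replicate_append_replicate, List.flatten_append]; rfl

theorem wpow_mul (m n : ℕ) (w : List α) : wpow (m * n) w = wpow m (wpow n w) := by
  induction m with
  | zero => simp
  | succ m ih => rw [Nat.succ_mul, Nat.add_comm, wpow_add, wpow_succ, ih]

theorem wpow_one (w : List α) : wpow 1 w = w := by simp [wpow]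

theorem length_wpow (n : ℕ) (w : List α) : (wpow n w).length = n * w.length := by
  simp [wpow]

/-- A language is aperiodic if large powers of a word can be exchanged for one another. -/
def IsAperiodic (L : Language α) : Prop :=
  ∃ n, ∀ m m', n ≤ m → n ≤ m' → ∀ x y z, x ++ wpow m y ++ z ∈ L → x ++ wpow m' y ++ z ∈ L

theorem append_wpow_eq_append {n : ℕ} {x y z u v : List α} (h : x ++ wpow n y ++ z = u ++ v) :
    (∃ x', x = u ++ x' ∧ v = x' ++ wpow n y ++ z) ∨
    (∃ p q y₁ y₂, n = p + 1 + q ∧ y = y₁ ++ y₂ ∧ u = x ++ wpow p y ++ y₁ ∧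
      v = y₂ ++ wpow q y ++ z) ∨
    ∃ z', u = x ++ wpow n y ++ z' ∧ z = z' ++ v := by
  induction n generalizing x with
  | zero =>
    simp only [wpow_zero, List.append_nil] at h ⊢
    rcases List.append_eq_append_iff.1 h with ⟨a, rfl, rfl⟩ | ⟨a, rfl, rfl⟩
    · exact Or.inr (Or.inr ⟨a, rfl, rfl⟩)
    · exact Or.inl ⟨a, rfl, rfl⟩
  | succ n ih =>
    rw [wpow_succ, ← List.append_assoc] at h
    rcases ih h with ⟨x', hx, rfl⟩ | ⟨p, q, y₁, y₂, rfl, hy, rfl, rfl⟩ | ⟨z', rfl, rfl⟩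
    · rcases List.append_eq_append_iff.1 hx with ⟨a, rfl, rfl⟩ | ⟨a, rfl, rfl⟩
      · exact Or.inr (Or.inl ⟨0, n, a, x', by omega, rfl, by simp, rfl⟩)
      · exact Or.inl ⟨a, rfl, by simp [wpow_succ]⟩
    · exact Or.inr (Or.inl ⟨p + 1, q, y₁, y₂, by omega, hy, by simp [wpow_succ], rfl⟩)
    · exact Or.inr (Or.inr ⟨z', by simp [wpow_succ], rfl⟩)

theorem IsAperiodic.mul {K L : Language α} (hK : IsAperiodic K) (hL : IsAperiodic L) :
    IsAperiodic (K * L) := by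
  obtain ⟨n₁, hK⟩ := hK
  obtain ⟨n₂, hL⟩ := hL
  refine ⟨n₁ + n₂ + 1, fun m m' hm hm' x y z h => ?_⟩
  obtain ⟨u, hu, v, hv, huv⟩ := Language.mem_mul.1 h
  rcases append_wpow_eq_append huv.symm with ⟨x', rfl, rfl⟩ |
    ⟨p, q, y₁, y₂, rfl, rfl, rfl, rfl⟩ | ⟨z', rfl, rfl⟩
  · exact Language.mem_mul.2 ⟨u, hu, _, hL m m' (by omega) (by omega) _ _ _ hv, by simp⟩
  · obtain ⟨p', q', rfl, hp, hq⟩ : ∃ p' q', m' = p' + 1 + q' ∧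
        (p' = p ∨ n₁ ≤ p ∧ n₁ ≤ p') ∧ (q' = q ∨ n₂ ≤ q ∧ n₂ ≤ q') := by
      by_cases hp : n₁ ≤ p
      · by_cases hq : n₂ ≤ q
        · exact ⟨n₁, m' - n₁ - 1, by omega, by omega, by omega⟩
        · exact ⟨m' - q - 1, q, by omega, by omega, by omega⟩
      · exact ⟨p, m' - p - 1, by omega, by omega, by omega⟩
    have hu' : x ++ wpow p' (y₁ ++ y₂) ++ y₁ ∈ K := by
      rcases hp with rfl | ⟨hp, hp'⟩
      · exact hu
      · exact hK p p' hp hp' _ _ _ hu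
    have hv' : y₂ ++ wpow q' (y₁ ++ y₂) ++ z ∈ L := by
      rcases hq with rfl | ⟨hq, hq'⟩
      · exact hv
      · exact hL q q' hq hq' _ _ _ hv
    refine Language.mem_mul.2 ⟨_, hu', _, hv', ?_⟩
    simp [wpow_add, wpow_one]
  · exact Language.mem_mul.2 ⟨_, hK m m' (by omega) (by omega) _ _ _ hu, v, hv, by simp⟩

theorem isAperiodic_of_length_le {L : Language α} {k : ℕ} (h : ∀ w ∈ L, w.length ≤ k) :
    IsAperiodic L := by
  refine ⟨k + 1, fun m m' hm _ x y z hL => ?_⟩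
  have hlen := h _ hL
  simp only [List.length_append, length_wpow] at hlen
  obtain rfl : y = [] := by
    rw [← List.length_eq_zero_iff]
    by_contra hy
    nlinarith [Nat.pos_of_ne_zero hy]
  simpa [wpow] using hL

theorem IsStarFree.isAperiodic {L : Language α} (h : IsStarFree L) : IsAperiodic L := by
  induction h with
  | zero => exact isAperiodic_of_length_le (k := 0) fun w hw => absurd hw (Language.notMem_zero w)
  | one => exact isAperiodic_of_length_le (k := 0) fun w hw => by simp [(Language.mem_one w).1 hw]
  | char a =>
    exact isAperiodic_of_length_le (k := 1) fun w hw => by simp [show w = [a] from hw]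
  | add _ _ hK hL =>
    obtain ⟨n₁, hK⟩ := hK
    obtain ⟨n₂, hL⟩ := hL
    exact ⟨n₁ + n₂, fun m m' hm hm' x y z h =>
      h.imp (hK m m' (by omega) (by omega) x y z) (hL m m' (by omega) (by omega) x y z)⟩
  | mul _ _ hK hL => exact hK.mul hL
  | compl _ hL =>
    obtain ⟨n, hL⟩ := hL
    exact ⟨n, fun m m' hm hm' x y z => mt (hL m' m hm' hm x y z)⟩

end Aperiodic

/-! ### Star-free languages are regular -/

section Regular

variable {α : Type*}

theorem isRegular_of_finite {L : Language α} (hL : Set.Finite {w | w ∈ L}) : L.IsRegular := by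
  rw [Language.isRegular_iff_finite_range_leftQuotient]
  have hprefixes : (⋃ w ∈ {w | w ∈ L}, {x | x <+: w}).Finite := hL.biUnion fun w _ =>
    w.inits.finite_toSet.subset fun x hx => (List.mem_inits x w).2 hx
  refine ((hprefixes.image L.leftQuotient).union (Set.finite_singleton 0)).subset ?_
  rintro _ ⟨x, rfl⟩
  by_cases hx : ∃ z, x ++ z ∈ L
  · obtain ⟨z, hz⟩ := hx
    exact Or.inl ⟨x, Set.mem_biUnion hz ⟨z, rfl⟩, rfl⟩
  · exact Or.inr (Language.ext fun z =>
      iff_of_false (fun hz => hx ⟨z, hz⟩) (Language.notMem_zero z))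

theorem leftQuotient_mul (K L : Language α) (x : List α) :
    (K * L).leftQuotient x = K.leftQuotient x * L +
      sSup (L.leftQuotient '' {v | ∃ u ∈ K, u ++ v = x}) := by
  ext w
  rw [Language.mem_leftQuotient, Language.mem_add, Language.mem_mul, Language.mem_mul]
  constructor
  · rintro ⟨u, hu, v, hv, huv⟩
    rcases List.append_eq_append_iff.1 huv with ⟨a, rfl, rfl⟩ | ⟨a, rfl, rfl⟩
    · exact Or.inr ⟨_, ⟨a, ⟨u, hu, rfl⟩, rfl⟩, hv⟩
    · exact Or.inl ⟨a, hu, v, hv, rfl⟩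
  · rintro (⟨u, hu, v, hv, rfl⟩ | ⟨_, ⟨v, ⟨u, hu, rfl⟩, rfl⟩, hw⟩)
    · exact ⟨x ++ u, hu, v, hv, by simp⟩
    · exact ⟨u, hu, v ++ w, hw, by simp⟩

theorem isRegular_mul {K L : Language α} (hK : K.IsRegular) (hL : L.IsRegular) :
    (K * L).IsRegular := by
  rw [Language.isRegular_iff_finite_range_leftQuotient] at *
  refine ((hK.prod hL.powerset).image fun p => p.1 * L + sSup p.2).subset ?_
  rintro _ ⟨x, rfl⟩
  exact ⟨(K.leftQuotient x, L.leftQuotient '' {v | ∃ u ∈ K, u ++ v = x}),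
    ⟨⟨x, rfl⟩, Set.image_subset_range _ _⟩, (leftQuotient_mul K L x).symm⟩

theorem IsStarFree.isRegular {L : Language α} (h : IsStarFree L) : L.IsRegular := by
  induction h with
  | zero => exact isRegular_of_finite Set.finite_empty
  | one => exact isRegular_of_finite (Set.finite_singleton [])
  | char a => exact isRegular_of_finite (Set.finite_singleton [a])
  | add _ _ hK hL => exact hK.add hL
  | mul _ _ hK hL => exact isRegular_mul hK hL
  | compl _ hL => exact hL.compl

end Regular

/-! ### Counter-free actions -/

section CounterFree

variable {Q Δ : Type*}

/-- A transition function is counter-free if no power of a word permutes states nontrivially. -/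
def IsCounterFree (step : Q → Δ → Q) : Prop :=
  ∀ (w : List Δ) (n : ℕ) (q : Q), 0 < n → (wpow n w).foldl step q = q → w.foldl step q = q

theorem foldl_wpow_eq_self {step : Q → Δ → Q} {w : List Δ} {q : Q} (h : w.foldl step q = q)
    (n : ℕ) : (wpow n w).foldl step q = q := by
  induction n with
  | zero => rfl
  | succ n ih => rw [wpow_succ, List.foldl_append, h, ih]

theorem foldl_step_toDFA (L : Language Δ) (q : Set.range L.leftQuotient) (w : List Δ) :
    (w.foldl L.toDFA.step q).1 = q.1.leftQuotient w := by
  induction w generalizing q with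
  | nil => rfl
  | cons a w ih => rw [List.foldl_cons, ih, L.step_toDFA, ← Language.leftQuotient_append]; rfl

theorem IsAperiodic.isCounterFree_toDFA {L : Language Δ} (h : IsAperiodic L) :
    IsCounterFree L.toDFA.step := by
  obtain ⟨m, h⟩ := h
  intro w n q hn hq
  have hfix : (wpow (m * n) w).foldl L.toDFA.step q = q :=
    wpow_mul m n w ▸ foldl_wpow_eq_self hq m
  have hfix' : (wpow (m * n + 1) w).foldl L.toDFA.step q = w.foldl L.toDFA.step q := by
    rw [wpow_add, List.foldl_append, hfix, wpow_one]
  suffices hexchange : (wpow (m * n + 1) w).foldl L.toDFA.step q =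
      (wpow (m * n) w).foldl L.toDFA.step q by rw [← hfix', hexchange, hfix]
  have hle : m ≤ m * n := Nat.le_mul_of_pos_right m hn
  apply Subtype.ext
  rw [foldl_step_toDFA, foldl_step_toDFA]
  obtain ⟨_, x, rfl⟩ := q
  ext z
  simp only [Language.mem_leftQuotient, ← List.append_assoc]
  exact ⟨h _ _ (by omega) hle x w z, h _ _ hle (by omega) x w z⟩

end CounterFree

/-! ### Finite alternatives of rational expressions -/

/-- Finite alternatives; the empty one is represented by a letter that holds nowhere. -/
def RatExp.altList : List (RatExp (Formula P)) → RatExp (Formula P)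
  | [] => .letter .fls
  | r :: l => .alt r (RatExp.altList l)

/-- Alternatives over finite types. -/
noncomputable def RatExp.iAlt {ι : Type*} [Finite ι] (r : ι → RatExp (Formula P)) :
    RatExp (Formula P) :=
  have := Fintype.ofFinite ι
  .altList (Finset.univ.toList.map r)

theorem match_altList {ρ : TimedWord P} {l : List (RatExp (Formula P))} {i j : ℕ} :
    Match ρ (.altList l) i j ↔ ∃ r ∈ l, Match ρ r i j := by
  induction l with
  | nil => simp [RatExp.altList]
  | cons r l ih => simp [RatExp.altList, ih]

@[simp] theorem match_iAlt {ρ : TimedWord P} {ι : Type*} [Finite ι]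
    {r : ι → RatExp (Formula P)} {i j : ℕ} :
    Match ρ (.iAlt r) i j ↔ ∃ k, Match ρ (r k) i j := by
  simp [RatExp.iAlt, match_altList]

theorem RatExp.iAlt_induction {p : RatExp (Formula P) → Prop} (fls : p (.letter .fls))
    (alt : ∀ r s, p r → p s → p (.alt r s)) {ι : Type*} [Finite ι] {r : ι → RatExp (Formula P)}
    (h : ∀ i, p (r i)) : p (.iAlt r) := by
  have haltList : ∀ l : List (RatExp (Formula P)), (∀ s ∈ l, p s) → p (.altList l) := by
    intro l hl
    induction l with
    | nil => exact fls
    | cons s l ih => exact alt _ _ (hl s (by simp)) (ih fun t ht => hl t (by simp [ht]))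
  refine haltList _ fun s hs => ?_
  obtain ⟨i, -, rfl⟩ := List.mem_map.1 hs
  exact h i

/-- All letters of the expression satisfy `p`. -/
def RatExp.LettersIn {α : Type*} (p : α → Prop) (r : RatExp α) : Prop := ∀ a ∈ r.letters, p a

namespace RatExp.LettersIn

variable {α : Type*} {p : α → Prop} {r s : RatExp α}

theorem eps : RatExp.LettersIn p .eps := fun _ h => h.elim

theorem letter {a : α} (h : p a) : RatExp.LettersIn p (.letter a) := by
  rintro _ rfl
  exact h

theorem cat (hr : r.LettersIn p) (hs : s.LettersIn p) : (r.cat s).LettersIn p :=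
  fun a ha => ha.elim (hr a) (hs a)

theorem alt (hr : r.LettersIn p) (hs : s.LettersIn p) : (r.alt s).LettersIn p :=
  fun a ha => ha.elim (hr a) (hs a)

theorem star (hr : r.LettersIn p) : r.star.LettersIn p := hr

end RatExp.LettersIn

theorem RatExp.LettersIn.iAlt {p : Formula P → Prop} (hp : p .fls) {ι : Type*} [Finite ι]
    {r : ι → RatExp (Formula P)} (h : ∀ i, (r i).LettersIn p) : (RatExp.iAlt r).LettersIn p :=
  RatExp.iAlt_induction (.letter hp) (fun _ _ => .alt) h

theorem RatExp.IsLetterStar.iAlt {ι : Type*} [Finite ι] {r : ι → RatExp (Formula P)}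
    (h : ∀ i, (r i).IsLetterStar) : (RatExp.iAlt r).IsLetterStar :=
  RatExp.iAlt_induction (.letter _) (fun _ _ => .alt) h

/-- Only letters are iterated, in the expression and hereditarily in the formulas that are its
letters, and the intervals of these formulas satisfy `J`. -/
def RatExp.LetterStarWithin (J : Interval → Prop) (r : RatExp (Formula P)) : Prop :=
  r.IsLetterStar ∧ r.LettersIn (Formula.Within J RatExp.IsLetterStar)

namespace RatExp.LetterStarWithin

variable {J : Interval → Prop} {r s : RatExp (Formula P)}

theorem letter {φ : Formula P} (h : φ.Within J RatExp.IsLetterStar) :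
    RatExp.LetterStarWithin J (.letter φ) :=
  ⟨.letter φ, .letter h⟩

theorem star {φ : Formula P} (h : φ.Within J RatExp.IsLetterStar) :
    RatExp.LetterStarWithin J (.star (.letter φ)) :=
  ⟨.star φ, .star (.letter h)⟩

theorem cat (hr : r.LetterStarWithin J) (hs : s.LetterStarWithin J) :
    (r.cat s).LetterStarWithin J :=
  ⟨hr.1.cat hs.1, hr.2.cat hs.2⟩

theorem alt (hr : r.LetterStarWithin J) (hs : s.LetterStarWithin J) :
    (r.alt s).LetterStarWithin J :=
  ⟨hr.1.alt hs.1, hr.2.alt hs.2⟩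

theorem iAlt {ι : Type*} [Finite ι] {r : ι → RatExp (Formula P)}
    (h : ∀ i, (r i).LetterStarWithin J) : (RatExp.iAlt r).LetterStarWithin J :=
  ⟨.iAlt fun i => (h i).1, .iAlt .fls fun i => (h i).2⟩

end RatExp.LetterStarWithin

/-! ### Segments labelled with words that act in a given way -/

section Exclusive

variable {Δ : Type*} {ρ : TimedWord P} {χ : Δ → Formula P} {c : Δ}

/-- At most one of the formulas holds at each position. -/
def Exclusive (χ : Δ → Formula P) : Prop :=
  ∀ (ρ : TimedWord P) (k : ℕ), k ≤ ρ.last → ∀ a b, SatAt ρ (χ a) k → SatAt ρ (χ b) k → a = b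

theorem Exclusive.labelled_unique (hχ : Exclusive χ) {i : ℕ} {u v : List Δ}
    (hu : Labelled ρ χ i u) (hv : Labelled ρ χ i v) (hlen : u.length = v.length)
    (hi : i + u.length ≤ ρ.last + 1) : u = v := by
  induction u generalizing i v with
  | nil => exact (List.length_eq_zero_iff.1 hlen.symm).symm
  | cons a u ih =>
    rcases v with _ | ⟨b, v⟩
    · simp at hlen
    · simp only [List.length_cons] at hlen hi
      rw [hχ ρ i (by omega) a b hu.1 hv.1, ih hu.2 hv.2 (by omega) (by omega)]

theorem Exclusive.labelled_append_unique (hχ : Exclusive χ) {k : ℕ} {u u' : List Δ}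
    (hu : c ∉ u) (hu' : c ∉ u') (hl : Labelled ρ χ k (u ++ [c])) (hl' : Labelled ρ χ k (u' ++ [c]))
    (hle : k + u.length ≤ ρ.last) : u = u' := by
  induction u generalizing k u' with
  | nil =>
    rcases u' with _ | ⟨a', u'⟩
    · rfl
    · exact absurd (hχ ρ k hle _ _ hl.1 hl'.1) (List.ne_of_not_mem_cons hu')
  | cons a u ih =>
    simp only [List.length_cons] at hle
    rcases u' with _ | ⟨a', u'⟩
    · exact absurd (hχ ρ k (by omega) _ _ hl'.1 hl.1) (List.ne_of_not_mem_cons hu)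
    · rw [hχ ρ k (by omega) _ _ hl.1 hl'.1,
        ih (List.not_mem_of_not_mem_cons hu) (List.not_mem_of_not_mem_cons hu') hl.2 hl'.2
          (by omega)]

end Exclusive

/-- The positions `i, …, j - 1` are labelled with a word over `A` that acts as `f` on the states. -/
def ActsOn {Q Δ : Type*} (step : Q → Δ → Q) (χ : Δ → Formula P) (A : Set Δ) (f : Q → Q)
    (ρ : TimedWord P) (i j : ℕ) : Prop :=
  ∃ v : List Δ, (∀ a ∈ v, a ∈ A) ∧ i + v.length = j ∧ (∀ q, v.foldl step q = f q) ∧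
    Labelled ρ χ i v

/-- The expression matches the segments that are labelled with a word over `A` acting as `f`. -/
def RatExp.DefinesAct {Q Δ : Type*} (step : Q → Δ → Q) (χ : Δ → Formula P) (A : Set Δ)
    (f : Q → Q) (r : RatExp (Formula P)) : Prop :=
  ∀ (ρ : TimedWord P) (i j : ℕ), j ≤ ρ.last → (Match ρ r i j ↔ ActsOn step χ A f ρ i j)

section ActsOn

variable {Q Δ : Type*} {step : Q → Δ → Q} {χ : Δ → Formula P} {A : Set Δ} {ρ : TimedWord P}
  {i j : ℕ}

theorem match_star_iOr [Finite A] :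
    Match ρ (.star (.letter (.iOr fun a : A => χ a))) i j ↔
      ∃ v : List Δ, (∀ a ∈ v, a ∈ A) ∧ i + v.length = j ∧ Labelled ρ χ i v := by
  rw [match_star_letter]
  constructor
  · rintro ⟨hij, h⟩
    obtain ⟨d, rfl⟩ := Nat.exists_eq_add_of_le hij
    clear hij
    induction d generalizing i with
    | zero => exact ⟨[], by simp, rfl, trivial⟩
    | succ d ih =>
      obtain ⟨v, hv, hlen, hlab⟩ := @ih (i + 1) fun k hk hkd => h k (by omega) (by omega)
      obtain ⟨a, ha⟩ := satAt_iOr.1 (h i (by omega) (by omega))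
      exact ⟨a :: v, List.forall_mem_cons.2 ⟨a.2, hv⟩, by grind, ha, hlab⟩
  · rintro ⟨v, hv, rfl, h⟩
    refine ⟨by omega, fun k hk hkv => ?_⟩
    have hlt : k - i < v.length := by omega
    have hsat := labelled_iff_getElem.1 h (k - i) hlt
    rw [Nat.add_sub_cancel' hk] at hsat
    exact satAt_iOr.2 ⟨⟨_, hv _ (v.getElem_mem hlt)⟩, hsat⟩

theorem exists_definesAct_of_forall_eq_self [Finite A] {J : Interval → Prop}
    (hid : ∀ a ∈ A, ∀ q, step q a = q) (hχJ : ∀ a, (χ a).Within J RatExp.IsLetterStar)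
    (f : Q → Q) :
    ∃ r : RatExp (Formula P), r.LetterStarWithin J ∧ r.DefinesAct step χ A f := by
  have hfoldl : ∀ v : List Δ, (∀ a ∈ v, a ∈ A) → ∀ q, v.foldl step q = q := by
    intro v hv q
    induction v with
    | nil => rfl
    | cons a v ih =>
      rw [List.foldl_cons, hid a (hv a (by simp)), ih fun b hb => hv b (by simp [hb])]
  by_cases hf : f = id
  · refine ⟨_, .star (.iOr fun a : A => hχJ a), fun ρ i j _ => match_star_iOr.trans ?_⟩
    refine exists_congr fun v => and_congr_right fun hv => and_congr_right fun _ => ?_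
    simp [hf, hfoldl v hv]
  · refine ⟨.letter .fls, .letter .fls, fun ρ i j _ => iff_of_false (by simp) ?_⟩
    rintro ⟨v, hv, -, hvf, -⟩
    exact hf (funext fun q => (hvf q).symm.trans (hfoldl v hv q))

end ActsOn

/-! ### The blocks between the occurrences of a letter -/

section Block

variable {Q Δ : Type*} {step : Q → Δ → Q} {χ : Δ → Formula P} {c : Δ} {B : Set Δ}
  {r : (Q → Q) → RatExp (Formula P)} {ρ : TimedWord P}

/-- The image of the states under the letter `c`. -/
abbrev ImageOf (step : Q → Δ → Q) (c : Δ) : Set Q := Set.range fun q => step q c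

/-- The functions by which words act on the states. -/
abbrev WordMaps (step : Q → Δ → Q) : Set (Q → Q) := Set.range fun (v : List Δ) q => v.foldl step q

/-- The state after the letter `c`. -/
def toImage (step : Q → Δ → Q) (c : Δ) (q : Q) : ImageOf step c := ⟨step q c, q, rfl⟩

/-- The action, on the image of `c`, of a block without `c` followed by `c`. The symbol `none`
stands for a letter inside of a block. -/
def blockStep (step : Q → Δ → Q) (c : Δ) (q : ImageOf step c) :
    Option (WordMaps step) → ImageOf step c
  | none => q
  | some t => toImage step c (t.1 q.1)

/-- `some t` labels the occurrences of `c` before a block over `B` that acts as `t` and is followed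
by `c`; `none` labels the occurrences of the letters in `B`. -/
noncomputable def blockLabel [Finite B] (step : Q → Δ → Q) (χ : Δ → Formula P) (c : Δ)
    (r : (Q → Q) → RatExp (Formula P)) : Option (WordMaps step) → Formula P
  | none => .iOr fun a : B => χ a
  | some t => .and (χ c) (.frat (.ci 0) (r t.1) (χ c))

open Classical in
/-- The block symbols of the letters of a word. -/
noncomputable def blocks (step : Q → Δ → Q) (c : Δ) : List Δ → List (Option (WordMaps step))
  | [] => []
  | a :: v =>
    (if a = c then some ⟨_, v.takeWhile (· ≠ c), rfl⟩ else none) :: blocks step c v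

theorem length_blocks (v : List Δ) : (blocks step c v).length = v.length := by
  induction v with
  | nil => rfl
  | cons a v ih => simp [blocks, ih]

open Classical in
theorem foldl_blocks (v : List Δ) (q : Q) :
    ((blocks step c v).foldl (blockStep step c) (toImage step c q)).1 =
      (v.dropWhile (· ≠ c) ++ [c]).foldl step q := by
  induction v generalizing q with
  | nil => rfl
  | cons a v ih =>
    by_cases ha : a = c
    · subst ha
      have hsplit : (v ++ [a]).foldl step (step q a) = (v.dropWhile (· ≠ a) ++ [a]).foldl step
          ((v.takeWhile (· ≠ a)).foldl step (step q a)) := by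
        rw [← List.foldl_append, ← List.append_assoc, List.takeWhile_append_dropWhile]
      simp only [blocks, if_true, List.foldl_cons, blockStep]
      simpa [toImage, hsplit] using ih _
    · simpa [blocks, ha, blockStep] using ih q

theorem foldl_blocks_of_append_eq_cons {v s : List Δ} (h : v ++ [c] = c :: s) (q : Q) :
    ((blocks step c v).foldl (blockStep step c) (toImage step c q)).1 =
      (v ++ [c]).foldl step q := by
  classical
  rw [foldl_blocks]
  rcases v with _ | ⟨a, v⟩
  · rfl
  · obtain rfl : a = c := (List.cons.inj h).1
    simp

theorem exists_foldl_blockStep (w : List (Option (WordMaps step))) :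
    ∃ v : List Δ, ∀ q, (w.foldl (blockStep step c) q).1 = v.foldl step q.1 := by
  induction w with
  | nil => exact ⟨[], fun q => rfl⟩
  | cons t w ih =>
    obtain ⟨v, hv⟩ := ih
    rcases t with _ | ⟨_, u, rfl⟩
    · exact ⟨v, fun q => hv q⟩
    · refine ⟨u ++ [c] ++ v, fun q => ?_⟩
      rw [List.foldl_cons, hv]
      simp [blockStep, toImage]

theorem IsCounterFree.blockStep (h : IsCounterFree step) : IsCounterFree (blockStep step c) := by
  intro w n q hn hq
  obtain ⟨v, hv⟩ := exists_foldl_blockStep w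
  have hpow : ∀ n q, ((wpow n w).foldl (ATA.blockStep step c) q).1 =
      (wpow n v).foldl step q.1 := by
    intro n
    induction n with
    | zero => exact fun _ => rfl
    | succ n ih =>
      intro q
      rw [wpow_succ, wpow_succ, List.foldl_append, List.foldl_append, ih, hv]
  apply Subtype.ext
  rw [hv]
  exact h v n q.1 hn (by rw [← hpow, hq])

theorem IsCounterFree.eq_self_of_bijective [Finite Q] (h : IsCounterFree step)
    (hc : Function.Bijective fun q => step q c) (q : Q) : step q c = q := by
  let σ : Equiv.Perm Q := .ofBijective _ hc
  obtain ⟨n, hn, hσ⟩ := (isOfFinOrder_of_finite σ).exists_pow_eq_one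
  have hpow : ∀ n q, (wpow n [c]).foldl step q = (σ ^ n) q := by
    intro n
    induction n with
    | zero => exact fun q => rfl
    | succ n ih =>
      intro q
      rw [wpow_succ, List.foldl_append, ih, pow_succ]
      rfl
  exact h [c] n q hn (by rw [hpow, hσ]; rfl)

theorem IsCounterFree.card_imageOf_lt [Finite Q] (h : IsCounterFree step)
    (hc : ∃ q, step q c ≠ q) : Nat.card (ImageOf step c) < Nat.card Q := by
  by_contra hlt
  obtain ⟨q, hq⟩ := hc
  have hsurj : Function.Surjective fun q => step q c := by
    rw [← Set.range_eq_univ]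
    apply Set.eq_of_subset_of_ncard_le (Set.subset_univ _)
    rw [Set.ncard_univ]
    exact not_lt.1 hlt
  exact hq (h.eq_self_of_bijective ⟨Finite.injective_iff_surjective.2 hsurj, hsurj⟩ q)

/-- The positions `k, …, z` are labelled with a word over `insert c B` that begins and ends with `c`
and acts as `g` once its first letter is read. -/
def CoreActsOn (step : Q → Δ → Q) (χ : Δ → Formula P) (c : Δ) (B : Set Δ)
    (g : ImageOf step c → ImageOf step c) (ρ : TimedWord P) (k z : ℕ) : Prop :=
  ∃ v : List Δ, (∀ a ∈ v, a ∈ insert c B) ∧ k + v.length = z ∧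
    (∀ q, (v ++ [c]).foldl step q = (g (toImage step c q)).1) ∧
    SatAt ρ (χ c) k ∧ Labelled ρ χ k (v ++ [c])

theorem exists_first_last_of_mem {v : List Δ} (h : c ∈ v) :
    ∃ u m u' s, v = u ++ (m ++ [c]) ++ u' ∧ m ++ [c] = c :: s ∧ c ∉ u ∧ c ∉ u' := by
  obtain ⟨u, v, rfl, hu⟩ := List.eq_append_cons_of_mem h
  obtain ⟨u', m, hm, hu'⟩ :=
    List.eq_append_cons_of_mem (List.mem_reverse.2 (List.mem_cons_self (a := c) (l := v)))
  have hsplit : c :: v = m.reverse ++ [c] ++ u'.reverse := by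
    simpa using congrArg List.reverse hm
  obtain ⟨s, hs⟩ : ∃ s, m.reverse ++ [c] = c :: s := by
    rcases hrev : m.reverse with _ | ⟨a, m⟩
    · exact ⟨[], rfl⟩
    · rw [hrev] at hsplit
      obtain rfl : c = a := (List.cons.inj hsplit).1
      exact ⟨m ++ [c], rfl⟩
  exact ⟨u, m.reverse, u'.reverse, s, by rw [hsplit, ← List.append_assoc], hs, hu,
    mt List.mem_reverse.1 hu'⟩

theorem actsOn_insert {f : Q → Q} {i j : ℕ} :
    ActsOn step χ (insert c B) f ρ i j ↔ ActsOn step χ B f ρ i j ∨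
      ∃ f₀ g f₁, (∀ q, f₁ (g (toImage step c (f₀ q))).1 = f q) ∧ ∃ k z,
        ActsOn step χ B f₀ ρ i k ∧ CoreActsOn step χ c B g ρ k z ∧
          ActsOn step χ B f₁ ρ (z + 1) j := by
  constructor
  · rintro ⟨v, hvB, rfl, hvf, hv⟩
    by_cases hcv : c ∈ v
    · obtain ⟨u, m, u', s, rfl, hs, hu, hu'⟩ := exists_first_last_of_mem hcv
      simp only [labelled_append, List.length_append, List.length_singleton] at hv
      obtain ⟨⟨hul, hml⟩, hul'⟩ := hv
      have hB : ∀ a ∈ u ++ (m ++ [c]) ++ u', a ≠ c → a ∈ B := fun a ha => (hvB a ha).resolve_left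
      refine .inr ⟨fun q => u.foldl step q, fun p => (blocks step c m).foldl (blockStep step c) p,
        fun q => u'.foldl step q, fun q => ?_, i + u.length, i + u.length + m.length,
        ⟨u, fun a ha => hB a (by simp [ha]) (ne_of_mem_of_not_mem ha hu), rfl, fun _ => rfl, hul⟩,
        ⟨m, fun a ha => hvB a (by simp [ha]), rfl,
          fun q => (foldl_blocks_of_append_eq_cons hs q).symm, ?_, labelled_append.2 hml⟩,
        u', fun a ha => hB a (by simp [ha]) (ne_of_mem_of_not_mem ha hu'), by grind,
        fun _ => rfl, by convert hul' using 1; omega⟩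
      · simp only [foldl_blocks_of_append_eq_cons hs, ← hvf, List.foldl_append]
      · have hms : Labelled ρ χ (i + u.length) (m ++ [c]) := labelled_append.2 hml
        rw [hs] at hms
        exact hms.1
    · have hB : ∀ a ∈ v, a ∈ B := fun a ha => (hvB a ha).resolve_left (ne_of_mem_of_not_mem ha hcv)
      exact .inl ⟨v, hB, rfl, hvf, hv⟩
  · rintro (⟨v, hvB, hlen, hvf, hv⟩ | ⟨f₀, g, f₁, hf, _, _, ⟨u, huB, rfl, huf, hu⟩,
      ⟨m, hmB, rfl, hmg, -, hm⟩, u', huB', rfl, huf', hu'⟩)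
    · exact ⟨v, fun a ha => .inr (hvB a ha), hlen, hvf, hv⟩
    · refine ⟨u ++ (m ++ [c]) ++ u', ?_, by grind, fun q => ?_, ?_⟩
      · simp only [List.mem_append, List.mem_singleton]
        rintro a ((ha | ha | rfl) | ha)
        exacts [.inr (huB a ha), hmB a ha, .inl rfl, .inr (huB' a ha)]
      · rw [List.foldl_append, List.foldl_append, huf, hmg, huf', hf]
      · refine labelled_append.2 ⟨labelled_append.2 ⟨hu, hm⟩, ?_⟩
        convert hu' using 1
        grind

open Classical in
theorem exists_append_eq_takeWhile_append (a : Δ) (v : List Δ) :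
    ∃ s, v ++ [a] = v.takeWhile (· ≠ a) ++ [a] ++ s := by
  induction v with
  | nil => exact ⟨[], rfl⟩
  | cons b v ih =>
    obtain ⟨s, hs⟩ := ih
    by_cases hb : b = a
    · exact ⟨v ++ [a], by simp [hb]⟩
    · exact ⟨s, by simpa [hb] using hs⟩

variable [Finite B]

theorem satAt_blockLabel_some (hr : ∀ f, (r f).DefinesAct step χ B f) {t : WordMaps step} {k : ℕ}
    (hk : k ≤ ρ.last) :
    SatAt ρ (blockLabel (B := B) step χ c r (some t)) k ↔ SatAt ρ (χ c) k ∧ ∃ u : List Δ,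
      (∀ a ∈ u, a ∈ B) ∧ (∀ q, u.foldl step q = t.1 q) ∧ k + 1 + u.length ≤ ρ.last ∧
        Labelled ρ χ (k + 1) (u ++ [c]) := by
  rw [blockLabel, satAt_and, satAt_frat hk]
  refine and_congr_right fun _ => ?_
  constructor
  · rintro ⟨j, -, hj, hc, -, hmatch⟩
    obtain ⟨u, huB, rfl, hut, hu⟩ := (hr _ ρ _ _ hj).1 hmatch
    exact ⟨u, huB, hut, hj, labelled_append.2 ⟨hu, hc, trivial⟩⟩
  · rintro ⟨u, huB, hut, hj, hlab⟩
    obtain ⟨hu, hc, -⟩ := labelled_append.1 hlab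
    refine ⟨_, by omega, hj, hc, ?_, (hr _ ρ _ _ hj).2 ⟨u, huB, rfl, hut, hu⟩⟩
    simpa [Interval.toSet] using ρ.timeAt_mono (show k ≤ k + 1 + u.length by omega)

theorem not_satAt_blockLabel_none (hχ : Exclusive χ) (hcB : c ∉ B) {k : ℕ} (hk : k ≤ ρ.last)
    (hc : SatAt ρ (χ c) k) : ¬ SatAt ρ (blockLabel (B := B) step χ c r none) k := by
  intro h
  obtain ⟨a, ha⟩ := satAt_iOr.1 h
  exact hcB (hχ ρ k hk _ _ ha hc ▸ a.2)

theorem exclusive_blockLabel (hχ : Exclusive χ) (hcB : c ∉ B)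
    (hr : ∀ f, (r f).DefinesAct step χ B f) :
    Exclusive (blockLabel (B := B) step χ c r) := by
  intro ρ k hk t t' ht ht'
  rcases t with _ | t <;> rcases t' with _ | t'
  · rfl
  · exact absurd ht (not_satAt_blockLabel_none hχ hcB hk (satAt_and.1 ht').1)
  · exact absurd ht' (not_satAt_blockLabel_none hχ hcB hk (satAt_and.1 ht).1)
  · obtain ⟨-, u, huB, hut, hle, hu⟩ := (satAt_blockLabel_some hr hk).1 ht
    obtain ⟨-, u', huB', hut', -, hu'⟩ := (satAt_blockLabel_some hr hk).1 ht'
    obtain rfl := hχ.labelled_append_unique (mt (huB c) hcB) (mt (huB' c) hcB) hu hu' hle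
    exact congrArg some (Subtype.ext (funext fun q => (hut q).symm.trans (hut' q)))

theorem labelled_blocks (hr : ∀ f, (r f).DefinesAct step χ B f) {v : List Δ} {k : ℕ}
    (hvB : ∀ a ∈ v, a ∈ insert c B) (hk : k + v.length ≤ ρ.last)
    (hv : Labelled ρ χ k (v ++ [c])) :
    Labelled ρ (blockLabel (B := B) step χ c r) k (blocks step c v) := by
  classical
  induction v generalizing k with
  | nil => trivial
  | cons a v ih =>
    simp only [List.length_cons] at hk
    obtain ⟨haB, hvB⟩ := List.forall_mem_cons.1 hvB
    refine ⟨?_, ih hvB (by omega) hv.2⟩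
    by_cases ha : a = c
    · subst ha
      have hle := (v.takeWhile_prefix (· ≠ a)).length_le
      rw [if_pos rfl, satAt_blockLabel_some hr (by omega)]
      refine ⟨hv.1, _, fun b hb => ?_, fun q => rfl, by omega, ?_⟩
      · have hba : b ≠ a := by simpa using List.mem_takeWhile_imp hb
        exact (hvB b (List.takeWhile_subset _ hb)).resolve_left hba
      · obtain ⟨s, hs⟩ := exists_append_eq_takeWhile_append a v
        have hv' : Labelled ρ χ (k + 1) (v ++ [a]) := hv.2
        rw [hs, labelled_append] at hv'
        exact hv'.1
    · rw [if_neg ha]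
      exact satAt_iOr.2 ⟨⟨a, haB.resolve_left ha⟩, hv.1⟩

theorem exists_labelled_of_blockLabel {w : List (Option (WordMaps step))} {k : ℕ}
    (hw : Labelled ρ (blockLabel (B := B) step χ c r) k w) :
    ∃ v : List Δ, v.length = w.length ∧ (∀ a ∈ v, a ∈ insert c B) ∧ Labelled ρ χ k v := by
  induction w generalizing k with
  | nil => exact ⟨[], rfl, by simp, trivial⟩
  | cons t w ih =>
    obtain ⟨v, hlen, hvB, hv⟩ := ih hw.2
    rcases t with _ | t
    · obtain ⟨a, ha⟩ := satAt_iOr.1 hw.1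
      exact ⟨a :: v, by simp [hlen], List.forall_mem_cons.2 ⟨.inr a.2, hvB⟩, ha, hv⟩
    · exact ⟨c :: v, by simp [hlen], List.forall_mem_cons.2 ⟨.inl rfl, hvB⟩,
        (satAt_and.1 hw.1).1, hv⟩

theorem coreActsOn_iff (hχ : Exclusive χ) (hcB : c ∉ B) (hr : ∀ f, (r f).DefinesAct step χ B f)
    {g : ImageOf step c → ImageOf step c} {k z : ℕ} (hz : z ≤ ρ.last) :
    CoreActsOn step χ c B g ρ k z ↔ SatAt ρ (χ c) k ∧ SatAt ρ (χ c) z ∧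
      ActsOn (blockStep step c) (blockLabel (B := B) step χ c r) Set.univ g ρ k z := by
  have hact : ∀ v : List Δ, SatAt ρ (χ c) k → Labelled ρ χ k (v ++ [c]) → k ≤ ρ.last →
      ∀ q, ((blocks step c v).foldl (blockStep step c) (toImage step c q)).1 =
        (v ++ [c]).foldl step q := by
    intro v hc hv hk
    rcases hs : v ++ [c] with _ | ⟨a, s⟩
    · simp at hs
    · obtain rfl := hχ ρ k hk _ _ (hs ▸ hv).1 hc
      exact hs ▸ foldl_blocks_of_append_eq_cons hs
  constructor
  · rintro ⟨v, hvB, rfl, hvg, hc, hv⟩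
    refine ⟨hc, (labelled_append.1 hv).2.1, blocks step c v, by simp, by rw [length_blocks], ?_,
      labelled_blocks hr hvB hz hv⟩
    rintro ⟨_, q, rfl⟩
    exact Subtype.ext ((hact v hc hv (by omega) q).trans (hvg q))
  · rintro ⟨hc, hcz, w, -, rfl, hwg, hw⟩
    obtain ⟨v, hlen, hvB, hv⟩ := exists_labelled_of_blockLabel hw
    rw [← hlen] at hz hcz ⊢
    have hv : Labelled ρ χ k (v ++ [c]) := labelled_append.2 ⟨hv, hcz, trivial⟩
    obtain rfl : blocks step c v = w :=
      (exclusive_blockLabel hχ hcB hr).labelled_unique (labelled_blocks hr hvB hz hv) hw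
        (by rw [length_blocks, hlen]) (by rw [length_blocks]; omega)
    refine ⟨v, hvB, rfl, fun q => ?_, hc, hv⟩
    rw [← hact v hc hv (by omega), hwg]

theorem within_blockLabel {J : Interval → Prop} (hJ : J (.ci 0))
    (hχJ : ∀ a, (χ a).Within J RatExp.IsLetterStar) (hrJ : ∀ f, (r f).LetterStarWithin J)
    (t : Option (WordMaps step)) :
    (blockLabel (B := B) step χ c r t).Within J RatExp.IsLetterStar := by
  rcases t with _ | t
  · exact .iOr fun a => hχJ a
  · exact .and (hχJ c) (.frat hJ (hrJ _).1 (hrJ _).2 (hχJ c))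

variable [Finite Q]

/-- Matches the segments that begin and end with `c` and act as `g` once their first letter is
read, when `r` and `r'` match the words over `B` and the words of block symbols. -/
noncomputable def coreExp (step : Q → Δ → Q) (χ : Δ → Formula P) (c : Δ)
    (r : (Q → Q) → RatExp (Formula P))
    (r' : (ImageOf step c → ImageOf step c) → RatExp (Formula P))
    (g : ImageOf step c → ImageOf step c) : RatExp (Formula P) :=
  .alt (.iAlt fun _ : PLift (g = id) => .letter (χ c))
    (.iAlt fun p : {p : WordMaps step × (ImageOf step c → ImageOf step c) //
        ∀ q, p.2 (blockStep step c q (some p.1)) = g q} =>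
      .cat (.letter (blockLabel (B := B) step χ c r (some p.1.1)))
        (.cat (r' p.1.2) (.letter (χ c))))

theorem match_coreExp {r' : (ImageOf step c → ImageOf step c) → RatExp (Formula P)}
    (hχ : Exclusive χ) (hcB : c ∉ B) (hr : ∀ f, (r f).DefinesAct step χ B f)
    (hr' : ∀ g, (r' g).DefinesAct (blockStep step c) (blockLabel (B := B) step χ c r) Set.univ g)
    {g : ImageOf step c → ImageOf step c} {k j : ℕ} (hj : j ≤ ρ.last) :
    Match ρ (coreExp (B := B) step χ c r r' g) k j ↔
      ∃ z, z + 1 = j ∧ CoreActsOn step χ c B g ρ k z := by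
  have hcore : (∃ z, z + 1 = j ∧ CoreActsOn step χ c B g ρ k z) ↔
      ∃ z, z + 1 = j ∧ SatAt ρ (χ c) k ∧ SatAt ρ (χ c) z ∧
        ActsOn (blockStep step c) (blockLabel (B := B) step χ c r) Set.univ g ρ k z :=
    exists_congr fun z => and_congr_right fun hz => coreActsOn_iff hχ hcB hr (by omega)
  rw [hcore]
  simp only [coreExp, match_alt, match_iAlt, match_cat, match_letter]
  constructor
  · rintro (⟨⟨rfl⟩, rfl, hc⟩ | ⟨⟨⟨t, x⟩, hg⟩, _, ⟨rfl, ht⟩, z, hx, rfl, hc⟩)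
    · exact ⟨k, rfl, hc, hc, [], by simp, rfl, fun q => rfl, trivial⟩
    · obtain ⟨w, -, rfl, hwx, hw⟩ := (hr' x ρ _ _ (by omega)).1 hx
      exact ⟨_, rfl, (satAt_and.1 ht).1, hc, some t :: w, by simp, by grind,
        fun q => (hwx _).trans (hg q), ht, hw⟩
  · rintro ⟨z, rfl, hc, hcz, w, -, rfl, hwg, hw⟩
    rcases w with _ | ⟨_ | t, w⟩
    · exact .inl ⟨⟨funext fun q => (hwg q).symm⟩, rfl, hc⟩
    · exact absurd hw.1 (not_satAt_blockLabel_none hχ hcB (by omega) hc)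
    · refine .inr ⟨⟨(t, fun q => w.foldl (blockStep step c) q), hwg⟩, _, ⟨rfl, hw.1⟩, _, ?_, rfl,
        hcz⟩
      exact (hr' _ ρ _ _ (by omega)).2
        ⟨w, by simp, by simp only [List.length_cons]; omega, fun q => rfl, hw.2⟩

theorem exists_definesAct_insert {J : Interval → Prop} (hJ : J (.ci 0))
    (hχ : Exclusive χ) (hcB : c ∉ B) (hχJ : ∀ a, (χ a).Within J RatExp.IsLetterStar)
    (hr : ∀ f, (r f).DefinesAct step χ B f) (hrJ : ∀ f, (r f).LetterStarWithin J)
    {r' : (ImageOf step c → ImageOf step c) → RatExp (Formula P)}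
    (hr' : ∀ g, (r' g).DefinesAct (blockStep step c) (blockLabel (B := B) step χ c r) Set.univ g)
    (hrJ' : ∀ g, (r' g).LetterStarWithin J) (f : Q → Q) :
    ∃ s : RatExp (Formula P), s.LetterStarWithin J ∧ s.DefinesAct step χ (insert c B) f := by
  refine ⟨.alt (r f) (.iAlt fun p : {p : (Q → Q) × (ImageOf step c → ImageOf step c) × (Q → Q) //
      ∀ q, p.2.2 (p.2.1 (toImage step c (p.1 q))).1 = f q} =>
    .cat (r p.1.1) (.cat (coreExp (B := B) step χ c r r' p.1.2.1) (r p.1.2.2))), ?_, ?_⟩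
  · have hcore : ∀ g, (coreExp (B := B) step χ c r r' g).LetterStarWithin J := fun g =>
      .alt (.iAlt fun _ => .letter (hχJ c)) (.iAlt fun p =>
        .cat (.letter (within_blockLabel hJ hχJ hrJ _)) (.cat (hrJ' _) (.letter (hχJ c))))
    exact .alt (hrJ f) (.iAlt fun p => .cat (hrJ _) (.cat (hcore _) (hrJ _)))
  · intro ρ i j hj
    rw [actsOn_insert, match_alt, hr f ρ i j hj]
    refine or_congr_right ?_
    simp only [match_iAlt, match_cat, Subtype.exists, Prod.exists, exists_prop]
    refine exists_congr fun f₀ => exists_congr fun g => exists_congr fun f₁ =>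
      and_congr_right fun _ => ?_
    constructor
    · rintro ⟨k, hik, y, hky, hyj⟩
      have hyj' := hyj.le
      have hky' := hky.le
      obtain ⟨z, rfl, hz⟩ := (match_coreExp hχ hcB hr hr' (by omega)).1 hky
      exact ⟨k, z, (hr _ ρ _ _ (by omega)).1 hik, hz, (hr _ ρ _ _ hj).1 hyj⟩
    · rintro ⟨k, z, hik, hkz, hzj⟩
      have hyj := (hr f₁ ρ _ _ hj).2 hzj
      have hyj' := hyj.le
      have hky := (match_coreExp hχ hcB hr hr' (by omega)).2 ⟨z, rfl, hkz⟩
      have hky' := hky.le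
      exact ⟨k, (hr _ ρ _ _ (by omega)).2 hik, z + 1, hky, hyj⟩

end Block

theorem IsCounterFree.exists_definesAct {J : Interval → Prop} (hJ : J (.ci 0)) {Q Δ : Type u}
    [Finite Q] [Finite Δ] {step : Q → Δ → Q} (hstep : IsCounterFree step) {χ : Δ → Formula P}
    (hχ : Exclusive χ) (hχJ : ∀ a, (χ a).Within J RatExp.IsLetterStar) (A : Set Δ) (f : Q → Q) :
    ∃ r : RatExp (Formula P), r.LetterStarWithin J ∧ r.DefinesAct step χ A f := by
  induction hn : Nat.card Q using Nat.strong_induction_on generalizing Q Δ A f with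
  | _ n ihQ =>
  induction A using WellFoundedLT.induction generalizing f with
  | _ A ihA =>
  by_cases hid : ∀ a ∈ A, ∀ q, step q a = q
  · exact exists_definesAct_of_forall_eq_self hid hχJ f
  push Not at hid
  obtain ⟨c, hcA, hc⟩ := hid
  have hcB : c ∉ A \ {c} := fun h => h.2 rfl
  choose r hrJ hr using ihA (A \ {c}) (Set.sdiff_singleton_ssubset.2 hcA)
  choose r' hrJ' hr' using ihQ _ (hn ▸ hstep.card_imageOf_lt hc) hstep.blockStep
    (exclusive_blockLabel hχ hcB hr) (within_blockLabel hJ hχJ hrJ) Set.univ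
  have := exists_definesAct_insert hJ hχ hcB hχJ hr hrJ (fun g => hr' g rfl) (fun g => hrJ' g rfl) f
  rwa [Set.insert_sdiff_self_of_mem hcA] at this

/-! ### From star-free to letter-star expressions -/

theorem IsStarFree.exists_match_iff_mem {J : Interval → Prop} (hJ : J (.ci 0)) {Δ : Type u}
    [Finite Δ] {K : Language Δ} (hK : IsStarFree K) {χ : Δ → Formula P} (hχ : Exclusive χ)
    (hχJ : ∀ a, (χ a).Within J RatExp.IsLetterStar) :
    ∃ r : RatExp (Formula P), r.LetterStarWithin J ∧ ∀ (ρ : TimedWord P) (i j : ℕ), j ≤ ρ.last →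
      (Match ρ r i j ↔ ∃ v ∈ K, i + v.length = j ∧ Labelled ρ χ i v) := by
  have : Finite (Set.range K.leftQuotient) := hK.isRegular.finite_range_leftQuotient
  choose r hrJ hr using hK.isAperiodic.isCounterFree_toDFA.exists_definesAct hJ hχ hχJ Set.univ
  refine ⟨.iAlt fun f : {f : Set.range K.leftQuotient → Set.range K.leftQuotient //
      f K.toDFA.start ∈ K.toDFA.accept} => r f, .iAlt fun f => hrJ f,
    fun ρ i j hj => ?_⟩
  have hmem : ∀ v, v ∈ K ↔ v.foldl K.toDFA.step K.toDFA.start ∈ K.toDFA.accept := fun v => by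
    conv_lhs => rw [← K.accepts_toDFA]
    rfl
  simp only [match_iAlt, hr _ ρ i j hj]
  constructor
  · rintro ⟨⟨f, hf⟩, v, -, hlen, hvf, hv⟩
    exact ⟨v, (hmem v).2 (hvf _ ▸ hf), hlen, hv⟩
  · rintro ⟨v, hvK, hlen, hv⟩
    exact ⟨⟨fun q => v.foldl K.toDFA.step q, (hmem v).1 hvK⟩, v, by simp, hlen, fun _ => rfl, hv⟩

/-- The formula that holds where exactly the members of the family with indices in `X` hold. -/
noncomputable def Formula.exactly {S : Type*} [Finite S] (g : S → Formula P) (X : Set S) :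
    Formula P :=
  open Classical in .iAnd fun s => if s ∈ X then g s else .neg (g s)

section Exactly

variable {S : Type*} [Finite S] {g : S → Formula P}

theorem satAt_exactly {X : Set S} {ρ : TimedWord P} {k : ℕ} :
    SatAt ρ (.exactly g X) k ↔ X = {s | SatAt ρ (g s) k} := by
  rw [Formula.exactly, satAt_iAnd, Set.ext_iff]
  refine forall_congr' fun s => ?_
  by_cases hs : s ∈ X <;> simp [hs]

theorem exclusive_exactly : Exclusive (Formula.exactly g) := fun _ _ _ _ _ hX hY =>
  (satAt_exactly.1 hX).trans (satAt_exactly.1 hY).symm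

theorem within_exactly {J : Interval → Prop} {R : RatExp (Formula P) → Prop}
    (h : ∀ s, (g s).Within J R) (X : Set S) : (Formula.exactly g X).Within J R := by
  refine .iAnd fun s => ?_
  split_ifs
  exacts [h s, .neg (h s)]

end Exactly

/-- The formulas hold at the same positions of all timed words. -/
def Formula.Equivalent (φ ψ : Formula P) : Prop :=
  ∀ (ρ : TimedWord P) (k : ℕ), k ≤ ρ.last → (SatAt ρ φ k ↔ SatAt ρ ψ k)

section Segment

variable {ρ : TimedWord P} {i j : ℕ}

theorem seg_pos_pos (S : Set (Formula P)) (hij : i < j) (hj : j ≤ ρ.last) :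
    seg ρ S (ρ.pos i) (ρ.pos j) =
      List.ofFn fun m : Fin (j - i - 1) => {ψ : S | SatAt ρ ψ.1 (i + 1 + m)} := by
  have hpi := ρ.val_pos (hij.le.trans hj)
  have hpj := ρ.val_pos hj
  refine List.ext_getElem (by simp [seg, hpi, hpj]) fun m hm _ => ?_
  have hm' : m < j - i - 1 := by simpa [seg, hpi, hpj] using hm
  simp only [seg, List.getElem_ofFn, SatAt]
  congr! 5
  rw [hpi, ρ.val_pos (by omega)]

theorem match_iff_single_seg {re : RatExp (Formula P)} (hij : i < j) (hj : j ≤ ρ.last) :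
    Match ρ re (i + 1) j ↔
      ∃ w, w ∈ single (seg ρ re.letters (ρ.pos i) (ρ.pos j)) ∧ w ∈ re.lang := by
  refine exists_congr fun w => and_comm.trans (and_congr_left fun hw => ?_)
  rw [seg_pos_pos _ hij hj, labelled_iff_getElem]
  simp only [single, Set.mem_ofPred_eq, List.forall₂_iff_get, List.length_ofFn, List.get_eq_getElem,
    List.getElem_ofFn]
  constructor
  · rintro ⟨hlen, hsat⟩
    exact ⟨by omega, fun m hm _ => ⟨re.mem_letters_of_mem_lang hw (List.getElem_mem hm), hsat m hm⟩⟩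
  · rintro ⟨hlen, hsat⟩
    exact ⟨by omega, fun m hm => (hsat m hm (by omega)).2⟩

theorem labelled_exactly_iff_eq_seg {S : Set (Formula P)} [Finite S] {g : S → Formula P}
    (hg : ∀ s, (g s).Equivalent s) (hij : i < j) (hj : j ≤ ρ.last) (v : List (Set S)) :
    i + 1 + v.length = j ∧ Labelled ρ (Formula.exactly g) (i + 1) v ↔
      v = seg ρ S (ρ.pos i) (ρ.pos j) := by
  have hsat : ∀ m < j - i - 1, ∀ X, SatAt ρ (Formula.exactly g X) (i + 1 + m) ↔
      X = {ψ : S | SatAt ρ ψ.1 (i + 1 + m)} := fun m hm X => by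
    simp only [satAt_exactly, hg _ ρ _ (show i + 1 + m ≤ ρ.last by omega)]
  rw [seg_pos_pos S hij hj, labelled_iff_getElem]
  constructor
  · rintro ⟨hlen, hv⟩
    refine List.ext_getElem (by grind) fun m hm hm' => ?_
    rw [List.getElem_ofFn, (hsat m (by omega) _).1 (hv m hm)]
  · rintro rfl
    refine ⟨by grind, fun m hm => ?_⟩
    rw [List.length_ofFn] at hm
    rw [List.getElem_ofFn, hsat m hm]

end Segment

theorem HasStarFreeEquivalent.exists_letterStarWithin {J : Interval → Prop} (hJ : J (.ci 0))
    {re : RatExp (Formula P)} (h : HasStarFreeEquivalent re)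
    (hre : ∀ ψ ∈ re.letters, ∃ ψ' : Formula P, ψ'.Within J RatExp.IsLetterStar ∧
      ψ'.Equivalent ψ) :
    ∃ r : RatExp (Formula P), r.LetterStarWithin J ∧ ∀ (ρ : TimedWord P) (i j : ℕ), i < j →
      j ≤ ρ.last → (Match ρ r (i + 1) j ↔ Match ρ re (i + 1) j) := by
  have : Finite re.letters := re.finite_letters
  obtain ⟨K, hK, hseg⟩ := h
  choose g hgJ hg using fun s : re.letters => hre s.1 s.2
  obtain ⟨r, hrJ, hr⟩ := hK.exists_match_iff_mem hJ exclusive_exactly (within_exactly hgJ)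
  refine ⟨r, hrJ, fun ρ i j hij hj => ?_⟩
  have hpos : ρ.pos i < ρ.pos j := by
    rwa [Fin.lt_def, ρ.val_pos (hij.le.trans hj), ρ.val_pos hj]
  rw [hr ρ _ j hj, match_iff_single_seg hij hj, ← hseg ρ _ _ hpos]
  simp only [labelled_exactly_iff_eq_seg hg hij hj, exists_eq_right]

namespace Formula.Equivalent

variable {φ φ' ψ ψ' : Formula P} {I : Interval}

theorem and_congr (h : φ'.Equivalent φ) (h' : ψ'.Equivalent ψ) :
    (Formula.and φ' ψ').Equivalent (.and φ ψ) := fun ρ k hk => by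
  rw [satAt_and, satAt_and, h ρ k hk, h' ρ k hk]

theorem neg_congr (h : φ'.Equivalent φ) : (Formula.neg φ').Equivalent (.neg φ) := fun ρ k hk => by
  rw [satAt_neg, satAt_neg, h ρ k hk]

theorem until_congr (h : φ'.Equivalent φ) (h' : ψ'.Equivalent ψ) :
    (Formula.until I φ' ψ').Equivalent (.until I φ ψ) := fun ρ k hk => by
  rw [satAt_until hk, satAt_until hk]
  refine exists_congr fun j => and_congr_right fun _ => and_congr_right fun hj => ?_
  rw [h' ρ j hj]
  refine and_congr_right fun _ => and_congr_right fun _ => ?_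
  exact forall_congr' fun m => imp_congr_right fun _ => imp_congr_right fun hm => h ρ m (by omega)

theorem frat_congr {r r' : RatExp (Formula P)} (h : φ'.Equivalent φ)
    (hr : ∀ (ρ : TimedWord P) (i j : ℕ), i < j → j ≤ ρ.last →
      (Match ρ r' (i + 1) j ↔ Match ρ r (i + 1) j)) :
    (Formula.frat I r' φ').Equivalent (.frat I r φ) := fun ρ k hk => by
  rw [satAt_frat hk, satAt_frat hk]
  refine exists_congr fun j => and_congr_right fun hkj => and_congr_right fun hj => ?_
  rw [h ρ j hj, hr ρ k j hkj hj]

end Formula.Equivalent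

theorem Formula.Within.exists_isLetterStar {J : Interval → Prop} (hJ : J (.ci 0)) {φ : Formula P}
    (h : φ.Within J HasStarFreeEquivalent) :
    ∃ φ' : Formula P, φ'.Within J RatExp.IsLetterStar ∧ φ'.Equivalent φ := by
  induction h with
  | atom a => exact ⟨_, .atom a, fun _ _ _ => Iff.rfl⟩
  | tru => exact ⟨_, .tru, fun _ _ _ => Iff.rfl⟩
  | and _ _ ihφ ihψ =>
    obtain ⟨φ', hφ', hφ⟩ := ihφ
    obtain ⟨ψ', hψ', hψ⟩ := ihψ
    exact ⟨_, .and hφ' hψ', hφ.and_congr hψ⟩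
  | neg _ ih =>
    obtain ⟨φ', hφ', hφ⟩ := ih
    exact ⟨_, .neg hφ', hφ.neg_congr⟩
  | frat hI hr _ _ ihr ihφ =>
    obtain ⟨φ', hφ', hφ⟩ := ihφ
    obtain ⟨r', hr', hmatch⟩ := hr.exists_letterStarWithin hJ ihr
    exact ⟨_, .frat hI hr'.1 hr'.2 hφ', hφ.frat_congr hmatch⟩
  | _ hI _ _ ihφ ihψ =>
    obtain ⟨φ', hφ', hφ⟩ := ihφ
    obtain ⟨ψ', hψ', hψ⟩ := ihψ
    exact ⟨_, .until hI hφ' hψ', hφ.until_congr hψ⟩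

/-! ### Acceptance in terms of reset times -/

namespace TForm

variable {S : Type}

/-- The truth value at time `now` of a transition formula for a clock that has been reset at time
`t`, where `L s t` says that the location `s` with reset time `t` accepts the remaining word. -/
def Ev (L : S → ℝ → Prop) (now : ℝ) : TForm S → ℝ → Prop
  | top, _ => True
  | bot, _ => False
  | conj φ ψ, t => φ.Ev L now t ∧ ψ.Ev L now t
  | disj φ ψ, t => φ.Ev L now t ∨ ψ.Ev L now t
  | loc s, t => L s t
  | guard g, t => g.Holds (now - t)
  | reset φ, _ => φ.Ev L now now

theorem exists_outcome_iff_ev {L : S → ℝ → Prop} {now : ℝ} {φ : TForm S} {v : ℝ} :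
    (∃ M ∈ φ.outcomes v, ∀ p ∈ M, L p.1 (now - p.2)) ↔ φ.Ev L now (now - v) := by
  induction φ generalizing v with
  | top => simp [outcomes, Ev]
  | bot => simp [outcomes, Ev]
  | conj φ ψ ihφ ihψ =>
    rw [Ev, ← ihφ, ← ihψ]
    constructor
    · rintro ⟨_, ⟨A, hA, B, hB, rfl⟩, h⟩
      exact ⟨⟨A, hA, fun p hp => h p (.inl hp)⟩, ⟨B, hB, fun p hp => h p (.inr hp)⟩⟩
    · rintro ⟨⟨A, hA, h⟩, ⟨B, hB, h'⟩⟩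
      exact ⟨_, ⟨A, hA, B, hB, rfl⟩, fun p hp => hp.elim (h p) (h' p)⟩
  | disj φ ψ ihφ ihψ =>
    rw [Ev, ← ihφ, ← ihψ]
    constructor
    · rintro ⟨M, hM | hM, h⟩
      · exact .inl ⟨M, hM, h⟩
      · exact .inr ⟨M, hM, h⟩
    · rintro (⟨M, hM, h⟩ | ⟨M, hM, h⟩)
      · exact ⟨M, .inl hM, h⟩
      · exact ⟨M, .inr hM, h⟩
  | loc s => simp [outcomes, Ev]
  | guard g =>
    rw [Ev, sub_sub_cancel]
    constructor
    · rintro ⟨M, ⟨rfl, h⟩, -⟩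
      exact h
    · exact fun h => ⟨∅, ⟨rfl, h⟩, fun p hp => hp.elim⟩
  | reset φ ih => simpa only [outcomes, Ev, sub_zero] using ih (v := 0)

theorem ev_congr {L L' : S → ℝ → Prop} {now : ℝ} {φ : TForm S} {t : ℝ}
    (hf : ∀ s ∈ φ.freeLocs, L s t ↔ L' s t) (hb : ∀ s ∈ φ.boundLocs, L s now ↔ L' s now) :
    φ.Ev L now t ↔ φ.Ev L' now t := by
  induction φ generalizing t with
  | top => rfl
  | bot => rfl
  | conj φ ψ ihφ ihψ =>
    exact and_congr (ihφ (fun s hs => hf s (.inl hs)) fun s hs => hb s (.inl hs))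
      (ihψ (fun s hs => hf s (.inr hs)) fun s hs => hb s (.inr hs))
  | disj φ ψ ihφ ihψ =>
    exact or_congr (ihφ (fun s hs => hf s (.inl hs)) fun s hs => hb s (.inl hs))
      (ihψ (fun s hs => hf s (.inr hs)) fun s hs => hb s (.inr hs))
  | loc s => exact hf s rfl
  | guard g => rfl
  | reset φ ih => exact ih (fun s hs => hb s (.inl hs)) fun s hs => hb s (.inr hs)

theorem IsResetCombination.ev_iff {β : TForm S} (hβ : β.IsResetCombination) {L : S → ℝ → Prop}
    {now t t' : ℝ} : β.Ev L now t ↔ β.Ev L now t' := by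
  induction hβ with
  | top => rfl
  | bot => rfl
  | atom q => rfl
  | conj _ _ ih₁ ih₂ => exact and_congr ih₁ ih₂
  | disj _ _ ih₁ ih₂ => exact or_congr ih₁ ih₂

theorem IsResetCombination.freeLocs_eq {β : TForm S} (hβ : β.IsResetCombination) :
    β.freeLocs = ∅ := by
  induction hβ with
  | top => rfl
  | bot => rfl
  | atom q => rfl
  | conj _ _ ih₁ ih₂ => simp [freeLocs, ih₁, ih₂]
  | disj _ _ ih₁ ih₂ => simp [freeLocs, ih₁, ih₂]

theorem IsResetCombination.guards_eq {β : TForm S} (hβ : β.IsResetCombination) :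
    β.guards = ∅ := by
  induction hβ with
  | top => rfl
  | bot => rfl
  | atom q => rfl
  | conj _ _ ih₁ ih₂ => simp [guards, ih₁, ih₂]
  | disj _ _ ih₁ ih₂ => simp [guards, ih₁, ih₂]

end TForm

section Accept

variable {S : Type} (δ : S → Letter P → TForm S) (F : Set S) (ρ : TimedWord P)

/-- Acceptance of the last `m` symbols. -/
def acceptRem : ℕ → S → ℝ → Prop
  | 0, s, _ => s ∈ F
  | m + 1, s, t =>
      (δ s (ρ.letterAt (ρ.last - m))).Ev (acceptRem m) (ρ.timeAt (ρ.last - m)) t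

/-- Acceptance of the symbols from the position `k` on, by a location whose clock has been reset at
time `t`. -/
def Accept (k : ℕ) : S → ℝ → Prop := acceptRem δ F ρ (ρ.last + 1 - k)

variable {δ F ρ}

theorem accept_end {s : S} {t : ℝ} : Accept δ F ρ (ρ.last + 1) s t ↔ s ∈ F := by
  rw [Accept, Nat.sub_self]
  rfl

theorem accept_iff {k : ℕ} (hk : k ≤ ρ.last) {s : S} {t : ℝ} :
    Accept δ F ρ k s t ↔
      (δ s (ρ.letterAt k)).Ev (Accept δ F ρ (k + 1)) (ρ.timeAt k) t := by
  rw [Accept, show ρ.last + 1 - k = (ρ.last - k) + 1 by omega, acceptRem,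
    show ρ.last - (ρ.last - k) = k by omega, Accept,
    show ρ.last + 1 - (k + 1) = ρ.last - k by omega]

end Accept

section Language

variable {A : OneATA P} {ρ : TimedWord P}

/-- The time at which the symbol before the position `k` is read. -/
def TimedWord.timeBefore (ρ : TimedWord P) : ℕ → ℝ
  | 0 => 0
  | k + 1 => ρ.timeAt k

theorem TimedWord.delay_eq (ρ : TimedWord P) (k : Fin (ρ.last + 1)) :
    ρ.delay k = ρ.timeAt k.1 - ρ.timeBefore k.1 := by
  rcases k with ⟨_ | k, hk⟩
  · rw [TimedWord.timeBefore, TimedWord.timeAt, ρ.pos_eq hk, sub_zero]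
    rfl
  · rw [TimedWord.timeBefore, TimedWord.timeAt, ρ.pos_eq hk, TimedWord.timeAt,
      ρ.pos_eq (by omega : k < ρ.last + 1)]
    rfl

theorem OneATA.accept_of_isRun {C : Fin (ρ.last + 2) → A.Config} (hC : A.IsRun ρ C)
    (hF : ∀ p ∈ C (Fin.last _), p.1 ∈ A.final) (i : Fin (ρ.last + 2)) :
    ∀ p ∈ C i, Accept A.δ A.final ρ i.1 p.1 (ρ.timeBefore i.1 - p.2) := by
  induction i using Fin.reverseInduction with
  | last => exact fun p hp => accept_end.2 (hF p hp)
  | cast k ih =>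
    intro p hp
    obtain ⟨M, hM, hsucc⟩ := hC.2 k
    have hmem : (p.1, p.2 + ρ.delay k) ∈ OneATA.Config.elapse (C k.castSucc) (ρ.delay k) :=
      ⟨p, hp, rfl⟩
    have hsub : M (p.1, p.2 + ρ.delay k) ⊆ C k.succ := by
      rw [hsucc]
      exact Set.subset_biUnion_of_mem (u := fun q => M q) hmem
    have hletter : ρ.letterAt k.1 = ρ.letter k := by rw [TimedWord.letterAt, ρ.pos_val]
    rw [Fin.val_castSucc, accept_iff (by omega), hletter]
    have hreset : ρ.timeBefore k.succ.1 - (p.2 + ρ.delay k) = ρ.timeBefore k.1 - p.2 := by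
      rw [ρ.delay_eq, Fin.val_succ, TimedWord.timeBefore]
      ring
    rw [← hreset]
    exact TForm.exists_outcome_iff_ev.1 ⟨_, hM _ hmem, fun q hq => ih q (hsub hq)⟩

open Classical in
/-- A choice of accepting outcomes at the position `k`. -/
noncomputable def OneATA.acceptingChoice (A : OneATA P) (ρ : TimedWord P) (k : ℕ)
    (p : A.Loc × ℝ) : A.Config :=
  if h : ∃ M ∈ (A.δ p.1 (ρ.letterAt k)).outcomes p.2,
    ∀ q ∈ M, Accept A.δ A.final ρ (k + 1) q.1 (ρ.timeAt k - q.2) then h.choose else ∅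

/-- The configurations reached with accepting outcomes. -/
noncomputable def OneATA.acceptingConfig (A : OneATA P) (ρ : TimedWord P) : ℕ → A.Config
  | 0 => {(A.init, 0)}
  | k + 1 => ⋃ p ∈ OneATA.Config.elapse (OneATA.acceptingConfig A ρ k)
      (ρ.timeAt k - ρ.timeBefore k), OneATA.acceptingChoice A ρ k p

theorem OneATA.acceptingChoice_spec {k : ℕ} {p : A.Loc × ℝ} (hk : k ≤ ρ.last)
    (hp : Accept A.δ A.final ρ k p.1 (ρ.timeAt k - p.2)) :
    A.acceptingChoice ρ k p ∈ (A.δ p.1 (ρ.letterAt k)).outcomes p.2 ∧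
      ∀ q ∈ A.acceptingChoice ρ k p, Accept A.δ A.final ρ (k + 1) q.1 (ρ.timeAt k - q.2) := by
  have h := TForm.exists_outcome_iff_ev.2 ((accept_iff hk).1 hp)
  rw [OneATA.acceptingChoice, dif_pos h]
  exact h.choose_spec

theorem OneATA.accept_of_mem_elapse {C : A.Config} {k : ℕ}
    (hC : ∀ p ∈ C, Accept A.δ A.final ρ k p.1 (ρ.timeBefore k - p.2)) {p : A.Loc × ℝ}
    (hp : p ∈ OneATA.Config.elapse C (ρ.timeAt k - ρ.timeBefore k)) :
    Accept A.δ A.final ρ k p.1 (ρ.timeAt k - p.2) := by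
  obtain ⟨q, hq, rfl⟩ := hp
  convert hC q hq using 1
  ring

theorem OneATA.accept_acceptingConfig (h : Accept A.δ A.final ρ 0 A.init 0) {k : ℕ}
    (hk : k ≤ ρ.last + 1) : ∀ p ∈ A.acceptingConfig ρ k,
      Accept A.δ A.final ρ k p.1 (ρ.timeBefore k - p.2) := by
  induction k with
  | zero =>
    rintro _ rfl
    simpa [TimedWord.timeBefore] using h
  | succ k ih =>
    intro p hp
    simp only [OneATA.acceptingConfig, Set.mem_iUnion] at hp
    obtain ⟨q, hq, hp⟩ := hp
    exact (OneATA.acceptingChoice_spec (by omega)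
      (OneATA.accept_of_mem_elapse (ih (by omega)) hq)).2 p hp

theorem OneATA.mem_language : ρ ∈ A.language ↔ Accept A.δ A.final ρ 0 A.init 0 := by
  constructor
  · rintro ⟨C, hC, hF⟩
    have := OneATA.accept_of_isRun hC hF 0 (A.init, 0) (by rw [hC.1]; rfl)
    simpa [TimedWord.timeBefore] using this
  · intro h
    refine ⟨fun i => A.acceptingConfig ρ i.1, ⟨rfl, fun k => ?_⟩, fun p hp => ?_⟩
    · have hletter : ρ.letterAt k.1 = ρ.letter k := by rw [TimedWord.letterAt, ρ.pos_val]
      refine ⟨A.acceptingChoice ρ k.1, fun p hp => ?_, ?_⟩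
      · rw [ρ.delay_eq] at hp
        rw [← hletter]
        exact (OneATA.acceptingChoice_spec (by omega) (OneATA.accept_of_mem_elapse
          (OneATA.accept_acceptingConfig h k.2.le) hp)).1
      · rw [ρ.delay_eq]; rfl
    · exact accept_end.1 (OneATA.accept_acceptingConfig h le_rfl p hp)

end Language

/-! ### Duality -/

/-- The negation of a clock constraint. -/
def Guard.compl : Guard → Guard
  | .mem I => .notMem I
  | .notMem I => .mem I

theorem Guard.holds_compl {g : Guard} {v : ℝ} : g.compl.Holds v ↔ ¬ g.Holds v := by
  cases g <;> simp [Guard.compl, Guard.Holds]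

theorem Guard.interval_compl (g : Guard) : g.compl.interval = g.interval := by
  cases g <;> rfl

namespace TForm

variable {S : Type}

/-- The dual formula. -/
def dual : TForm S → TForm S
  | top => bot
  | bot => top
  | conj φ ψ => disj φ.dual ψ.dual
  | disj φ ψ => conj φ.dual ψ.dual
  | loc s => loc s
  | guard g => guard g.compl
  | reset φ => reset φ.dual

theorem ev_dual {L : S → ℝ → Prop} {now : ℝ} {φ : TForm S} {t : ℝ} :
    φ.dual.Ev (fun s t => ¬ L s t) now t ↔ ¬ φ.Ev L now t := by
  induction φ generalizing t with
  | top => simp [dual, Ev]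
  | bot => simp [dual, Ev]
  | conj φ ψ ihφ ihψ => simp only [dual, Ev, ihφ, ihψ]; tauto
  | disj φ ψ ihφ ihψ => simp only [dual, Ev, ihφ, ihψ]; tauto
  | loc s => rfl
  | guard g => exact Guard.holds_compl
  | reset _ ih => exact ih

theorem freeLocs_dual (φ : TForm S) : φ.dual.freeLocs = φ.freeLocs := by
  induction φ with
  | conj φ ψ ihφ ihψ => simp [dual, freeLocs, ihφ, ihψ]
  | disj φ ψ ihφ ihψ => simp [dual, freeLocs, ihφ, ihψ]
  | _ => rfl

theorem boundLocs_dual (φ : TForm S) : φ.dual.boundLocs = φ.boundLocs := by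
  induction φ with
  | conj φ ψ ihφ ihψ => simp [dual, boundLocs, ihφ, ihψ]
  | disj φ ψ ihφ ihψ => simp [dual, boundLocs, ihφ, ihψ]
  | reset φ ih => simp [dual, boundLocs, ih, freeLocs_dual]
  | _ => rfl

theorem guards_dual {J : Interval → Prop} {φ : TForm S} (h : ∀ g ∈ φ.guards, J g.interval) :
    ∀ g ∈ φ.dual.guards, J g.interval := by
  induction φ with
  | conj φ ψ ihφ ihψ =>
    rintro g (hg | hg)
    · exact ihφ (fun g hg => h g (.inl hg)) g hg
    · exact ihψ (fun g hg => h g (.inr hg)) g hg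
  | disj φ ψ ihφ ihψ =>
    rintro g (hg | hg)
    · exact ihφ (fun g hg => h g (.inl hg)) g hg
    · exact ihψ (fun g hg => h g (.inr hg)) g hg
  | guard g =>
    rintro _ rfl
    rw [Guard.interval_compl]
    exact h g rfl
  | reset φ ih => exact ih h
  | _ => exact fun g hg => hg.elim

theorem IsResetCombination.dual {β : TForm S} (hβ : β.IsResetCombination) :
    β.dual.IsResetCombination := by
  induction hβ with
  | top => exact .bot
  | bot => exact .top
  | atom q => exact .atom q
  | conj _ _ ih₁ ih₂ => exact .disj ih₁ ih₂
  | disj _ _ ih₁ ih₂ => exact .conj ih₁ ih₂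

theorem IsConjunctive.dual {Q : Set S} {φ : TForm S} (h : φ.IsConjunctive Q) :
    φ.dual.IsDisjunctive Q := by
  induction h with
  | loc h => exact .loc h
  | locOr h hβ => exact .locAnd h hβ.dual
  | guard g => exact .guard _
  | guardOr g hβ => exact .guardAnd _ hβ.dual
  | resets hβ => exact .resets hβ.dual
  | conj _ _ ih₁ ih₂ => exact .disj ih₁ ih₂

theorem IsDisjunctive.dual {Q : Set S} {φ : TForm S} (h : φ.IsDisjunctive Q) :
    φ.dual.IsConjunctive Q := by
  induction h with
  | loc h => exact .loc h
  | locAnd h hβ => exact .locOr h hβ.dual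
  | guard g => exact .guard _
  | guardAnd g hβ => exact .guardOr _ hβ.dual
  | resets hβ => exact .resets hβ.dual
  | disj _ _ ih₁ ih₂ => exact .conj ih₁ ih₂

end TForm

theorem accept_dual {S : Type} {δ : S → Letter P → TForm S} {F : Set S}
    {ρ : TimedWord P} {k : ℕ} {s : S} {t : ℝ} :
    Accept (fun s a => (δ s a).dual) Fᶜ ρ k s t ↔ ¬ Accept δ F ρ k s t := by
  have : ∀ m, acceptRem (fun s a => (δ s a).dual) Fᶜ ρ m = fun s t => ¬ acceptRem δ F ρ m s t := by
    intro m
    induction m with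
    | zero => rfl
    | succ m ih =>
      funext s t
      rw [acceptRem, ih, acceptRem]
      exact propext TForm.ev_dual
  rw [Accept, this, Accept]

/-! ### Paths -/

section Path

variable {S : Type*}

/-- A path that reads the positions `i, …, j - 1`, where the step from `p` to `q` is allowed at the
positions that satisfy `step p q`. -/
inductive Path (ρ : TimedWord P) (step : S → S → Formula P) : S → ℕ → S → ℕ → Prop
  | refl (q : S) (i : ℕ) : Path ρ step q i q i
  | cons {p q r : S} {i j : ℕ} :
      SatAt ρ (step p q) i → Path ρ step q (i + 1) r j → Path ρ step p i r j

variable {ρ : TimedWord P} {step : S → S → Formula P}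

theorem Path.le {p q : S} {i j : ℕ} (h : Path ρ step p i q j) : i ≤ j := by
  induction h with
  | refl => exact le_rfl
  | cons _ _ ih => omega

theorem path_iff {p r : S} {i j : ℕ} : Path ρ step p i r j ↔
    (p = r ∧ i = j) ∨ ∃ q, SatAt ρ (step p q) i ∧ Path ρ step q (i + 1) r j := by
  constructor
  · rintro (_ | ⟨hstep, h⟩)
    · exact .inl ⟨rfl, rfl⟩
    · exact .inr ⟨_, hstep, h⟩
  · rintro (⟨rfl, rfl⟩ | ⟨q, hstep, h⟩)
    · exact .refl _ _
    · exact .cons hstep h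

theorem path_self_iff {p q : S} {i : ℕ} : Path ρ step p i q i ↔ p = q := by
  refine path_iff.trans ⟨?_, fun h => .inl ⟨h, rfl⟩⟩
  rintro (⟨h, -⟩ | ⟨_, -, h⟩)
  · exact h
  · exact absurd h.le (by omega)

theorem Path.trans {p q r : S} {i j k : ℕ} (h : Path ρ step p i q j) (h' : Path ρ step q j r k) :
    Path ρ step p i r k := by
  induction h with
  | refl => exact h'
  | cons hstep _ ih => exact .cons hstep (ih h')

theorem path_succ_iff {p r : S} {i j : ℕ} (hij : i ≤ j) : Path ρ step p i r (j + 1) ↔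
    ∃ q, Path ρ step p i q j ∧ SatAt ρ (step q r) j := by
  constructor
  · intro h
    induction hij using Nat.decreasingInduction generalizing p with
    | self =>
      obtain ⟨-, h⟩ | ⟨q, hstep, h⟩ := path_iff.1 h
      · omega
      · exact ⟨p, .refl _ _, path_self_iff.1 h ▸ hstep⟩
    | of_succ i hi ih =>
      obtain ⟨-, h⟩ | ⟨q, hstep, h⟩ := path_iff.1 h
      · omega
      · obtain ⟨q', hpath, hlast⟩ := ih h
        exact ⟨q', .cons hstep hpath, hlast⟩
  · rintro ⟨q, h, hstep⟩
    exact h.trans (.cons hstep (.refl _ _))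

theorem path_and_iff {χ : Formula P} {p q : S} {i j : ℕ} :
    Path ρ (fun p q => .and (step p q) χ) p i q j ↔
      Path ρ step p i q j ∧ ∀ k, i ≤ k → k < j → SatAt ρ χ k := by
  constructor
  · intro h
    induction h with
    | refl => exact ⟨.refl _ _, fun k _ _ => by omega⟩
    | cons hstep _ ih =>
      obtain ⟨hstep, hχ⟩ := satAt_and.1 hstep
      refine ⟨.cons hstep ih.1, fun k hk hkj => ?_⟩
      rcases Nat.eq_or_lt_of_le hk with rfl | hk
      · exact hχ
      · exact ih.2 k hk hkj
  · rintro ⟨h, hχ⟩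
    induction h with
    | refl => exact .refl _ _
    | cons hstep h ih =>
      exact .cons (satAt_and.2 ⟨hstep, hχ _ le_rfl h.le⟩)
        (ih fun k hk hkj => hχ k (by omega) hkj)

/-- The expression `re` over the steps defines the paths from `p` to `q`. -/
def DefinesPath (step : S → S → Formula P) (p q : S) (re : RatExp (Formula P)) : Prop :=
  re.LettersIn (fun ψ => ψ = .fls ∨ ∃ p q, ψ = step p q) ∧
    ∀ (ρ : TimedWord P) (i j : ℕ), Match ρ re i j ↔ Path ρ step p i q j

theorem DefinesPath.lettersIn_within {J : Interval → Prop} {R : RatExp (Formula P) → Prop}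
    {p q : S} {re : RatExp (Formula P)} (h : DefinesPath step p q re)
    (hstep : ∀ p q, (step p q).Within J R) : re.LettersIn (Formula.Within J R) := by
  intro ψ hψ
  obtain rfl | ⟨p, q, rfl⟩ := h.1 ψ hψ
  · exact .fls
  · exact hstep p q

/-- The nonempty paths with all intermediate states in `X`. -/
inductive PathVia (ρ : TimedWord P) (step : S → S → Formula P) (X : Set S) :
    S → ℕ → S → ℕ → Prop
  | single {p q : S} {i : ℕ} : SatAt ρ (step p q) i → PathVia ρ step X p i q (i + 1)
  | cons {p q r : S} {i j : ℕ} : SatAt ρ (step p q) i → q ∈ X →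
      PathVia ρ step X q (i + 1) r j → PathVia ρ step X p i r j

theorem PathVia.trans {X : Set S} {p q r : S} {i j k : ℕ} (h : PathVia ρ step X p i q j)
    (hq : q ∈ X) (h' : PathVia ρ step X q j r k) : PathVia ρ step X p i r k := by
  induction h with
  | single hstep => exact .cons hstep hq h'
  | cons hstep hX _ ih => exact .cons hstep hX (ih hq h')

theorem PathVia.mono {X Y : Set S} (hXY : X ⊆ Y) {p q : S} {i j : ℕ}
    (h : PathVia ρ step X p i q j) : PathVia ρ step Y p i q j := by
  induction h with
  | single hstep => exact .single hstep
  | cons hstep hX _ ih => exact .cons hstep (hXY hX) ih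

theorem pathVia_insert {X : Set S} {z p q : S} {i j : ℕ} :
    PathVia ρ step (insert z X) p i q j ↔ PathVia ρ step X p i q j ∨
      ∃ k, PathVia ρ step X p i z k ∧ ∃ l,
        Relation.ReflTransGen (fun a b => PathVia ρ step X z a z b) k l ∧
          PathVia ρ step X z l q j := by
  constructor
  · intro h
    induction h with
    | single hstep => exact .inl (.single hstep)
    | cons hstep hX _ ih =>
      rcases hX with rfl | hX
      · right
        refine ⟨_, .single hstep, ?_⟩
        rcases ih with h | ⟨k, hfirst, l, hloops, hlast⟩
        · exact ⟨_, .refl, h⟩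
        · exact ⟨l, .head hfirst hloops, hlast⟩
      · rcases ih with h | ⟨k, hfirst, hrest⟩
        · exact .inl (.cons hstep hX h)
        · exact .inr ⟨k, .cons hstep hX hfirst, hrest⟩
  · have hsub : X ⊆ insert z X := Set.subset_insert _ _
    rintro (h | ⟨k, hfirst, l, hloops, hlast⟩)
    · exact h.mono hsub
    · refine (hfirst.mono hsub).trans (.inl rfl) ?_
      clear hfirst
      induction hloops using Relation.ReflTransGen.head_induction_on with
      | refl => exact hlast.mono hsub
      | head hloop _ ih => exact (hloop.mono hsub).trans (.inl rfl) ih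

theorem path_iff_pathVia_univ {p q : S} {i j : ℕ} :
    Path ρ step p i q j ↔ (p = q ∧ i = j) ∨ PathVia ρ step Set.univ p i q j := by
  constructor
  · intro h
    induction h with
    | refl => exact .inl ⟨rfl, rfl⟩
    | cons hstep _ ih =>
      obtain ⟨rfl, rfl⟩ | ih := ih
      · exact .inr (.single hstep)
      · exact .inr (.cons hstep trivial ih)
  · rintro (⟨rfl, rfl⟩ | h)
    · exact .refl _ _
    · induction h with
      | single hstep => exact .cons hstep (.refl _ _)
      | cons hstep _ _ ih => exact .cons hstep ih

theorem exists_match_iff_pathVia (step : S → S → Formula P) {X : Set S} (hX : X.Finite) :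
    ∃ re : S → S → RatExp (Formula P), ∀ p q,
      (re p q).LettersIn (fun ψ => ψ = .fls ∨ ∃ p q, ψ = step p q) ∧
        ∀ (ρ : TimedWord P) (i j : ℕ), Match ρ (re p q) i j ↔ PathVia ρ step X p i q j := by
  induction X, hX using Set.Finite.induction_on with
  | empty =>
    refine ⟨fun p q => .letter (step p q), fun p q => ⟨.letter (.inr ⟨p, q, rfl⟩), ?_⟩⟩
    intro ρ i j
    rw [match_letter]
    constructor
    · rintro ⟨rfl, h⟩
      exact .single h
    · rintro (h | ⟨_, h, _⟩)
      · exact ⟨rfl, h⟩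
      · exact h.elim
  | @insert z X _ _ ih =>
    obtain ⟨re, hre⟩ := ih
    refine ⟨fun p q => .alt (re p q) (.cat (re p z) (.cat (.star (re z z)) (re z q))),
      fun p q => ⟨?_, fun ρ i j => ?_⟩⟩
    · exact .alt (hre p q).1 (.cat (hre p z).1 (.cat (.star (hre z z).1) (hre z q).1))
    · have hloop : Match ρ (re z z) = fun a b => PathVia ρ step X z a z b := by
        funext a b
        exact propext ((hre z z).2 ρ a b)
      simp only [pathVia_insert, match_alt, match_cat, match_star, (hre _ _).2 ρ, hloop]

open Classical in
/-- The expression `ε` if `c` holds, and the empty language otherwise. -/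
noncomputable def RatExp.epsIf (c : Prop) : RatExp (Formula P) := if c then .eps else .letter .fls

@[simp] theorem match_epsIf {c : Prop} {i j : ℕ} : Match ρ (.epsIf c) i j ↔ c ∧ i = j := by
  rw [RatExp.epsIf]
  split_ifs with hc <;> simp [hc]

theorem RatExp.LettersIn.epsIf {p : Formula P → Prop} (hp : p .fls) (c : Prop) :
    (RatExp.epsIf c).LettersIn p := by
  rw [RatExp.epsIf]
  split_ifs
  · exact .eps
  · exact .letter hp

theorem RatExp.IsLetterStar.epsIf (c : Prop) : (.epsIf c : RatExp (Formula P)).IsLetterStar := by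
  rw [RatExp.epsIf]
  split_ifs
  · exact .eps
  · exact .letter _

theorem exists_definesPath [Finite S] (step : S → S → Formula P) :
    ∃ re : S → S → RatExp (Formula P), ∀ p q, DefinesPath step p q (re p q) := by
  obtain ⟨re, hre⟩ := exists_match_iff_pathVia step (Set.finite_univ (α := S))
  refine ⟨fun p q => .alt (.epsIf (p = q)) (re p q), fun p q => ⟨?_, fun ρ i j => ?_⟩⟩
  · exact .alt (.epsIf (.inl rfl) _) (hre p q).1
  · rw [path_iff_pathVia_univ, match_alt, match_epsIf, (hre p q).2]

theorem Path.of_forall_satAt {p : S} {i k : ℕ} (hik : i ≤ k)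
    (h : ∀ m, i ≤ m → m < k → SatAt ρ (step p p) m) : Path ρ step p i p k := by
  induction k, hik using Nat.le_induction with
  | base => exact .refl _ _
  | succ k hk ih =>
    exact (path_succ_iff hk).2 ⟨p, ih fun m hm hmk => h m hm (by omega), h k hk (by omega)⟩

theorem path_iff_exists_leave {p q : S} {i j : ℕ} : Path ρ step p i q j ↔
    ∃ k, (i ≤ k ∧ ∀ m, i ≤ m → m < k → SatAt ρ (step p p) m) ∧
      ((p = q ∧ k = j) ∨ ∃ r, r ≠ p ∧ SatAt ρ (step p r) k ∧ Path ρ step r (k + 1) q j) := by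
  constructor
  · intro h
    induction h with
    | refl q i => exact ⟨i, ⟨le_rfl, fun m _ _ => by omega⟩, .inl ⟨rfl, rfl⟩⟩
    | @cons p r q i j hstep h ih =>
      by_cases hr : r = p
      · subst hr
        obtain ⟨k, ⟨hk, hstay⟩, hleave⟩ := ih
        refine ⟨k, ⟨by omega, fun m hm hmk => ?_⟩, hleave⟩
        rcases Nat.eq_or_lt_of_le hm with rfl | hm
        · exact hstep
        · exact hstay m hm hmk
      · exact ⟨i, ⟨le_rfl, fun m _ _ => by omega⟩, .inr ⟨r, hr, hstep, h⟩⟩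
  · rintro ⟨k, ⟨hik, hstay⟩, hleave⟩
    refine (Path.of_forall_satAt hik hstay).trans ?_
    obtain ⟨rfl, rfl⟩ | ⟨r, -, hstep, h⟩ := hleave
    · exact .refl _ _
    · exact .cons hstep h

section PartiallyOrdered

variable [Finite S] {lt : S → S → Prop} [IsStrictOrder S lt]
  (hstep : ∀ (ρ : TimedWord P) k p q, SatAt ρ (step p q) k → q = p ∨ lt q p)

include hstep

theorem exists_isLetterStar_definesPath_of_forall_lt {p q : S} {re : S → RatExp (Formula P)}
    (hre : ∀ r, lt r p → (re r).IsLetterStar ∧ DefinesPath step r q (re r)) :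
    ∃ re', re'.IsLetterStar ∧ DefinesPath step p q re' := by
  let tail : RatExp (Formula P) := .iAlt fun r : {r // lt r p} => .cat (.letter (step p r)) (re r)
  refine ⟨.cat (.star (.letter (step p p))) (.alt (.epsIf (p = q)) tail), ?_, ?_, fun ρ i j => ?_⟩
  · exact .cat (.star _) (.alt (.epsIf _) (.iAlt fun r => .cat (.letter _) (hre r r.2).1))
  · exact .cat (.star (.letter (.inr ⟨_, _, rfl⟩))) (.alt (.epsIf (.inl rfl) _)
      (.iAlt (.inl rfl) fun r => .cat (.letter (.inr ⟨_, _, rfl⟩)) (hre r r.2).2.1))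
  · have htail : ∀ k, Match ρ tail k j ↔
        ∃ r, r ≠ p ∧ SatAt ρ (step p r) k ∧ Path ρ step r (k + 1) q j := by
      intro k
      simp only [tail, match_iAlt, match_cat, match_letter, Subtype.exists]
      constructor
      · rintro ⟨r, hr, _, ⟨rfl, hsat⟩, h⟩
        exact ⟨r, ne_of_irrefl hr, hsat, ((hre r hr).2.2 ρ _ _).1 h⟩
      · rintro ⟨r, hr, hsat, h⟩
        have hlt : lt r p := (hstep ρ k p r hsat).resolve_left hr
        exact ⟨r, hlt, _, ⟨rfl, hsat⟩, ((hre r hlt).2.2 ρ _ _).2 h⟩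
    simp only [path_iff_exists_leave (i := i), match_cat, match_star_letter, match_alt, match_epsIf,
      htail]

theorem exists_isLetterStar_definesPath :
    ∃ re : S → S → RatExp (Formula P), ∀ p q,
      (re p q).IsLetterStar ∧ DefinesPath step p q (re p q) := by
  have hexists : ∀ q p, ∃ re, re.IsLetterStar ∧ DefinesPath step p q re := by
    intro q p
    induction p using (Finite.wellFounded_of_trans_of_irrefl lt).induction with
    | _ p ih =>
      have : Nonempty (RatExp (Formula P)) := ⟨.eps⟩
      choose! re hre using ih
      exact exists_isLetterStar_definesPath_of_forall_lt hstep hre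
  choose re hre using hexists
  exact ⟨fun p q => re q p, fun p q => hre q p⟩

end PartiallyOrdered

end Path

/-! ### Letters and clock constraints as formulas -/

section Letter

variable [Finite P]

/-- The formula that holds at the positions with the symbol `a`. -/
noncomputable def Formula.ofLetter (a : Letter P) : Formula P :=
  .exactly (fun p : P => .atom p) a.1

@[simp] theorem satAt_ofLetter {a : Letter P} {ρ : TimedWord P} {k : ℕ} :
    SatAt ρ (.ofLetter a) k ↔ ρ.letterAt k = a := by
  rw [Formula.ofLetter, satAt_exactly]
  simp only [satAt_atom]
  exact ⟨fun h => Subtype.ext h.symm, fun h => by rw [h]; rfl⟩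

theorem Formula.Within.ofLetter {J : Interval → Prop} {R : RatExp (Formula P) → Prop}
    (a : Letter P) : (Formula.ofLetter a).Within J R :=
  within_exactly .atom a.1

end Letter

theorem Interval.not_punctual_co (a b : ℕ) : ¬ (Interval.co a b).Punctual := by
  rintro ⟨_, h⟩
  cases h

theorem Interval.not_punctual_ci (a : ℕ) : ¬ (Interval.ci a).Punctual := by
  rintro ⟨_, h⟩
  cases h

theorem Interval.not_punctual_oi (a : ℕ) : ¬ (Interval.oi a).Punctual := by
  rintro ⟨_, h⟩
  cases h

theorem Interval.punctual_cc {a b : ℕ} : (Interval.cc a b).Punctual ↔ a = b := by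
  simp [Interval.Punctual, eq_comm]

theorem forall_satAt_nextSimul_iff {ρ : TimedWord P} {i j : ℕ} (hij : i ≤ j) (hj : j ≤ ρ.last) :
    (∀ k, i ≤ k → k < j → SatAt ρ .nextSimul k) ↔ ρ.timeAt j = ρ.timeAt i := by
  constructor
  · intro h
    induction j, hij using Nat.le_induction with
    | base => rfl
    | succ j hij ih =>
      exact ((satAt_nextSimul hj).1 (h j hij j.lt_succ_self)).trans
        (ih (by omega) fun k hik hkj => h k hik (by omega))
  · intro h k hik hkj
    rw [satAt_nextSimul (by omega)]
    refine le_antisymm ?_ (ρ.timeAt_mono k.le_succ)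
    exact (ρ.timeAt_mono hkj).trans (h.le.trans (ρ.timeAt_mono hik))

/-- The expression `re₀` matches the segments that `re` matches without any time elapsing. -/
def RatExp.IsInstantPart (re₀ re : RatExp (Formula P)) : Prop :=
  ∀ (ρ : TimedWord P) (i j : ℕ), j ≤ ρ.last →
    (Match ρ re₀ i j ↔ Match ρ re i j ∧ ρ.timeAt j = ρ.timeAt i)

theorem DefinesPath.isInstantPart {S : Type*} {step : S → S → Formula P} {p q : S}
    {re₀ re : RatExp (Formula P)}
    (h₀ : DefinesPath (fun p q => .and (step p q) .nextSimul) p q re₀)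
    (h : DefinesPath step p q re) : re₀.IsInstantPart re := by
  intro ρ i j hj
  rw [h₀.2, h.2, path_and_iff]
  exact and_congr_right fun hpath => forall_satAt_nextSimul_iff hpath.le hj

/-- `FRat` for the interval `[0, a]`, which is punctual for `a = 0`: then the expression `re₀`,
which stands for the instantaneous part of `re`, is used instead. -/
def Formula.fratLe (a : ℕ) (re re₀ : RatExp (Formula P)) (φ : Formula P) : Formula P :=
  if a = 0 then .and .nextSimul (.frat (.ci 0) re₀ φ) else .frat (.cc 0 a) re φ

/-- `FRat` with a clock constraint in place of an interval. -/
def Formula.fratGuard (re re₀ : RatExp (Formula P)) (φ : Formula P) : Guard → Formula P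
  | .mem I => .frat I re φ
  | .notMem (.cc a b) => .orList [.frat (.co 0 a) re φ, .frat (.oi b) re φ]
  | .notMem (.co a b) => .orList [.frat (.co 0 a) re φ, .frat (.ci b) re φ]
  | .notMem (.oc a b) => .orList [.fratLe a re re₀ φ, .frat (.oi b) re φ]
  | .notMem (.oo a b) => .orList [.fratLe a re re₀ φ, .frat (.ci b) re φ]
  | .notMem (.ci a) => .frat (.co 0 a) re φ
  | .notMem (.oi a) => .fratLe a re re₀ φ

/-- The semantics of `FRat` at the position `i` for an arbitrary set `D` of delays. -/
def FratAt (ρ : TimedWord P) (re : RatExp (Formula P)) (φ : Formula P) (i : ℕ) (D : Set ℝ) : Prop :=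
  ∃ j, i < j ∧ j ≤ ρ.last ∧ SatAt ρ φ j ∧ ρ.timeAt j - ρ.timeAt i ∈ D ∧ Match ρ re (i + 1) j

section FratGuard

variable {re re₀ : RatExp (Formula P)} {φ : Formula P} {ρ : TimedWord P} {i : ℕ}

theorem fratAt_congr {D D' : Set ℝ} (h : ∀ d, 0 ≤ d → (d ∈ D ↔ d ∈ D')) :
    FratAt ρ re φ i D ↔ FratAt ρ re φ i D' :=
  exists_congr fun _ => and_congr_right fun hij => and_congr_right fun _ => and_congr_right fun _ =>
    and_congr_left fun _ => h _ (sub_nonneg.2 (ρ.timeAt_mono hij.le))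

theorem fratAt_union {D D' : Set ℝ} :
    FratAt ρ re φ i (D ∪ D') ↔ FratAt ρ re φ i D ∨ FratAt ρ re φ i D' := by
  simp only [FratAt, Set.mem_union, or_and_right, and_or_left, exists_or]

theorem satAt_frat_iff_fratAt {I : Interval} (hi : i ≤ ρ.last) :
    SatAt ρ (.frat I re φ) i ↔ FratAt ρ re φ i I.toSet := satAt_frat hi

theorem satAt_fratLe {a : ℕ} (hre : re₀.IsInstantPart re) (hi : i ≤ ρ.last) :
    SatAt ρ (.fratLe a re re₀ φ) i ↔ FratAt ρ re φ i (Set.Iic a) := by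
  rw [Formula.fratLe]
  split_ifs with ha
  · subst ha
    rw [satAt_and, satAt_frat hi]
    constructor
    · rintro ⟨hnext, j, hij, hj, hφ, -, hmatch⟩
      obtain ⟨hmatch, htime⟩ := (hre ρ _ _ hj).1 hmatch
      refine ⟨j, hij, hj, hφ, ?_, hmatch⟩
      simp [htime, (satAt_nextSimul (by omega)).1 hnext]
    · rintro ⟨j, hij, hj, hφ, hle, hmatch⟩
      have htime : ρ.timeAt j ≤ ρ.timeAt i := by simpa using hle
      have hsucc := ρ.timeAt_mono (Nat.le_succ i)
      have hrest := ρ.timeAt_mono (show i + 1 ≤ j from hij)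
      refine ⟨(satAt_nextSimul (by omega)).2 (le_antisymm (hrest.trans htime) hsucc), j, hij, hj,
        hφ, ?_, (hre ρ _ _ hj).2 ⟨hmatch, le_antisymm (htime.trans hsucc) hrest⟩⟩
      simpa [Interval.toSet] using ρ.timeAt_mono hij.le
  · rw [satAt_frat_iff_fratAt hi]
    exact fratAt_congr fun d hd => by simp [Interval.toSet, hd]

theorem satAt_fratGuard {g : Guard} (hre : re₀.IsInstantPart re) (hi : i ≤ ρ.last) :
    SatAt ρ (.fratGuard re re₀ φ g) i ↔ FratAt ρ re φ i {d | g.Holds d} := by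
  rcases g with I | I
  · exact satAt_frat hi
  · cases I <;> simp only [Formula.fratGuard, satAt_orList, List.mem_cons, List.not_mem_nil,
      or_false, exists_eq_or_imp, exists_eq_left, satAt_frat_iff_fratAt hi, satAt_fratLe hre hi,
      ← fratAt_union] <;>
    refine fratAt_congr fun d hd => ?_ <;>
    simp [Guard.Holds, Interval.toSet, hd, imp_iff_not_or]

section Within

variable {J : Interval → Prop} {R : RatExp (Formula P) → Prop}
  (hJ : ∀ I : Interval, ¬ I.Punctual → J I)

include hJ

theorem Formula.Within.atEnd : (Formula.atEnd : Formula P).Within J R :=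
  .neg (.until (hJ _ (Interval.not_punctual_ci 0)) .tru .tru)

theorem Formula.Within.nextSimul : (Formula.nextSimul : Formula P).Within J R :=
  .neg (.until (hJ _ (Interval.not_punctual_oi 0)) .fls .tru)

variable (hR : R re) (hR₀ : R re₀) (hletters : re.LettersIn (Formula.Within J R))
  (hletters₀ : re₀.LettersIn (Formula.Within J R)) (hφ : φ.Within J R)

include hR hR₀ hletters hletters₀ hφ

theorem Formula.Within.fratLe (a : ℕ) : (Formula.fratLe a re re₀ φ).Within J R := by
  rw [Formula.fratLe]
  split_ifs with ha
  · exact .and (.nextSimul hJ) (.frat (hJ _ (Interval.not_punctual_ci 0)) hR₀ hletters₀ hφ)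
  · exact .frat (hJ _ (mt Interval.punctual_cc.1 (Ne.symm ha))) hR hletters hφ

theorem Formula.Within.fratGuard {g : Guard} (hg : J g.interval) :
    (Formula.fratGuard re re₀ φ g).Within J R := by
  have hfrat : ∀ I, J I → (Formula.frat I re φ).Within J R := fun I hI => .frat hI hR hletters hφ
  have hco := fun a b => hfrat _ (hJ _ (Interval.not_punctual_co a b))
  have hci := fun a => hfrat _ (hJ _ (Interval.not_punctual_ci a))
  have hoi := fun a => hfrat _ (hJ _ (Interval.not_punctual_oi a))
  have hle := Formula.Within.fratLe hJ hR hR₀ hletters hletters₀ hφ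
  rcases g with I | I
  · exact hfrat I hg
  · cases I <;> simp only [Formula.fratGuard]
    · exact .orPair (hco _ _) (hoi _)
    · exact .orPair (hco _ _) (hci _)
    · exact .orPair (hle _) (hoi _)
    · exact .orPair (hle _) (hci _)
    · exact hco _ _
    · exact hle _

end Within

end FratGuard

/-! ### Transition formulas as formulas of the logic -/

section FormulaOf

variable {S : Type}

open Classical in
/-- The formula with the constant truth value `c`. -/
noncomputable def Formula.ofProp (c : Prop) : Formula P := if c then .tru else .fls

@[simp] theorem satAt_ofProp {c : Prop} {ρ : TimedWord P} {k : ℕ} : SatAt ρ (.ofProp c) k ↔ c := by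
  rw [Formula.ofProp]
  split_ifs with hc <;> simp [hc]

theorem Formula.Within.ofProp {J : Interval → Prop} {R : RatExp (Formula P) → Prop} (c : Prop) :
    (Formula.ofProp c).Within J R := by
  rw [Formula.ofProp]
  split_ifs
  · exact .tru
  · exact .fls

/-- The formula obtained from a transition formula that is evaluated with the clock value `0`,
where the formulas `Φ s` stand for the locations. -/
noncomputable def TForm.toFormula (Φ : S → Formula P) : TForm S → Formula P
  | top => .tru
  | bot => .fls
  | conj φ ψ => .and (φ.toFormula Φ) (ψ.toFormula Φ)
  | disj φ ψ => .orList [φ.toFormula Φ, ψ.toFormula Φ]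
  | loc s => Φ s
  | guard g => .ofProp (g.Holds 0)
  | reset φ => φ.toFormula Φ

theorem TForm.satAt_toFormula {Φ : S → Formula P} {L : S → ℝ → Prop} {now : ℝ}
    {ρ : TimedWord P} {k : ℕ} {φ : TForm S}
    (h : ∀ s ∈ φ.freeLocs ∪ φ.boundLocs, SatAt ρ (Φ s) k ↔ L s now) :
    SatAt ρ (φ.toFormula Φ) k ↔ φ.Ev L now now := by
  induction φ with
  | top => simp [toFormula, Ev]
  | bot => simp [toFormula, Ev]
  | conj φ ψ ihφ ihψ =>
    rw [toFormula, satAt_and, Ev, ihφ fun s hs => h s (hs.imp .inl .inl),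
      ihψ fun s hs => h s (hs.imp .inr .inr)]
  | disj φ ψ ihφ ihψ =>
    rw [Ev, ← ihφ fun s hs => h s (hs.imp .inl .inl), ← ihψ fun s hs => h s (hs.imp .inr .inr)]
    simp [toFormula]
  | loc s => exact h s (.inl rfl)
  | guard g => rw [toFormula, satAt_ofProp, Ev, sub_self]
  | reset φ ih => exact ih fun s hs => h s (.inr hs)

theorem Formula.Within.toFormula {J : Interval → Prop} {R : RatExp (Formula P) → Prop}
    {Φ : S → Formula P} (hΦ : ∀ s, (Φ s).Within J R) (φ : TForm S) :
    (φ.toFormula Φ).Within J R := by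
  induction φ with
  | top => exact .tru
  | bot => exact .fls
  | conj _ _ ihφ ihψ => exact .and ihφ ihψ
  | disj _ _ ihφ ihψ => exact .orPair ihφ ihψ
  | loc s => exact hΦ s
  | guard => exact .ofProp _
  | reset _ ih => exact ih

/-! ### Clauses of disjunctive transition formulas -/

/-- A clause of a disjunctive transition formula: `step q β` stands for `q ∧ β`, which continues in
the island, and `exit g β` stands for `g ∧ β`, which leaves it. -/
inductive Clause (S : Type) where
  | step (q : S) (β : TForm S)
  | exit (g : Guard) (β : TForm S)

/-- The truth value of a clause, with the conventions of `TForm.Ev`; the resets in `β` make the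
value of the clock irrelevant there. -/
def Clause.Holds (L : S → ℝ → Prop) (now t : ℝ) : Clause S → Prop
  | step q β => L q t ∧ β.Ev L now now
  | exit g β => g.Holds (now - t) ∧ β.Ev L now now

/-- The clauses of a disjunctive transition formula. A clause without a location and a clock
constraint gets the constraint `x ∈ [0, ∞)`. -/
def TForm.clauses : TForm S → List (Clause S)
  | disj φ ψ => φ.clauses ++ ψ.clauses
  | loc q => [.step q .top]
  | conj (loc q) β => [.step q β]
  | guard g => [.exit g .top]
  | conj (guard g) β => [.exit g β]
  | β => [.exit (.mem (.ci 0)) β]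

namespace TForm

variable {φ β : TForm S} {q : S} {g : Guard}

theorem of_step_mem_clauses (h : .step q β ∈ φ.clauses) :
    q ∈ φ.freeLocs ∧ β.boundLocs ⊆ φ.boundLocs := by
  fun_induction clauses φ with
  | case1 φ ψ ihφ ihψ =>
    rcases List.mem_append.1 h with h | h
    · exact ⟨.inl (ihφ h).1, (ihφ h).2.trans Set.subset_union_left⟩
    · exact ⟨.inr (ihψ h).1, (ihψ h).2.trans Set.subset_union_right⟩
  | _ => simp_all [freeLocs, boundLocs]

theorem of_exit_mem_clauses (h : .exit g β ∈ φ.clauses) :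
    (g ∈ φ.guards ∨ g = .mem (.ci 0)) ∧ β.boundLocs ⊆ φ.boundLocs := by
  fun_induction clauses φ with
  | case1 φ ψ ihφ ihψ =>
    rcases List.mem_append.1 h with h | h
    · exact ⟨(ihφ h).1.imp_left .inl, (ihφ h).2.trans Set.subset_union_left⟩
    · exact ⟨(ihψ h).1.imp_left .inr, (ihψ h).2.trans Set.subset_union_right⟩
  | _ => simp_all [guards, boundLocs]

theorem IsResetCombination.exists_of_mem_clauses (hφ : φ.IsResetCombination) {c : Clause S}
    (hc : c ∈ φ.clauses) : ∃ β, β.IsResetCombination ∧ c = .exit (.mem (.ci 0)) β := by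
  induction hφ with
  | top => exact ⟨_, .top, List.mem_singleton.1 hc⟩
  | bot => exact ⟨_, .bot, List.mem_singleton.1 hc⟩
  | atom q => exact ⟨_, .atom q, List.mem_singleton.1 hc⟩
  | conj hβ hγ => exact ⟨_, .conj hβ hγ, by cases hβ <;> exact List.mem_singleton.1 hc⟩
  | disj _ _ ihβ ihγ => exact (List.mem_append.1 hc).elim ihβ ihγ

theorem IsDisjunctive.of_step_mem_clauses {Q : Set S} (hφ : φ.IsDisjunctive Q)
    (h : .step q β ∈ φ.clauses) : q ∈ Q ∧ β.IsResetCombination := by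
  induction hφ with
  | loc => simp_all [clauses, IsResetCombination.top]
  | locAnd => simp_all [clauses]
  | guard => simp [clauses] at h
  | guardAnd => simp [clauses] at h
  | resets hφ =>
    obtain ⟨_, -, h⟩ := hφ.exists_of_mem_clauses h
    cases h
  | disj _ _ ihφ ihψ => exact (List.mem_append.1 h).elim ihφ ihψ

theorem IsDisjunctive.of_exit_mem_clauses {Q : Set S} (hφ : φ.IsDisjunctive Q)
    (h : .exit g β ∈ φ.clauses) : β.IsResetCombination := by
  induction hφ with
  | loc => simp [clauses] at h
  | locAnd => simp [clauses] at h
  | guard => simp_all [clauses, IsResetCombination.top]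
  | guardAnd => simp_all [clauses]
  | resets hφ =>
    obtain ⟨_, hβ, h⟩ := hφ.exists_of_mem_clauses h
    cases h
    exact hβ
  | disj _ _ ihφ ihψ => exact (List.mem_append.1 h).elim ihφ ihψ

variable {L : S → ℝ → Prop} {now t : ℝ}

theorem IsResetCombination.ev_iff_exists_clause (hφ : φ.IsResetCombination) (ht : t ≤ now) :
    φ.Ev L now t ↔ ∃ c ∈ φ.clauses, c.Holds L now t := by
  have hci : (Guard.mem (.ci 0)).Holds (now - t) := by simpa [Guard.Holds, Interval.toSet] using ht
  induction hφ with
  | top => simp [clauses, Clause.Holds, Ev, hci]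
  | bot => simp [clauses, Clause.Holds, Ev]
  | atom q => simp [clauses, Clause.Holds, Ev, hci]
  | conj hβ hγ =>
    rw [(hβ.conj hγ).ev_iff (t' := now)]
    cases hβ <;> simp [clauses, Clause.Holds, hci]
  | disj _ _ ihβ ihγ =>
    simp only [clauses, List.mem_append, or_and_right, exists_or]
    exact or_congr ihβ ihγ

theorem IsDisjunctive.ev_iff_exists_clause {Q : Set S} (hφ : φ.IsDisjunctive Q) (ht : t ≤ now) :
    φ.Ev L now t ↔ ∃ c ∈ φ.clauses, c.Holds L now t := by
  induction hφ with
  | loc => simp [clauses, Clause.Holds, Ev]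
  | locAnd _ hβ => simp [clauses, Clause.Holds, Ev, hβ.ev_iff (t := t) (t' := now)]
  | guard => simp [clauses, Clause.Holds, Ev]
  | guardAnd _ hβ => simp [clauses, Clause.Holds, Ev, hβ.ev_iff (t := t) (t' := now)]
  | resets hφ => exact hφ.ev_iff_exists_clause ht
  | disj _ _ ihφ ihψ =>
    simp only [clauses, List.mem_append, or_and_right, exists_or]
    exact or_congr ihφ ihψ

end TForm

/-! ### Islands as formulas -/

/-- A transition from `p` to `q` inside an island, i.e. without a reset. -/
def FreeEdge (δ : S → Letter P → TForm S) (p q : S) : Prop := ∃ a, q ∈ (δ p a).freeLocs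

/-- Reachability inside an island. -/
def FreeReach (δ : S → Letter P → TForm S) : S → S → Prop := Relation.ReflTransGen (FreeEdge δ)

/-- The formula `φ` expresses acceptance by the location `p` with a clock that has just been
reset. -/
def Expresses (δ : S → Letter P → TForm S) (F : Set S) (p : S) (φ : Formula P) : Prop :=
  ∀ (ρ : TimedWord P) (k : ℕ), k ≤ ρ.last →
    (SatAt ρ φ k ↔ Accept δ F ρ (k + 1) p (ρ.timeAt k))

/-- `Expresses δ F s` is decided by the formulas `Φ` for the resets in the island of `s`. -/
def ExpressesResets (δ : S → Letter P → TForm S) (F : Set S) (Φ : S → Formula P) (s : S) : Prop :=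
  ∀ q, FreeReach δ s q → ∀ a, ∀ p ∈ (δ q a).boundLocs, Expresses δ F p (Φ p)

theorem iff_exists_path {ρ : TimedWord P} {step : S → S → Formula P} {F X : Set S} {n : ℕ}
    {acc exit : ℕ → S → Prop} (hend : ∀ p, acc n p ↔ p ∈ F)
    (hstep : ∀ p ∈ X, ∀ k q, SatAt ρ (step p q) k → q ∈ X) {k : ℕ} (hk : k ≤ n)
    (hacc : ∀ i, k ≤ i → i < n → ∀ p ∈ X,
      (acc i p ↔ exit i p ∨ ∃ q, SatAt ρ (step p q) i ∧ acc (i + 1) q)) {p : S} (hp : p ∈ X) :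
    acc k p ↔ (∃ q ∈ F, Path ρ step p k q n) ∨
      ∃ q j, j < n ∧ Path ρ step p k q j ∧ exit j q := by
  induction hk using Nat.decreasingInduction generalizing p with
  | self =>
    have hlate : ¬ ∃ q j, j < n ∧ Path ρ step p n q j ∧ exit j q := fun ⟨_, _, hj, hpath, _⟩ =>
      absurd hpath.le (by omega)
    simp [hend, hlate, path_self_iff]
  | of_succ k hk ih =>
    have ih := fun q hq => ih (fun i hi => hacc i (by omega)) (p := q) hq
    rw [hacc k le_rfl hk p hp]
    constructor
    · rintro (hexit | ⟨q, hpq, hq⟩)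
      · exact .inr ⟨p, k, hk, .refl _ _, hexit⟩
      · obtain ⟨r, hr, hpath⟩ | ⟨r, j, hj, hpath, hexit⟩ := (ih q (hstep p hp k q hpq)).1 hq
        · exact .inl ⟨r, hr, .cons hpq hpath⟩
        · exact .inr ⟨r, j, hj, .cons hpq hpath, hexit⟩
    · rintro (⟨r, hr, hpath⟩ | ⟨r, j, hj, hpath, hexit⟩)
      · obtain ⟨-, h⟩ | ⟨q, hpq, hpath⟩ := path_iff.1 hpath
        · omega
        · exact .inr ⟨q, hpq, (ih q (hstep p hp k q hpq)).2 (.inl ⟨r, hr, hpath⟩)⟩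
      · obtain ⟨rfl, rfl⟩ | ⟨q, hpq, hpath⟩ := path_iff.1 hpath
        · exact .inl hexit
        · exact .inr ⟨q, hpq, (ih q (hstep p hp k q hpq)).2 (.inr ⟨r, j, hj, hpath, hexit⟩)⟩

section Island

variable [Finite P] {δ : S → Letter P → TForm S} {F Q : Set S} {Φ : S → Formula P}
  {ρ : TimedWord P} {s p q : S} {k : ℕ} {t : ℝ}

variable (δ Φ) in
/-- The formula for the steps from `p` to `q`: a clause of `p` with the location `q` is satisfied,
where the formulas `Φ` stand for the resets. -/
noncomputable def clauseStep (p q : S) : Formula P :=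
  .iOr fun a => .and (.ofLetter a) (.orList ((δ p a).clauses.map fun
    | .step r β => .and (.ofProp (r = q)) (β.toFormula Φ)
    | .exit _ _ => .fls))

variable (δ Φ ρ t) in
/-- At the position `k`, a clause of `p` with a clock constraint is satisfied by a clock that has
been reset at time `t`. -/
def ClauseExit (k : ℕ) (p : S) : Prop :=
  ∃ g β, .exit g β ∈ (δ p (ρ.letterAt k)).clauses ∧ g.Holds (ρ.timeAt k - t) ∧
    SatAt ρ (β.toFormula Φ) k

theorem satAt_clauseStep : SatAt ρ (clauseStep δ Φ p q) k ↔
    ∃ β, .step q β ∈ (δ p (ρ.letterAt k)).clauses ∧ SatAt ρ (β.toFormula Φ) k := by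
  simp only [clauseStep, satAt_iOr, satAt_and, satAt_ofLetter, exists_eq_left', satAt_orList,
    List.mem_map, exists_exists_and_eq_and]
  constructor
  · rintro ⟨⟨r, β⟩ | ⟨g, β⟩, hc, h⟩
    · obtain ⟨hr, hβ⟩ := satAt_and.1 h
      obtain rfl := satAt_ofProp.1 hr
      exact ⟨β, hc, hβ⟩
    · exact absurd h not_satAt_fls
  · rintro ⟨β, hc, h⟩
    exact ⟨_, hc, satAt_and.2 ⟨satAt_ofProp.2 rfl, h⟩⟩

theorem freeEdge_of_satAt_clauseStep (h : SatAt ρ (clauseStep δ Φ p q) k) : FreeEdge δ p q := by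
  obtain ⟨β, hβ, -⟩ := satAt_clauseStep.1 h
  exact ⟨_, (TForm.of_step_mem_clauses hβ).1⟩

theorem accept_iff_clause (hδ : ∀ a, (δ p a).IsDisjunctive Q)
    (hΦ : ∀ a, ∀ q ∈ (δ p a).boundLocs, Expresses δ F q (Φ q)) (hk : k ≤ ρ.last)
    (ht : t ≤ ρ.timeAt k) :
    Accept δ F ρ k p t ↔ ClauseExit δ Φ ρ t k p ∨
      ∃ q, SatAt ρ (clauseStep δ Φ p q) k ∧ Accept δ F ρ (k + 1) q t := by
  have hsat : ∀ β : TForm S, β.IsResetCombination → β.boundLocs ⊆ (δ p (ρ.letterAt k)).boundLocs →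
      (SatAt ρ (β.toFormula Φ) k ↔
        β.Ev (Accept δ F ρ (k + 1)) (ρ.timeAt k) (ρ.timeAt k)) := by
    intro β hβ hsub
    refine TForm.satAt_toFormula fun q hq => ?_
    rw [hβ.freeLocs_eq, Set.empty_union] at hq
    exact hΦ _ q (hsub hq) ρ k hk
  have hstep : ∀ q β, .step q β ∈ (δ p (ρ.letterAt k)).clauses → _ := fun q β hc =>
    hsat β ((hδ _).of_step_mem_clauses hc).2 (TForm.of_step_mem_clauses hc).2
  have hexit : ∀ g β, .exit g β ∈ (δ p (ρ.letterAt k)).clauses → _ := fun g β hc =>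
    hsat β ((hδ _).of_exit_mem_clauses hc) (TForm.of_exit_mem_clauses hc).2
  rw [accept_iff hk, (hδ _).ev_iff_exists_clause ht]
  constructor
  · rintro ⟨⟨q, β⟩ | ⟨g, β⟩, hc, h, hβ⟩
    · exact .inr ⟨q, satAt_clauseStep.2 ⟨β, hc, (hstep q β hc).2 hβ⟩, h⟩
    · exact .inl ⟨g, β, hc, h, (hexit g β hc).2 hβ⟩
  · rintro (⟨g, β, hc, h, hβ⟩ | ⟨q, hq, h⟩)
    · exact ⟨_, hc, h, (hexit g β hc).1 hβ⟩
    · obtain ⟨β, hc, hβ⟩ := satAt_clauseStep.1 hq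
      exact ⟨_, hc, h, (hstep q β hc).1 hβ⟩

theorem mem_of_satAt_clauseStep (hδ : ∀ a, (δ p a).IsDisjunctive Q)
    (h : SatAt ρ (clauseStep δ Φ p q) k) : q ∈ Q := by
  obtain ⟨β, hβ, -⟩ := satAt_clauseStep.1 h
  exact ((hδ _).of_step_mem_clauses hβ).1

theorem accept_iff_exists_path (hδ : ∀ q ∈ Q, ∀ a, (δ q a).IsDisjunctive Q)
    (hΦ : ExpressesResets δ F Φ s) (hs : s ∈ Q) (hk : k ≤ ρ.last + 1) (ht : t ≤ ρ.timeAt k) :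
    Accept δ F ρ k s t ↔ (∃ q ∈ F, Path ρ (clauseStep δ Φ) s k q (ρ.last + 1)) ∨
      ∃ q j, j < ρ.last + 1 ∧ Path ρ (clauseStep δ Φ) s k q j ∧ ClauseExit δ Φ ρ t j q := by
  refine iff_exists_path (X := {q | q ∈ Q ∧ FreeReach δ s q}) (acc := fun k q => Accept δ F ρ k q t)
    (fun q => accept_end) ?_ hk ?_ ⟨hs, .refl⟩
  · rintro p ⟨hp, hreach⟩ k q h
    exact ⟨mem_of_satAt_clauseStep (hδ p hp) h, hreach.tail (freeEdge_of_satAt_clauseStep h)⟩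
  · rintro i hki hi p ⟨hp, hreach⟩
    exact accept_iff_clause (hδ p hp) (hΦ p hreach) (by omega) (ht.trans (ρ.timeAt_mono hki))

end Island

/-- The formula for a path from `s` to a location in `F` that reads all symbols after the current
one, where `re q` stands for the paths from `s` to `q`. -/
noncomputable def Formula.pathToEnd [Finite S] (step : S → S → Formula P)
    (re : S → RatExp (Formula P)) (F : Set S) (s : S) : Formula P :=
  .orList [.and (.ofProp (s ∈ F)) .atEnd, .iOr fun p => .iOr fun q =>
    .and (.ofProp (q ∈ F)) (.frat (.ci 0) (re p) (.and .atEnd (step p q)))]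

/-- The formula for a path from `s` that ends with a clause with a clock constraint, where `re q`
stands for the paths from `s` to `q` and `re₀ q` for the instantaneous ones. -/
noncomputable def Formula.pathToExit [Finite S] [Finite P] (δ : S → Letter P → TForm S)
    (Φ : S → Formula P) (re re₀ : S → RatExp (Formula P)) : Formula P :=
  .iOr fun q => .iOr fun a => .orList ((δ q a).clauses.map fun
    | .step _ _ => .fls
    | .exit g β => .fratGuard (re q) (re₀ q) (.and (.ofLetter a) (β.toFormula Φ)) g)

section PathFormula

variable [Finite S] {F : Set S} {s : S} {ρ : TimedWord P} {k : ℕ} {re re₀ : S → RatExp (Formula P)}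

theorem satAt_pathToEnd {step : S → S → Formula P} (hre : ∀ q, DefinesPath step s q (re q))
    (hk : k ≤ ρ.last) : SatAt ρ (.pathToEnd step re F s) k ↔
      ∃ q ∈ F, Path ρ step s (k + 1) q (ρ.last + 1) := by
  simp only [Formula.pathToEnd, satAt_orList, List.mem_cons, List.not_mem_nil, or_false,
    exists_eq_or_imp, exists_eq_left, satAt_and, satAt_ofProp, satAt_atEnd hk, satAt_iOr,
    satAt_frat hk, (hre _).2 ρ]
  constructor
  · rintro (⟨hs, rfl⟩ | ⟨p, q, hq, j, hkj, hj, ⟨hend, hlast⟩, -, hpath⟩)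
    · exact ⟨s, hs, .refl _ _⟩
    · obtain rfl := (satAt_atEnd hj).1 hend
      exact ⟨q, hq, (path_succ_iff hpath.le).2 ⟨p, hpath, hlast⟩⟩
  · rintro ⟨q, hq, hpath⟩
    rcases Nat.eq_or_lt_of_le hk with rfl | hlt
    · exact .inl ⟨path_self_iff.1 hpath ▸ hq, rfl⟩
    · obtain ⟨p, hpath, hlast⟩ := (path_succ_iff hlt).1 hpath
      refine .inr ⟨p, q, hq, _, hlt, le_rfl, ⟨(satAt_atEnd le_rfl).2 rfl, hlast⟩, ?_, hpath⟩
      simpa [Interval.toSet] using ρ.timeAt_mono hk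

theorem satAt_pathToExit [Finite P] {δ : S → Letter P → TForm S} {Φ : S → Formula P}
    (hre : ∀ q, DefinesPath (clauseStep δ Φ) s q (re q))
    (hre₀ : ∀ q, (re₀ q).IsInstantPart (re q)) (hk : k ≤ ρ.last) :
    SatAt ρ (.pathToExit δ Φ re re₀) k ↔ ∃ q j, j < ρ.last + 1 ∧
      Path ρ (clauseStep δ Φ) s (k + 1) q j ∧ ClauseExit δ Φ ρ (ρ.timeAt k) j q := by
  simp only [Formula.pathToExit, satAt_iOr, satAt_orList, List.mem_map, exists_exists_and_eq_and]
  refine exists_congr fun q => ?_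
  constructor
  · rintro ⟨a, ⟨r, β⟩ | ⟨g, β⟩, hc, h⟩
    · exact absurd h not_satAt_fls
    · obtain ⟨j, -, hj, hφ, hg, hpath⟩ := (satAt_fratGuard (hre₀ q) hk).1 h
      obtain ⟨ha, hβ⟩ := satAt_and.1 hφ
      obtain rfl := satAt_ofLetter.1 ha
      exact ⟨j, by omega, ((hre q).2 _ _ _).1 hpath, g, β, hc, hg, hβ⟩
  · rintro ⟨j, hj, hpath, g, β, hc, hg, hβ⟩
    exact ⟨ρ.letterAt j, _, hc, (satAt_fratGuard (hre₀ q) hk).2 ⟨j, hpath.le, by omega,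
      satAt_and.2 ⟨satAt_ofLetter.2 rfl, hβ⟩, hg, ((hre q).2 _ _ _).2 hpath⟩⟩

variable {J : Interval → Prop} {R : RatExp (Formula P) → Prop}
  (hJ : ∀ I : Interval, ¬ I.Punctual → J I)

include hJ

theorem Formula.Within.pathToEnd {step : S → S → Formula P}
    (hstep : ∀ p q, (step p q).Within J R) (hR : ∀ q, R (re q))
    (hre : ∀ q, DefinesPath step s q (re q)) : (Formula.pathToEnd step re F s).Within J R :=
  .orPair (.and (.ofProp _) (.atEnd hJ)) <| .iOr fun p => .iOr fun q => .and (.ofProp _) <|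
    .frat (hJ _ (Interval.not_punctual_ci 0)) (hR p) ((hre p).lettersIn_within hstep)
      (.and (.atEnd hJ) (hstep p q))

theorem Formula.Within.pathToExit [Finite P] {δ : S → Letter P → TForm S} {Φ : S → Formula P}
    (hδ : ∀ q a, ∀ g ∈ (δ q a).guards, J g.interval) (hΦ : ∀ p, (Φ p).Within J R)
    (hR : ∀ q, R (re q)) (hR₀ : ∀ q, R (re₀ q)) (hre : ∀ q, (re q).LettersIn (Formula.Within J R))
    (hre₀ : ∀ q, (re₀ q).LettersIn (Formula.Within J R)) :
    (Formula.pathToExit δ Φ re re₀).Within J R := by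
  refine .iOr fun q => .iOr fun a => .orList fun ψ hψ => ?_
  obtain ⟨⟨r, β⟩ | ⟨g, β⟩, hc, rfl⟩ := List.mem_map.1 hψ
  · exact .fls
  · refine .fratGuard hJ (hR q) (hR₀ q) (hre q) (hre₀ q) (.and (.ofLetter a) (.toFormula hΦ β)) ?_
    obtain hg | rfl := (TForm.of_exit_mem_clauses hc).1
    · exact hδ q a g hg
    · exact hJ _ (Interval.not_punctual_ci 0)

end PathFormula

theorem Formula.Within.clauseStep [Finite P] {J : Interval → Prop} {R : RatExp (Formula P) → Prop}
    {δ : S → Letter P → TForm S} {Φ : S → Formula P} (hΦ : ∀ p, (Φ p).Within J R) (p q : S) :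
    (clauseStep δ Φ p q).Within J R := by
  refine .iOr fun a => .and (.ofLetter a) (.orList fun ψ hψ => ?_)
  obtain ⟨⟨r, β⟩ | ⟨g, β⟩, -, rfl⟩ := List.mem_map.1 hψ
  · exact .and (.ofProp _) (.toFormula hΦ β)
  · exact .fls

/-- The paths along the transitions inside the islands are defined by rational expressions that
satisfy `R`. -/
def DefinesFreePaths (δ : S → Letter P → TForm S) (R : RatExp (Formula P) → Prop) : Prop :=
  ∀ step : S → S → Formula P, (∀ ρ k p q, SatAt ρ (step p q) k → FreeEdge δ p q) →
    ∃ re : S → S → RatExp (Formula P), ∀ p q, R (re p q) ∧ DefinesPath step p q (re p q)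

section Expresses

variable [Finite P] [Finite S] {δ : S → Letter P → TForm S} {F Q : Set S} {Φ : S → Formula P}
  {s : S} {J : Interval → Prop} {R : RatExp (Formula P) → Prop}
  (hJ : ∀ I : Interval, ¬ I.Punctual → J I) (hR : DefinesFreePaths δ R)
  (hg : ∀ q a, ∀ g ∈ (δ q a).guards, J g.interval)

include hJ hR hg

theorem exists_expresses_of_isDisjunctive (hδ : ∀ q ∈ Q, ∀ a, (δ q a).IsDisjunctive Q)
    (hs : s ∈ Q) (hΦJ : ∀ p, (Φ p).Within J R) (hΦ : ExpressesResets δ F Φ s) :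
    ∃ φ : Formula P, φ.Within J R ∧ Expresses δ F s φ := by
  have hstepJ : ∀ p q, (clauseStep δ Φ p q).Within J R := Formula.Within.clauseStep hΦJ
  have hstepJ₀ : ∀ p q, (Formula.and (clauseStep δ Φ p q) .nextSimul).Within J R :=
    fun p q => .and (hstepJ p q) (.nextSimul hJ)
  obtain ⟨re, hre⟩ := hR (clauseStep δ Φ) fun _ _ _ _ => freeEdge_of_satAt_clauseStep
  obtain ⟨re₀, hre₀⟩ := hR (fun p q => .and (clauseStep δ Φ p q) .nextSimul)
    fun _ _ _ _ h => freeEdge_of_satAt_clauseStep (satAt_and.1 h).1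
  refine ⟨.orList [.pathToEnd (clauseStep δ Φ) (re s) F s, .pathToExit δ Φ (re s) (re₀ s)],
    .orPair (.pathToEnd hJ hstepJ (fun q => (hre s q).1) fun q => (hre s q).2)
      (.pathToExit hJ hg hΦJ (fun q => (hre s q).1) (fun q => (hre₀ s q).1)
        (fun q => (hre s q).2.lettersIn_within hstepJ)
        fun q => (hre₀ s q).2.lettersIn_within hstepJ₀), fun ρ k hk => ?_⟩
  rw [accept_iff_exists_path hδ hΦ hs (by omega) (ρ.timeAt_mono k.le_succ),
    ← satAt_pathToEnd (fun q => (hre s q).2) hk,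
    ← satAt_pathToExit (fun q => (hre s q).2) (fun q => (hre₀ s q).2.isInstantPart (hre s q).2) hk]
  simp

theorem exists_expresses_of_isConjunctive (hδ : ∀ q ∈ Q, ∀ a, (δ q a).IsConjunctive Q)
    (hs : s ∈ Q) (hΦJ : ∀ p, (Φ p).Within J R) (hΦ : ExpressesResets δ F Φ s) :
    ∃ φ : Formula P, φ.Within J R ∧ Expresses δ F s φ := by
  have hedge : FreeEdge (fun s a => (δ s a).dual) = FreeEdge δ := by
    funext p q
    simp only [FreeEdge, TForm.freeLocs_dual]
  obtain ⟨φ, hφJ, hφ⟩ := exists_expresses_of_isDisjunctive (δ := fun s a => (δ s a).dual)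
    (F := Fᶜ) (Φ := fun p => .neg (Φ p)) hJ (by rwa [DefinesFreePaths, hedge])
    (fun q a => TForm.guards_dual (hg q a)) (fun q hq a => (hδ q hq a).dual) hs
    (fun p => .neg (hΦJ p)) fun q hq a p hp ρ k hk => by
      rw [TForm.boundLocs_dual] at hp
      rw [FreeReach, hedge] at hq
      rw [satAt_neg, hΦ q hq a p hp ρ k hk, accept_dual]
  refine ⟨.neg φ, .neg hφJ, fun ρ k hk => ?_⟩
  rw [satAt_neg, hφ ρ k hk, accept_dual, not_not]

theorem exists_expresses (hδ : ∀ s a, (s ∈ Q → (δ s a).IsConjunctive Q) ∧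
      (s ∉ Q → (δ s a).IsDisjunctive Qᶜ)) {lt : S → S → Prop} [IsStrictOrder S lt]
    (hlt : ∀ s q, FreeReach δ s q → ∀ a, ∀ p ∈ (δ q a).boundLocs, lt p s) (s : S) :
    ∃ φ : Formula P, φ.Within J R ∧ Expresses δ F s φ := by
  induction s using (Finite.wellFounded_of_trans_of_irrefl lt).induction with
  | _ s ih =>
    have hex : ∀ p, ∃ φ : Formula P, φ.Within J R ∧ (lt p s → Expresses δ F p φ) := by
      intro p
      by_cases hp : lt p s
      · exact (ih p hp).imp fun φ => And.imp_right fun h _ => h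
      · exact ⟨.tru, .tru, fun h => absurd h hp⟩
    choose Φ hΦJ hΦ using hex
    have hΦ : ExpressesResets δ F Φ s := fun q hq a p hp => hΦ p (hlt s q hq a p hp)
    by_cases hs : s ∈ Q
    · exact exists_expresses_of_isConjunctive hJ hR hg (fun q hq a => (hδ q a).1 hq) hs hΦJ hΦ
    · exact exists_expresses_of_isDisjunctive hJ hR hg (fun q hq a => (hδ q a).2 hq) hs hΦJ hΦ

end Expresses

theorem OneATA.exists_formula [Finite P] {A : OneATA P} {J : Interval → Prop}
    {R : RatExp (Formula P) → Prop} (hJ : ∀ I : Interval, ¬ I.Punctual → J I)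
    (hR : DefinesFreePaths A.δ R) (hg : ∀ q a, ∀ g ∈ (A.δ q a).guards, J g.interval)
    (hcd : A.IsConjunctiveDisjunctive) {lt : A.Loc → A.Loc → Prop} [IsStrictOrder A.Loc lt]
    (hlt : ∀ s q, FreeReach A.δ s q → ∀ a, ∀ p ∈ (A.δ q a).boundLocs, lt p s) :
    ∃ φ : Formula P, φ.Within J R ∧ A.language = φ.language := by
  have := A.finite_loc
  obtain ⟨Q, hQ⟩ := hcd
  choose Φ hΦJ hΦ using exists_expresses (F := A.final) hJ hR hg hQ hlt
  refine ⟨.iOr fun a => .and (.ofLetter a) ((A.δ A.init a).toFormula Φ),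
    .iOr fun a => .and (.ofLetter a) (.toFormula hΦJ _), ?_⟩
  ext ρ
  rw [OneATA.mem_language, Formula.mem_language, accept_iff (Nat.zero_le _), ρ.timeAt_zero]
  simp only [satAt_iOr, satAt_and, satAt_ofLetter, exists_eq_left']
  refine (TForm.satAt_toFormula fun s _ => ?_).symm
  rw [hΦ s ρ 0 (Nat.zero_le _), ρ.timeAt_zero]

theorem OneATA.HasLoopFreeResets.exists_order {A : OneATA P} (hA : A.HasLoopFreeResets) :
    ∃ lt : A.Loc → A.Loc → Prop, IsStrictOrder A.Loc lt ∧
      ∀ s q, FreeReach A.δ s q → ∀ a, ∀ p ∈ (A.δ q a).boundLocs, lt p s := by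
  obtain ⟨header, lt, hnormal, hlt, hbound⟩ := hA
  refine ⟨fun p q => lt (header p) (header q),
    { irrefl := fun _ => hlt.irrefl _, trans := fun _ _ _ => hlt.trans _ _ _ },
    fun s q hq a p hp => ?_⟩
  have hisland : header q = header s := by
    clear hp
    induction hq with
    | refl => rfl
    | tail _ hedge ih =>
      obtain ⟨b, hfree⟩ := hedge
      exact (hnormal.free _ b _ hfree).1.trans ih
  change lt (header p) (header s)
  rw [hnormal.bound q a p hp, ← hisland]
  exact hbound q a p hp

theorem OneATA.IsPartiallyOrdered.exists_order {A : OneATA P} (hA : A.IsPartiallyOrdered) :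
    ∃ lt : A.Loc → A.Loc → Prop, IsStrictOrder A.Loc lt ∧
      (∀ p q, FreeEdge A.δ p q → q = p ∨ lt q p) ∧
      ∀ s q, FreeReach A.δ s q → ∀ a, ∀ p ∈ (A.δ q a).boundLocs, lt p s := by
  obtain ⟨lt, hlt, h⟩ := hA
  have hfree : ∀ p q, FreeEdge A.δ p q → q = p ∨ lt q p := fun p q ⟨a, hq⟩ =>
    (h p a).1 q (.inl hq)
  refine ⟨lt, hlt, hfree, fun s q hq a p hp => ?_⟩
  have hpq : lt p q :=
    ((h q a).1 p (.inr hp)).resolve_left fun heq => (h q a).2 (heq ▸ hp)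
  clear hp
  induction hq with
  | refl => exact hpq
  | tail _ hedge ih =>
    obtain rfl | hlt' := hfree _ _ hedge
    · exact ih hpq
    · exact ih (hlt.trans _ _ _ hpq hlt')

end FormulaOf

/-! ### Position automata of rational expressions -/

/-- Automata whose states are an initial state and positions, each of which is entered with a fixed
letter. -/
structure PosAut (α : Type*) where
  Pos : Type
  label : Pos → α
  follow : Option Pos → Pos → Prop
  final : Option Pos → Prop

/-- Acceptance of a word from a state, where `none` is the initial state. -/
def PosAut.Accepts {α : Type*} (M : PosAut α) : Option M.Pos → List α → Prop
  | q, [] => M.final q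
  | q, a :: w => ∃ p, M.follow q p ∧ M.label p = a ∧ M.Accepts (some p) w

namespace PosAut

/-- The language of a position automaton. -/
def lang {α : Type*} (M : PosAut α) : Language α :=
  {w | M.Accepts none w}

variable {α : Type*} (M N : PosAut α)

/-- The position automaton of the union of two languages. -/
def alt : PosAut α where
  Pos := M.Pos ⊕ N.Pos
  label := Sum.elim M.label N.label
  follow
    | none, .inl q => M.follow none q
    | none, .inr q => N.follow none q
    | some (.inl p), .inl q => M.follow (some p) q
    | some (.inr p), .inr q => N.follow (some p) q
    | some (.inl _), .inr _ | some (.inr _), .inl _ => False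
  final
    | none => M.final none ∨ N.final none
    | some (.inl p) => M.final (some p)
    | some (.inr p) => N.final (some p)

/-- The position automaton of the product of two languages. -/
def cat : PosAut α where
  Pos := M.Pos ⊕ N.Pos
  label := Sum.elim M.label N.label
  follow
    | none, .inl q => M.follow none q
    | none, .inr q => M.final none ∧ N.follow none q
    | some (.inl p), .inl q => M.follow (some p) q
    | some (.inl p), .inr q => M.final (some p) ∧ N.follow none q
    | some (.inr p), .inr q => N.follow (some p) q
    | some (.inr _), .inl _ => False
  final
    | none => M.final none ∧ N.final none
    | some (.inl p) => M.final (some p) ∧ N.final none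
    | some (.inr p) => N.final (some p)

/-- The position automaton of the iteration of a language. -/
def star : PosAut α where
  Pos := M.Pos
  label := M.label
  follow p q := M.follow p q ∨ (M.final p ∧ M.follow none q)
  final
    | none => True
    | some p => M.final (some p)

variable {M N}

theorem accepts_some_congr (f : N.Pos → M.Pos) (hlabel : ∀ p, M.label (f p) = N.label p)
    (hfollow : ∀ p q, M.follow (some (f p)) q ↔ ∃ p', N.follow (some p) p' ∧ f p' = q)
    (hfinal : ∀ p, M.final (some (f p)) ↔ N.final (some p)) {p : N.Pos} {w : List α} :
    M.Accepts (some (f p)) w ↔ N.Accepts (some p) w := by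
  induction w generalizing p with
  | nil => exact hfinal p
  | cons a w ih => simp only [Accepts, hfollow, exists_exists_and_eq_and, hlabel, ih]

theorem accepts_alt_inl {p : M.Pos} {w : List α} :
    (M.alt N).Accepts (some (.inl p)) w ↔ M.Accepts (some p) w :=
  accepts_some_congr (M := M.alt N) (N := M) Sum.inl (fun _ => rfl)
    (by rintro p (q | q) <;> simp [alt]) fun _ => Iff.rfl

theorem accepts_alt_inr {p : N.Pos} {w : List α} :
    (M.alt N).Accepts (some (.inr p)) w ↔ N.Accepts (some p) w :=
  accepts_some_congr (M := M.alt N) (N := N) Sum.inr (fun _ => rfl)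
    (by rintro p (q | q) <;> simp [alt]) fun _ => Iff.rfl

theorem lang_alt : (M.alt N).lang = M.lang + N.lang := by
  ext w
  rw [Language.mem_add]
  cases w with
  | nil => exact Iff.rfl
  | cons a w =>
    refine Sum.exists.trans (or_congr ?_ ?_)
    · exact exists_congr fun _ => and_congr_right' (and_congr_right' accepts_alt_inl)
    · exact exists_congr fun _ => and_congr_right' (and_congr_right' accepts_alt_inr)

theorem accepts_cat_inr {p : N.Pos} {w : List α} :
    (M.cat N).Accepts (some (.inr p)) w ↔ N.Accepts (some p) w :=
  accepts_some_congr (M := M.cat N) (N := N) Sum.inr (fun _ => rfl)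
    (by rintro p (q | q) <;> simp [cat]) fun _ => Iff.rfl

theorem accepts_cat {p : Option M.Pos} {w : List α} :
    (M.cat N).Accepts (p.map .inl) w ↔
      ∃ u v, w = u ++ v ∧ M.Accepts p u ∧ v ∈ N.lang := by
  have hinl : ∀ p q, (M.cat N).follow (Option.map .inl p) (.inl q) ↔ M.follow p q := by
    rintro (_ | p) q <;> rfl
  have hinr : ∀ p q, (M.cat N).follow (Option.map .inl p) (.inr q) ↔
      M.final p ∧ N.follow none q := by
    rintro (_ | p) q <;> rfl
  have hfinal : ∀ p, (M.cat N).final (Option.map .inl p) ↔ M.final p ∧ N.final none := by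
    rintro (_ | p) <;> rfl
  induction w generalizing p with
  | nil =>
    refine (hfinal p).trans ⟨fun h => ⟨[], [], rfl, h⟩, ?_⟩
    rintro ⟨u, v, huv, h⟩
    obtain ⟨rfl, rfl⟩ := List.append_eq_nil_iff.1 huv.symm
    exact h
  | cons a w ih =>
    constructor
    · rintro ⟨q | q, hq, hlabel, hw⟩
      · obtain ⟨u, v, rfl, hu, hv⟩ := (ih (p := some q)).1 hw
        exact ⟨a :: u, v, rfl, ⟨q, (hinl p q).1 hq, hlabel, hu⟩, hv⟩
      · obtain ⟨hp, hq⟩ := (hinr p q).1 hq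
        exact ⟨[], a :: w, rfl, hp, q, hq, hlabel, accepts_cat_inr.1 hw⟩
    · rintro ⟨_ | ⟨b, u⟩, v, huv, hu, hv⟩
      · obtain rfl : v = a :: w := huv.symm
        obtain ⟨q, hq, hlabel, hw⟩ := hv
        exact ⟨.inr q, (hinr p q).2 ⟨hu, hq⟩, hlabel, accepts_cat_inr.2 hw⟩
      · obtain ⟨rfl, rfl⟩ := List.cons.inj huv
        obtain ⟨q, hq, hlabel, hu⟩ := hu
        exact ⟨.inl q, (hinl p q).2 hq, hlabel, (ih (p := some q)).2 ⟨u, v, rfl, hu, hv⟩⟩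

theorem lang_cat : (M.cat N).lang = M.lang * N.lang := by
  ext w
  rw [Language.mem_mul]
  refine (accepts_cat (p := none)).trans ?_
  constructor
  · rintro ⟨u, v, rfl, hu, hv⟩
    exact ⟨u, hu, v, hv, rfl⟩
  · rintro ⟨u, hu, v, hv, rfl⟩
    exact ⟨u, v, rfl, hu, hv⟩

theorem exists_append_of_accepts_star {p : M.Pos} {w : List α}
    (hw : M.star.Accepts (some p) w) :
    ∃ u v, w = u ++ v ∧ M.Accepts (some p) u ∧ v ∈ KStar.kstar M.lang := by
  induction w generalizing p with
  | nil => exact ⟨[], [], rfl, hw, Language.nil_mem_kstar _⟩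
  | cons a w ih =>
    obtain ⟨q, hq, hlabel, hw⟩ := hw
    obtain ⟨u, v, rfl, hu, hv⟩ := ih hw
    rcases hq with hq | ⟨hp, hq⟩
    · exact ⟨a :: u, v, rfl, ⟨q, hq, hlabel, hu⟩, hv⟩
    · have hau : a :: u ∈ M.lang := ⟨q, hq, hlabel, hu⟩
      exact ⟨[], a :: u ++ v, rfl, hp,
        mul_kstar_le_kstar (a := M.lang) (Language.append_mem_mul hau hv)⟩

theorem accepts_star_append {p : M.Pos} {u v : List α} (hu : M.Accepts (some p) u)
    (hv : v ∈ M.star.lang) : M.star.Accepts (some p) (u ++ v) := by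
  induction u generalizing p with
  | nil =>
    cases v with
    | nil => exact hu
    | cons b v =>
      obtain ⟨q, hq, hlabel, hv⟩ := hv
      exact ⟨q, .inr ⟨hu, hq.elim id And.right⟩, hlabel, hv⟩
  | cons a u ih =>
    obtain ⟨q, hq, hlabel, hu⟩ := hu
    exact ⟨q, .inl hq, hlabel, ih hu⟩

theorem lang_star : M.star.lang = KStar.kstar M.lang := by
  apply le_antisymm
  · rintro (_ | ⟨a, w⟩) hw
    · exact Language.nil_mem_kstar _
    · obtain ⟨q, hq, hlabel, hw⟩ := hw
      obtain ⟨u, v, rfl, hu, hv⟩ := exists_append_of_accepts_star hw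
      have hau : a :: u ∈ M.lang := ⟨q, hq.elim id And.right, hlabel, hu⟩
      exact mul_kstar_le_kstar (a := M.lang) (Language.append_mem_mul hau hv)
  · refine kstar_le_of_mul_le_right ?_ ?_
    · rintro w rfl
      exact trivial
    · intro w hw
      obtain ⟨u, hu, v, hv, rfl⟩ := Language.mem_mul.1 hw
      cases u with
      | nil => exact hv
      | cons a u =>
        obtain ⟨q, hq, hlabel, hu⟩ := hu
        exact ⟨q, .inl hq, hlabel, accepts_star_append hu hv⟩

end PosAut

namespace RatExp

variable {α : Type*}

/-- The position automaton of a rational expression (Glushkov's construction): a position is an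
occurrence of a letter. -/
def posAut : RatExp α → PosAut α
  | eps => { Pos := Empty, label := Empty.elim, follow := fun _ _ => False, final := fun _ => True }
  | letter a => { Pos := Unit, label := fun _ => a, follow := fun p _ => p = none,
                  final := fun p => p ≠ none }
  | cat r s => r.posAut.cat s.posAut
  | alt r s => r.posAut.alt s.posAut
  | star r => r.posAut.star

theorem finite_pos (r : RatExp α) : Finite r.posAut.Pos := by
  induction r with
  | eps => exact inferInstanceAs (Finite Empty)
  | letter => exact inferInstanceAs (Finite Unit)
  | cat => exact inferInstanceAs (Finite (_ ⊕ _))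
  | alt => exact inferInstanceAs (Finite (_ ⊕ _))
  | star _ ih => exact ih

theorem label_posAut_mem (r : RatExp α) (p : r.posAut.Pos) : r.posAut.label p ∈ r.letters := by
  induction r with
  | eps => exact p.elim
  | letter => exact rfl
  | cat _ _ ihr ihs => exact p.casesOn (fun p => .inl (ihr p)) fun p => .inr (ihs p)
  | alt _ _ ihr ihs => exact p.casesOn (fun p => .inl (ihr p)) fun p => .inr (ihs p)
  | star _ ih => exact ih p

theorem lang_posAut_letter (a : α) : (letter a).posAut.lang = {[a]} := by
  ext w
  constructor
  · intro hw
    match w, hw with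
    | [], hw => exact (hw rfl).elim
    | [_], ⟨_, _, rfl, _⟩ => rfl
    | _ :: _ :: _, ⟨_, _, _, _, hfollow, _⟩ => cases hfollow
  · rintro rfl
    exact ⟨(), rfl, rfl, Option.some_ne_none _⟩

theorem lang_posAut_eps : (eps : RatExp α).posAut.lang = 1 := by
  ext w
  cases w with
  | nil => exact iff_of_true trivial rfl
  | cons a w => exact iff_of_false (fun ⟨q, _⟩ => q.elim) (by simp [Language.mem_one])

theorem lang_posAut (r : RatExp α) : r.posAut.lang = r.lang := by
  induction r with
  | eps => exact lang_posAut_eps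
  | letter a => exact lang_posAut_letter a
  | cat r s ihr ihs => rw [lang, ← ihr, ← ihs, ← PosAut.lang_cat, posAut]
  | alt r s ihr ihs => rw [lang, ← ihr, ← ihs, ← PosAut.lang_alt, posAut]
  | star r ih => rw [lang, ← ih, ← PosAut.lang_star, posAut]

theorem IsLetterStar.exists_rank_pos {r : RatExp α} (h : r.IsLetterStar) :
    ∃ rank : r.posAut.Pos → ℕ, ∀ p q, r.posAut.follow (some p) q → q = p ∨ rank q < rank p := by
  induction h with
  | eps => exact ⟨fun _ => 0, fun p => p.elim⟩
  | letter a => exact ⟨fun _ => 0, fun p q _ => .inl rfl⟩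
  | star a => exact ⟨fun _ => 0, fun p q _ => .inl rfl⟩
  | alt _ _ ihr ihs =>
    obtain ⟨f, hf⟩ := ihr
    obtain ⟨g, hg⟩ := ihs
    refine ⟨Sum.elim f g, ?_⟩
    rintro (p | p) (q | q) h
    · exact (hf p q h).imp_left (congrArg Sum.inl)
    · exact h.elim
    · exact h.elim
    · exact (hg p q h).imp_left (congrArg Sum.inr)
  | @cat r s _ _ ihr ihs =>
    obtain ⟨f, hf⟩ := ihr
    obtain ⟨g, hg⟩ := ihs
    have := s.finite_pos
    obtain ⟨N, hN⟩ := (Set.finite_range g).bddAbove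
    refine ⟨Sum.elim (fun p => f p + (N + 1)) g, ?_⟩
    rintro (p | p) (q | q) h
    · exact (hf p q h).imp (congrArg Sum.inl) (Nat.add_lt_add_right · _)
    · exact .inr (Nat.lt_add_left _ (Nat.lt_succ_of_le (hN ⟨q, rfl⟩)))
    · exact h.elim
    · exact (hg p q h).imp_left (congrArg Sum.inr)

theorem IsLetterStar.exists_rank {r : RatExp α} (h : r.IsLetterStar) :
    ∃ rank : Option r.posAut.Pos → ℕ,
      ∀ q p, r.posAut.follow q p → some p = q ∨ rank (some p) < rank q := by
  obtain ⟨f, hf⟩ := h.exists_rank_pos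
  have := r.finite_pos
  obtain ⟨N, hN⟩ := (Set.finite_range f).bddAbove
  refine ⟨fun q => q.elim (N + 1) f, ?_⟩
  rintro (_ | q) p h
  · exact .inr (Nat.lt_succ_of_le (hN ⟨p, rfl⟩))
  · exact (hf q p h).imp_left (congrArg some)

end RatExp

section MatchFrom

variable {ρ : TimedWord P} {M : PosAut (Formula P)} {q : Option M.Pos} {i j : ℕ}

/-- The positions `i, …, j - 1` satisfy the successive letters of a word that `M` accepts from the
state `q`. -/
def PosAut.MatchFrom (M : PosAut (Formula P)) (ρ : TimedWord P) (q : Option M.Pos) (i j : ℕ) :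
    Prop :=
  ∃ w, M.Accepts q w ∧ i + w.length = j ∧ Labelled ρ id i w

theorem PosAut.MatchFrom.le (h : M.MatchFrom ρ q i j) : i ≤ j := by
  obtain ⟨w, -, rfl, -⟩ := h
  exact Nat.le_add_right _ _

theorem PosAut.matchFrom_iff : M.MatchFrom ρ q i j ↔ (M.final q ∧ i = j) ∨
    ∃ p, M.follow q p ∧ SatAt ρ (M.label p) i ∧ M.MatchFrom ρ (some p) (i + 1) j := by
  constructor
  · rintro ⟨_ | ⟨ψ, w⟩, hw, hlen, hlab⟩
    · exact .inl ⟨hw, hlen⟩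
    · obtain ⟨p, hp, rfl, hw⟩ := hw
      exact .inr ⟨p, hp, hlab.1, w, hw, by rw [← hlen, List.length_cons]; omega, hlab.2⟩
  · rintro (⟨hq, hij⟩ | ⟨p, hp, hsat, w, hw, hlen, hlab⟩)
    · exact ⟨[], hq, hij, trivial⟩
    · exact ⟨M.label p :: w, ⟨p, hp, rfl, hw⟩, by rw [← hlen, List.length_cons]; omega, hsat, hlab⟩

theorem RatExp.matchFrom_posAut {r : RatExp (Formula P)} :
    r.posAut.MatchFrom ρ none i j ↔ Match ρ r i j := by
  rw [Match, ← r.lang_posAut]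
  exact Iff.rfl

end MatchFrom

/-! ### Renaming locations -/

namespace TForm

variable {S S' : Type}

/-- The transition formula with its locations renamed by `f`. -/
def map (f : S → S') : TForm S → TForm S'
  | top => top
  | bot => bot
  | conj φ ψ => conj (φ.map f) (ψ.map f)
  | disj φ ψ => disj (φ.map f) (ψ.map f)
  | loc s => loc (f s)
  | guard g => guard g
  | reset φ => reset (φ.map f)

theorem ev_map {f : S → S'} {L : S' → ℝ → Prop} {now : ℝ} {φ : TForm S} {t : ℝ} :
    (φ.map f).Ev L now t ↔ φ.Ev (fun s t => L (f s) t) now t := by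
  induction φ generalizing t with
  | conj _ _ ihφ ihψ => exact and_congr ihφ ihψ
  | disj _ _ ihφ ihψ => exact or_congr ihφ ihψ
  | reset _ ih => exact ih
  | _ => rfl

theorem freeLocs_map {f : S → S'} (φ : TForm S) : (φ.map f).freeLocs = f '' φ.freeLocs := by
  induction φ with
  | conj φ ψ ihφ ihψ => simp [map, freeLocs, ihφ, ihψ, Set.image_union]
  | disj φ ψ ihφ ihψ => simp [map, freeLocs, ihφ, ihψ, Set.image_union]
  | _ => simp [map, freeLocs]

theorem boundLocs_map {f : S → S'} (φ : TForm S) : (φ.map f).boundLocs = f '' φ.boundLocs := by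
  induction φ with
  | conj φ ψ ihφ ihψ => simp [map, boundLocs, ihφ, ihψ, Set.image_union]
  | disj φ ψ ihφ ihψ => simp [map, boundLocs, ihφ, ihψ, Set.image_union]
  | reset φ ih => simp [map, boundLocs, ih, freeLocs_map, Set.image_union]
  | _ => simp [map, boundLocs]

theorem guards_map {f : S → S'} (φ : TForm S) : (φ.map f).guards = φ.guards := by
  induction φ with
  | conj φ ψ ihφ ihψ => simp [map, guards, ihφ, ihψ]
  | disj φ ψ ihφ ihψ => simp [map, guards, ihφ, ihψ]
  | reset φ ih => simp [map, guards, ih]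
  | _ => rfl

theorem IsResetCombination.map {β : TForm S} (hβ : β.IsResetCombination) (f : S → S') :
    (β.map f).IsResetCombination := by
  induction hβ with
  | top => exact .top
  | bot => exact .bot
  | atom q => exact .atom _
  | conj _ _ ihφ ihψ => exact .conj ihφ ihψ
  | disj _ _ ihφ ihψ => exact .disj ihφ ihψ

theorem IsConjunctive.map {Q : Set S} {Q' : Set S'} {f : S → S'} (hf : ∀ q ∈ Q, f q ∈ Q')
    {φ : TForm S} (h : φ.IsConjunctive Q) : (φ.map f).IsConjunctive Q' := by
  induction h with
  | loc h => exact .loc (hf _ h)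
  | locOr h hβ => exact .locOr (hf _ h) (hβ.map f)
  | guard g => exact .guard g
  | guardOr g hβ => exact .guardOr g (hβ.map f)
  | resets hβ => exact .resets (hβ.map f)
  | conj _ _ ihφ ihψ => exact .conj ihφ ihψ

theorem IsDisjunctive.map {Q : Set S} {Q' : Set S'} {f : S → S'} (hf : ∀ q ∈ Q, f q ∈ Q')
    {φ : TForm S} (h : φ.IsDisjunctive Q) : (φ.map f).IsDisjunctive Q' := by
  induction h with
  | loc h => exact .loc (hf _ h)
  | locAnd h hβ => exact .locAnd (hf _ h) (hβ.map f)
  | guard g => exact .guard g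
  | guardAnd g hβ => exact .guardAnd g (hβ.map f)
  | resets hβ => exact .resets (hβ.map f)
  | disj _ _ ihφ ihψ => exact .disj ihφ ihψ

/-- The disjunction of a list of transition formulas. -/
def disjList : List (TForm S) → TForm S
  | [] => bot
  | φ :: l => disj φ (disjList l)

/-- The disjunction of a finite family of transition formulas. -/
noncomputable def iDisj {ι : Type*} [Finite ι] (φ : ι → TForm S) : TForm S :=
  have := Fintype.ofFinite ι
  disjList (Finset.univ.toList.map φ)

theorem ev_disjList {L : S → ℝ → Prop} {now t : ℝ} {l : List (TForm S)} :
    (disjList l).Ev L now t ↔ ∃ φ ∈ l, φ.Ev L now t := by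
  induction l with
  | nil => simp [disjList, Ev]
  | cons φ l ih => simp [disjList, Ev, ih]

theorem freeLocs_disjList {l : List (TForm S)} :
    (disjList l).freeLocs = ⋃ φ ∈ l, φ.freeLocs := by
  induction l with
  | nil => simp [disjList, freeLocs]
  | cons φ l ih => simp [disjList, freeLocs, ih]

theorem boundLocs_disjList {l : List (TForm S)} :
    (disjList l).boundLocs = ⋃ φ ∈ l, φ.boundLocs := by
  induction l with
  | nil => simp [disjList, boundLocs]
  | cons φ l ih => simp [disjList, boundLocs, ih]

theorem guards_disjList {l : List (TForm S)} :
    (disjList l).guards = ⋃ φ ∈ l, φ.guards := by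
  induction l with
  | nil => simp [disjList, guards]
  | cons φ l ih => simp [disjList, guards, ih]

theorem IsDisjunctive.disjList {Q : Set S} {l : List (TForm S)}
    (h : ∀ φ ∈ l, φ.IsDisjunctive Q) : (TForm.disjList l).IsDisjunctive Q := by
  induction l with
  | nil => exact .resets .bot
  | cons φ l ih => exact .disj (h φ (by simp)) (ih fun ψ hψ => h ψ (by simp [hψ]))

section iDisj

variable {ι : Type*} [Finite ι] {φ : ι → TForm S}

theorem ev_iDisj {L : S → ℝ → Prop} {now t : ℝ} :
    (iDisj φ).Ev L now t ↔ ∃ i, (φ i).Ev L now t := by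
  simp [iDisj, ev_disjList]

theorem freeLocs_iDisj : (iDisj φ).freeLocs = ⋃ i, (φ i).freeLocs := by
  simp [iDisj, freeLocs_disjList]

theorem boundLocs_iDisj : (iDisj φ).boundLocs = ⋃ i, (φ i).boundLocs := by
  simp [iDisj, boundLocs_disjList]

theorem guards_iDisj : (iDisj φ).guards = ⋃ i, (φ i).guards := by
  simp [iDisj, guards_disjList]

theorem IsDisjunctive.iDisj {Q : Set S} (h : ∀ i, (φ i).IsDisjunctive Q) :
    (TForm.iDisj φ).IsDisjunctive Q := by
  refine .disjList fun ψ hψ => ?_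
  obtain ⟨i, -, rfl⟩ := List.mem_map.1 hψ
  exact h i

end iDisj

end TForm

theorem accept_map {S S' : Type} {δ : S → Letter P → TForm S} {F : Set S}
    {δ' : S' → Letter P → TForm S'} {F' : Set S'} {f : S → S'}
    (hδ : ∀ s a, δ' (f s) a = (δ s a).map f) (hF : ∀ s, f s ∈ F' ↔ s ∈ F) {ρ : TimedWord P}
    {k : ℕ} {s : S} {t : ℝ} : Accept δ' F' ρ k (f s) t ↔ Accept δ F ρ k s t := by
  have hrem : ∀ m s t, acceptRem δ' F' ρ m (f s) t ↔ acceptRem δ F ρ m s t := by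
    intro m
    induction m with
    | zero => exact fun s _ => hF s
    | succ m ih =>
      intro s t
      rw [acceptRem, acceptRem, hδ, TForm.ev_map]
      exact TForm.ev_congr (fun s _ => ih s _) fun s _ => ih s _
  exact hrem _ s t

/-! ### Transition structures with islands -/

/-- The transition structure of an automaton without initial location, with islands given by
`header`, a rank of the locations, and the set `conjLocs` of conjunctive locations. -/
structure TransitionStructure (P : Type*) where
  Loc : Type
  finite_loc : Finite Loc
  δ : Loc → Letter P → TForm Loc
  final : Set Loc
  header : Loc → Loc
  rank : Loc → ℕ
  conjLocs : Set Loc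

namespace TransitionStructure

variable {ord : Prop} {J : Interval → Prop} {B B' : TransitionStructure P} {φ ψ : Formula P}

/-- The conditions that a conjunctive-disjunctive automaton with loop-free resets and intervals in
`J` imposes on the location `s`; the rank gives the order of the headers and, if `ord` holds, it
makes the automaton partially ordered. -/
structure ValidAt (ord : Prop) (J : Interval → Prop) (B : TransitionStructure P) (s : B.Loc) :
    Prop where
  header_header : B.header (B.header s) = B.header s
  bound : ∀ a, ∀ q ∈ (B.δ s a).boundLocs,
    B.header q = q ∧ B.rank q < B.rank s ∧ B.rank q < B.rank (B.header s)
  free : ∀ a, ∀ p ∈ (B.δ s a).freeLocs,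
    B.header p = B.header s ∧ p ≠ B.header s ∧ (ord → p = s ∨ B.rank p < B.rank s)
  isConjunctive : s ∈ B.conjLocs → ∀ a, (B.δ s a).IsConjunctive B.conjLocs
  isDisjunctive : s ∉ B.conjLocs → ∀ a, (B.δ s a).IsDisjunctive B.conjLocsᶜ
  guards : ∀ a, ∀ g ∈ (B.δ s a).guards, J g.interval

/-- All locations satisfy the conditions `ValidAt`. -/
def Valid (ord : Prop) (J : Interval → Prop) (B : TransitionStructure P) : Prop :=
  ∀ s, B.ValidAt ord J s

/-- The formula `φ` is represented by the reset combinations `T a`, to be used at the symbol `a`. -/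
structure Represents (B : TransitionStructure P) (T : Letter P → TForm B.Loc) (φ : Formula P) :
    Prop where
  isResetCombination : ∀ a, (T a).IsResetCombination
  bound : ∀ a, ∀ q ∈ (T a).boundLocs, B.header q = q
  satAt_iff : ∀ (ρ : TimedWord P) (k : ℕ), k ≤ ρ.last → ∀ t, (SatAt ρ φ k ↔
    (T (ρ.letterAt k)).Ev (Accept B.δ B.final ρ (k + 1)) (ρ.timeAt k) t)

theorem Represents.and {T U : Letter P → TForm B.Loc} (hT : B.Represents T φ)
    (hU : B.Represents U ψ) : B.Represents (fun a => .conj (T a) (U a)) (.and φ ψ) where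
  isResetCombination a := .conj (hT.isResetCombination a) (hU.isResetCombination a)
  bound a q hq := hq.elim (hT.bound a q) (hU.bound a q)
  satAt_iff ρ k hk t := by
    rw [satAt_and]
    exact and_congr (hT.satAt_iff ρ k hk t) (hU.satAt_iff ρ k hk t)

theorem exists_rank_le (B : TransitionStructure P) : ∃ N, ∀ s, B.rank s ≤ N := by
  have := B.finite_loc
  obtain ⟨N, hN⟩ := (Set.finite_range B.rank).bddAbove
  exact ⟨N, fun s => hN ⟨s, rfl⟩⟩

/-- The empty transition structure. -/
def empty : TransitionStructure P where
  Loc := Empty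
  finite_loc := inferInstance
  δ s := s.elim
  final := ∅
  header := id
  rank := fun _ => 0
  conjLocs := ∅

theorem valid_empty : (empty : TransitionStructure P).Valid ord J :=
  fun s => s.elim

open Classical in
theorem represents_atom (p : P) :
    empty.Represents (fun a => if p ∈ a.1 then .top else .bot) (.atom p) where
  isResetCombination a := by
    split_ifs
    · exact .top
    · exact .bot
  bound _ q := q.elim
  satAt_iff ρ k _ t := by
    rw [satAt_atom]
    split_ifs with h <;> simp [h, TForm.Ev]

theorem represents_tru : empty.Represents (fun _ : Letter P => .top) .tru where
  isResetCombination _ := .top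
  bound _ q := q.elim
  satAt_iff _ _ _ _ := iff_of_true satAt_tru trivial

/-- The dual transition structure, which accepts in the complementary states. -/
abbrev dual (B : TransitionStructure P) : TransitionStructure P where
  Loc := B.Loc
  finite_loc := B.finite_loc
  δ s a := (B.δ s a).dual
  final := B.finalᶜ
  header := B.header
  rank := B.rank
  conjLocs := B.conjLocsᶜ

theorem Valid.dual (h : B.Valid ord J) : B.dual.Valid ord J := fun s =>
  { header_header := (h s).header_header
    bound := fun a q hq => (h s).bound a q ((TForm.boundLocs_dual _).subset hq)
    free := fun a q hq => (h s).free a q ((TForm.freeLocs_dual _).subset hq)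
    isConjunctive := fun hs a => ((h s).isDisjunctive hs a).dual
    isDisjunctive := fun hs a => by
      simpa only [compl_compl] using ((h s).isConjunctive (not_not.1 hs) a).dual
    guards := fun a => TForm.guards_dual ((h s).guards a) }

theorem Represents.dual {T : Letter P → TForm B.Loc} (h : B.Represents T φ) :
    B.dual.Represents (fun a => (T a).dual) (.neg φ) where
  isResetCombination a := (h.isResetCombination a).dual
  bound a q hq := h.bound a q ((TForm.boundLocs_dual _).subset hq)
  satAt_iff ρ k hk t := by
    rw [satAt_neg, h.satAt_iff ρ k hk t, ← TForm.ev_dual]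
    exact TForm.ev_congr (fun _ _ => accept_dual.symm) fun _ _ => accept_dual.symm

/-- Embeddings of transition structures: `f` identifies `B` with a part of `B'` that is closed under
transitions. -/
structure IsEmbedding (B B' : TransitionStructure P) (f : B.Loc → B'.Loc) : Prop where
  injective : f.Injective
  δ_apply : ∀ s a, B'.δ (f s) a = (B.δ s a).map f
  mem_final : ∀ s, f s ∈ B'.final ↔ s ∈ B.final
  header_apply : ∀ s, B'.header (f s) = f (B.header s)
  rank_apply : ∀ s, B'.rank (f s) = B.rank s
  mem_conjLocs : ∀ s, f s ∈ B'.conjLocs ↔ s ∈ B.conjLocs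

namespace IsEmbedding

variable {f : B.Loc → B'.Loc} (hf : IsEmbedding B B' f)
include hf

theorem validAt {s : B.Loc} (h : B.ValidAt ord J s) : B'.ValidAt ord J (f s) where
  header_header := by rw [hf.header_apply, hf.header_apply, h.header_header]
  bound a q hq := by
    rw [hf.δ_apply, TForm.boundLocs_map] at hq
    obtain ⟨q, hq, rfl⟩ := hq
    simpa only [hf.header_apply, hf.rank_apply, hf.injective.eq_iff] using h.bound a q hq
  free a p hp := by
    rw [hf.δ_apply, TForm.freeLocs_map] at hp
    obtain ⟨p, hp, rfl⟩ := hp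
    simpa only [hf.header_apply, hf.rank_apply, hf.injective.ne_iff, hf.injective.eq_iff]
      using h.free a p hp
  isConjunctive hs a := by
    rw [hf.δ_apply]
    exact (h.isConjunctive ((hf.mem_conjLocs s).1 hs) a).map fun q => (hf.mem_conjLocs q).2
  isDisjunctive hs a := by
    rw [hf.δ_apply]
    exact (h.isDisjunctive (mt (hf.mem_conjLocs s).2 hs) a).map
      fun q => mt (hf.mem_conjLocs q).1
  guards a g hg := by
    rw [hf.δ_apply, TForm.guards_map] at hg
    exact h.guards a g hg

theorem represents {T : Letter P → TForm B.Loc} (h : B.Represents T φ) :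
    B'.Represents (fun a => (T a).map f) φ where
  isResetCombination a := (h.isResetCombination a).map f
  bound a q hq := by
    rw [TForm.boundLocs_map] at hq
    obtain ⟨q, hq, rfl⟩ := hq
    rw [hf.header_apply, h.bound a q hq]
  satAt_iff ρ k hk t := by
    rw [h.satAt_iff ρ k hk t, TForm.ev_map]
    exact TForm.ev_congr (fun _ _ => (accept_map hf.δ_apply hf.mem_final).symm)
      fun _ _ => (accept_map hf.δ_apply hf.mem_final).symm

end IsEmbedding

/-- The disjoint union of a finite family of transition structures. -/
abbrev sigma {ι : Type} [Finite ι] (B : ι → TransitionStructure P) : TransitionStructure P where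
  Loc := Σ i, (B i).Loc
  finite_loc := have := fun i => (B i).finite_loc; inferInstance
  δ s a := ((B s.1).δ s.2 a).map (Sigma.mk s.1)
  final := {s | s.2 ∈ (B s.1).final}
  header s := ⟨s.1, (B s.1).header s.2⟩
  rank s := (B s.1).rank s.2
  conjLocs := {s | s.2 ∈ (B s.1).conjLocs}

theorem isEmbedding_sigma {ι : Type} [Finite ι] (B : ι → TransitionStructure P) (i : ι) :
    IsEmbedding (B i) (sigma B) (fun s => ⟨i, s⟩) where
  injective := sigma_mk_injective (β := fun i => (B i).Loc)
  δ_apply _ _ := rfl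
  mem_final _ := Iff.rfl
  header_apply _ := rfl
  rank_apply _ := rfl
  mem_conjLocs _ := Iff.rfl

/-! ### Islands from position automata -/

section Island

variable (B : TransitionStructure P) (M : PosAut (Formula P)) (I : Interval)
  (T : Option M.Pos → Letter P → TForm B.Loc)

/-- The transitions of an island for `FRat`, from the position automaton `M`: `T (some p)`
represents the label of the position `p`, and `T none` represents the argument of `FRat`. -/
noncomputable def islandδ [Finite M.Pos] (q : Option M.Pos) (a : Letter P) :
    TForm (Option M.Pos ⊕ B.Loc) :=
  .disj
    (.iDisj fun p : {p // M.follow q p} =>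
      .conj (.loc (.inl (some p.1))) ((T (some p) a).map .inr))
    (.iDisj fun _ : PLift (M.final q) => .conj (.guard (.mem I)) ((T none a).map .inr))

/-- The transition structure with an additional island for `FRat`, all of whose locations are ranked
above the number `N` and according to `r`. -/
noncomputable abbrev island [Finite M.Pos] (N : ℕ) (r : Option M.Pos → ℕ) :
    TransitionStructure P where
  Loc := Option M.Pos ⊕ B.Loc
  finite_loc := have := B.finite_loc; inferInstance
  δ := Sum.elim (B.islandδ M I T) fun s a => (B.δ s a).map .inr
  final := Sum.inr '' B.final
  header := Sum.elim (fun _ => .inl none) fun s => .inr (B.header s)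
  rank := Sum.elim (fun q => N + 1 + r q) B.rank
  conjLocs := Sum.inr '' B.conjLocs

variable {B M I T} [Finite M.Pos] {N : ℕ} {r : Option M.Pos → ℕ}

theorem isEmbedding_island_inr : IsEmbedding B (B.island M I T N r) .inr where
  injective := Sum.inr_injective
  δ_apply _ _ := rfl
  mem_final _ := Sum.inr_injective.mem_set_image
  header_apply _ := rfl
  rank_apply _ := rfl
  mem_conjLocs _ := Sum.inr_injective.mem_set_image

theorem ev_islandδ {L : Option M.Pos ⊕ B.Loc → ℝ → Prop} {now t : ℝ} {q : Option M.Pos}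
    {a : Letter P} : (B.islandδ M I T q a).Ev L now t ↔
      (∃ p, M.follow q p ∧ L (.inl (some p)) t ∧ ((T (some p) a).map .inr).Ev L now t) ∨
        (M.final q ∧ now - t ∈ I.toSet ∧ ((T none a).map .inr).Ev L now t) := by
  simp [islandδ, TForm.Ev, TForm.ev_iDisj, Guard.Holds, and_left_comm]

theorem boundLocs_islandδ_subset {q : Option M.Pos} {a : Letter P} :
    (B.islandδ M I T q a).boundLocs ⊆ ⋃ o, Sum.inr '' (T o a).boundLocs := by
  simp only [islandδ, TForm.boundLocs, TForm.boundLocs_iDisj, TForm.boundLocs_map, Set.empty_union,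
    Set.union_subset_iff, Set.iUnion_subset_iff]
  exact ⟨fun p => Set.subset_iUnion_of_subset (some p.1) subset_rfl,
    fun _ => Set.subset_iUnion_of_subset none subset_rfl⟩

theorem freeLocs_islandδ_subset (hT : ∀ o a, (T o a).IsResetCombination) {q : Option M.Pos}
    {a : Letter P} :
    (B.islandδ M I T q a).freeLocs ⊆ {s | ∃ p, M.follow q p ∧ s = .inl (some p)} := by
  simp [islandδ, TForm.freeLocs, TForm.freeLocs_iDisj, TForm.freeLocs_map, (hT _ _).freeLocs_eq,
    Set.range_subset_iff]

theorem guards_islandδ_subset (hT : ∀ o a, (T o a).IsResetCombination) {q : Option M.Pos}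
    {a : Letter P} : (B.islandδ M I T q a).guards ⊆ {.mem I} := by
  simp [islandδ, TForm.guards, TForm.guards_iDisj, TForm.guards_map, (hT _ _).guards_eq]

theorem isDisjunctive_islandδ (hT : ∀ o a, (T o a).IsResetCombination) {q : Option M.Pos}
    {a : Letter P} {Q : Set (Option M.Pos ⊕ B.Loc)} (hQ : ∀ p, .inl p ∈ Q) :
    (B.islandδ M I T q a).IsDisjunctive Q :=
  .disj (.iDisj fun _ => .locAnd (hQ _) ((hT _ _).map _))
    (.iDisj fun _ => .guardAnd _ ((hT _ _).map _))

theorem validAt_island_inl (hI : J I) (hT : ∀ o a, (T o a).IsResetCombination)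
    (hbound : ∀ o a, ∀ q ∈ (T o a).boundLocs, B.header q = q) (hN : ∀ s, B.rank s ≤ N)
    (hr : ord → ∀ q p, M.follow q p → some p = q ∨ r (some p) < r q) (q : Option M.Pos) :
    (B.island M I T N r).ValidAt ord J (.inl q) where
  header_header := rfl
  bound a s hs := by
    obtain ⟨o, s, hso, rfl⟩ := Set.mem_iUnion.1 (boundLocs_islandδ_subset hs)
    have hrank : ∀ p, B.rank s < N + 1 + r p := fun p => by have := hN s; omega
    exact ⟨congrArg Sum.inr (hbound o a s hso), hrank q, hrank none⟩
  free a s hs := by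
    obtain ⟨p, hp, rfl⟩ := freeLocs_islandδ_subset hT hs
    refine ⟨rfl, nofun, fun ho => ?_⟩
    exact (hr ho q p hp).imp (congrArg Sum.inl) (Nat.add_lt_add_left · _)
  isConjunctive := nofun
  isDisjunctive _ _ := isDisjunctive_islandδ hT nofun
  guards a g hg := by
    rw [guards_islandδ_subset hT hg]
    exact hI

theorem Valid.island (h : B.Valid ord J) (hI : J I) (hT : ∀ o a, (T o a).IsResetCombination)
    (hbound : ∀ o a, ∀ q ∈ (T o a).boundLocs, B.header q = q) (hN : ∀ s, B.rank s ≤ N)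
    (hr : ord → ∀ q p, M.follow q p → some p = q ∨ r (some p) < r q) :
    (B.island M I T N r).Valid ord J
  | .inl q => validAt_island_inl hI hT hbound hN hr q
  | .inr s => isEmbedding_island_inr.validAt (h s)

variable {T : Option M.Pos → Letter P → TForm B.Loc} {ρ : TimedWord P}

theorem accept_island_inl (hφ : B.Represents (T none) φ)
    (hM : ∀ p, B.Represents (T (some p)) (M.label p)) {k : ℕ} (hk : k ≤ ρ.last + 1)
    {q : Option M.Pos} {t : ℝ} :
    Accept (B.island M I T N r).δ (B.island M I T N r).final ρ k (.inl q) t ↔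
      ∃ j ≤ ρ.last, SatAt ρ φ j ∧ ρ.timeAt j - t ∈ I.toSet ∧ M.MatchFrom ρ q k j := by
  induction hk using Nat.decreasingInduction generalizing q with
  | self =>
    rw [accept_end]
    exact iff_of_false nofun fun ⟨j, hj, _, _, hmatch⟩ => hj.not_gt hmatch.le
  | of_succ k hk ih =>
    have hk : k ≤ ρ.last := Nat.le_of_lt_succ hk
    have hsat {ψ o} (h : B.Represents (T o) ψ) :=
      (isEmbedding_island_inr.represents (B' := B.island M I T N r) h).satAt_iff ρ k hk t
    rw [accept_iff hk]
    refine ev_islandδ.trans ?_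
    simp only [← hsat hφ, ← hsat (hM _), ih]
    constructor
    · rintro (⟨p, hp, ⟨j, hj, hφj, hI, hmatch⟩, hlabel⟩ | ⟨hq, hI, hφk⟩)
      · exact ⟨j, hj, hφj, hI, PosAut.matchFrom_iff.2 (.inr ⟨p, hp, hlabel, hmatch⟩)⟩
      · exact ⟨k, hk, hφk, hI, PosAut.matchFrom_iff.2 (.inl ⟨hq, rfl⟩)⟩
    · rintro ⟨j, hj, hφj, hI, hmatch⟩
      rcases PosAut.matchFrom_iff.1 hmatch with ⟨hq, rfl⟩ | ⟨p, hp, hlabel, hmatch⟩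
      · exact .inr ⟨hq, hI, hφj⟩
      · exact .inl ⟨p, hp, ⟨j, hj, hφj, hI, hmatch⟩, hlabel⟩

end Island

theorem Represents.island {re : RatExp (Formula P)} [Finite re.posAut.Pos]
    {T : Option re.posAut.Pos → Letter P → TForm B.Loc} {I : Interval} {N : ℕ}
    {r : Option re.posAut.Pos → ℕ} (hφ : B.Represents (T none) φ)
    (hM : ∀ p, B.Represents (T (some p)) (re.posAut.label p)) :
    (B.island re.posAut I T N r).Represents (fun _ => .reset (.loc (.inl none)))
      (.frat I re φ) where
  isResetCombination _ := .atom _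
  bound := by
    rintro _ q (hq | hq)
    · cases hq
      rfl
    · exact hq.elim
  satAt_iff ρ k hk t := by
    refine (satAt_frat hk).trans (Iff.trans ?_ (accept_island_inl hφ hM (by omega)).symm)
    simp only [RatExp.matchFrom_posAut]
    exact exists_congr fun j => and_iff_right_of_imp fun h => h.2.2.2.le

end TransitionStructure

open TransitionStructure

/-! ### From formulas to automata -/

/-- The formula `φ` is represented in some valid transition structure. -/
def Formula.Representable (ord : Prop) (J : Interval → Prop) (φ : Formula P) : Prop :=
  ∃ B : TransitionStructure P, B.Valid ord J ∧ ∃ T, B.Represents T φ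

section Representable

variable {ord : Prop} {J : Interval → Prop} {I : Interval} {φ ψ : Formula P}

theorem Formula.Representable.exists_common {ι : Type} [Finite ι] {φ : ι → Formula P}
    (h : ∀ i, (φ i).Representable ord J) : ∃ B : TransitionStructure P, B.Valid ord J ∧
      ∃ T : ι → Letter P → TForm B.Loc, ∀ i, B.Represents (T i) (φ i) := by
  choose B hB T hT using h
  exact ⟨sigma B, fun s => (isEmbedding_sigma B s.1).validAt (hB s.1 s.2), _,
    fun i => (isEmbedding_sigma B i).represents (hT i)⟩

theorem Formula.Representable.and (hφ : φ.Representable ord J) (hψ : ψ.Representable ord J) :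
    (Formula.and φ ψ).Representable ord J := by
  obtain ⟨B, hB, T, hT⟩ :=
    Representable.exists_common (φ := fun b => cond b φ ψ) (Bool.forall_bool.2 ⟨hψ, hφ⟩)
  exact ⟨B, hB, _, (hT true).and (hT false)⟩

theorem Formula.Representable.frat (hI : J I) {re : RatExp (Formula P)}
    (hord : ord → re.IsLetterStar) (hre : ∀ ψ ∈ re.letters, ψ.Representable ord J)
    (hφ : φ.Representable ord J) : (Formula.frat I re φ).Representable ord J := by
  have := re.finite_pos
  obtain ⟨B, hB, T, hT⟩ := Representable.exists_common (φ := fun o => o.elim φ re.posAut.label)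
    (Option.forall.2 ⟨hφ, fun p => hre _ (re.label_posAut_mem p)⟩)
  obtain ⟨N, hN⟩ := B.exists_rank_le
  obtain ⟨r, hr⟩ : ∃ r : Option re.posAut.Pos → ℕ,
      ord → ∀ q p, re.posAut.follow q p → some p = q ∨ r (some p) < r q := by
    by_cases ho : ord
    · exact (hord ho).exists_rank.imp fun _ hr _ => hr
    · exact ⟨fun _ => 0, fun h => (ho h).elim⟩
  exact ⟨B.island re.posAut I T N r,
    hB.island hI (fun o => (hT o).isResetCombination) (fun o => (hT o).bound) hN hr, _,
    .island (hT none) fun p => hT (some p)⟩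

theorem Formula.Representable.until (hI : J I) (hφ : φ.Representable ord J)
    (hψ : ψ.Representable ord J) : (Formula.until I φ ψ).Representable ord J := by
  obtain ⟨B, hB, T, hT⟩ := Representable.frat (re := .star (.letter φ)) hI
    (fun _ => .star φ) (by rintro _ rfl; exact hφ) hψ
  exact ⟨B, hB, T, hT.isResetCombination, hT.bound, fun ρ k hk t =>
    (satAt_until_iff_frat hk).trans (hT.satAt_iff ρ k hk t)⟩

theorem Formula.Within.representable {R : RatExp (Formula P) → Prop}
    (hR : ord → ∀ re, R re → re.IsLetterStar) (h : φ.Within J R) : φ.Representable ord J := by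
  induction h with
  | atom p => exact ⟨empty, valid_empty, _, represents_atom p⟩
  | tru => exact ⟨empty, valid_empty, _, represents_tru⟩
  | and _ _ ihφ ihψ => exact ihφ.and ihψ
  | neg _ ih =>
    obtain ⟨B, hB, T, hT⟩ := ih
    exact ⟨B.dual, hB.dual, _, hT.dual⟩
  | frat hI hre _ _ ihre ihφ => exact .frat hI (fun ho => hR ho _ hre) ihre ihφ
  | _ hI _ _ ihφ ihψ => exact .until hI ihφ ihψ

end Representable

namespace TransitionStructure

variable {B : TransitionStructure P} {ord : Prop} {J : Interval → Prop} {φ : Formula P}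

/-- The automaton with the given initial location. -/
abbrev toOneATA (B : TransitionStructure P) (init : B.Loc) : OneATA P where
  Loc := B.Loc
  finite_loc := B.finite_loc
  init := init
  final := B.final
  δ := B.δ

theorem Valid.isConjunctiveDisjunctive (h : B.Valid ord J) (init : B.Loc) :
    (B.toOneATA init).IsConjunctiveDisjunctive :=
  ⟨B.conjLocs, fun s a => ⟨fun hs => (h s).isConjunctive hs a, fun hs => (h s).isDisjunctive hs a⟩⟩

theorem Valid.hasLoopFreeResets (h : B.Valid ord J) {init : B.Loc} (hinit : B.header init = init) :
    (B.toOneATA init).HasLoopFreeResets := by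
  refine ⟨B.header, B.rank ⁻¹'o (· < ·), ⟨?_, hinit, ?_, ?_⟩, inferInstance, ?_⟩
  · exact fun s => (h s).header_header
  · exact fun s a q hq => ((h s).bound a q hq).1
  · exact fun s a p hp => ((h s).free a p hp).imp_right And.left
  · exact fun s a q hq => ((h s).bound a q hq).2.2

theorem Valid.isPartiallyOrdered (h : B.Valid True J) (init : B.Loc) :
    (B.toOneATA init).IsPartiallyOrdered := by
  refine ⟨B.rank ⁻¹'o (· < ·), inferInstance, fun s a => ⟨?_, ?_⟩⟩
  · rintro p (hp | hp)
    · exact ((h s).free a p hp).2.2 trivial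
    · exact .inr ((h s).bound a p hp).2.1
  · exact fun hs => lt_irrefl _ ((h s).bound a s hs).2.1

/-- The transition structure with an additional location `none` above all others, whose transitions
are given by `T`. -/
abbrev withInit (B : TransitionStructure P) (T : Letter P → TForm B.Loc) (N : ℕ) :
    TransitionStructure P where
  Loc := Option B.Loc
  finite_loc := have := B.finite_loc; inferInstance
  δ s a := s.elim ((T a).map some) fun s => (B.δ s a).map some
  final := some '' B.final
  header := Option.map B.header
  rank s := s.elim (N + 1) B.rank
  conjLocs := some '' B.conjLocs

variable {T : Letter P → TForm B.Loc} {N : ℕ}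

theorem isEmbedding_withInit : IsEmbedding B (B.withInit T N) some where
  injective := Option.some_injective _
  δ_apply _ _ := rfl
  mem_final _ := (Option.some_injective _).mem_set_image
  header_apply _ := rfl
  rank_apply _ := rfl
  mem_conjLocs _ := (Option.some_injective _).mem_set_image

theorem Represents.validAt_withInit_none (hT : B.Represents T φ) (hN : ∀ s, B.rank s ≤ N) :
    (B.withInit T N).ValidAt ord J none where
  header_header := rfl
  bound a q hq := by
    obtain ⟨q, hqT, rfl⟩ := (TForm.boundLocs_map _).subset hq
    exact ⟨congrArg some (hT.bound a q hqT), Nat.lt_succ_of_le (hN q), Nat.lt_succ_of_le (hN q)⟩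
  free a p hp := (((hT.isResetCombination a).map some).freeLocs_eq.subset hp).elim
  isConjunctive := nofun
  isDisjunctive _ a := .resets ((hT.isResetCombination a).map some)
  guards a g hg := (((hT.isResetCombination a).map some).guards_eq.subset hg).elim

theorem Valid.withInit (hB : B.Valid ord J) (hT : B.Represents T φ) (hN : ∀ s, B.rank s ≤ N) :
    (B.withInit T N).Valid ord J
  | none => hT.validAt_withInit_none hN
  | some s => isEmbedding_withInit.validAt (hB s)

theorem Represents.language_eq (hT : B.Represents T φ) :
    φ.language = ((B.withInit T N).toOneATA none).language := by
  ext ρ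
  rw [Formula.mem_language, OneATA.mem_language, accept_iff (Nat.zero_le _)]
  exact (isEmbedding_withInit (T := T) (N := N) |>.represents hT).satAt_iff ρ 0 (Nat.zero_le _) 0

end TransitionStructure

theorem Formula.Representable.exists_toOneATA {ord : Prop} {J : Interval → Prop} {φ : Formula P}
    (h : φ.Representable ord J) : ∃ (B : TransitionStructure P) (init : B.Loc),
      B.Valid ord J ∧ B.header init = init ∧ φ.language = (B.toOneATA init).language := by
  obtain ⟨B, hB, T, hT⟩ := h
  obtain ⟨N, hN⟩ := B.exists_rank_le
  exact ⟨B.withInit T N, none, hB.withInit hT hN, rfl, hT.language_eq⟩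

/-! ### Expressive equivalence -/

/-- The automata all of whose clock constraints use intervals in `J`. -/
def guardsIn (J : Interval → Prop) : Set (OneATA P) :=
  {A | ∀ s a, ∀ g ∈ (A.δ s a).guards, J g.interval}

theorem guardsIn_true : (guardsIn fun _ => True : Set (OneATA P)) = Set.univ :=
  Set.eq_univ_of_forall fun _ _ _ _ _ => trivial

theorem npAutomata_eq : NPAutomata P = guardsIn fun I => ¬ I.Punctual :=
  rfl

theorem fRatMTL_eq : FRatMTL P = {φ | φ.Within (fun _ => True) fun _ => True} :=
  (Set.eq_univ_of_forall Formula.within_true).symm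

theorem fSfrMTL_eq : FSfrMTL P = {φ | φ.Within (fun _ => True) HasStarFreeEquivalent} :=
  Set.ext fun _ => Formula.isSfr_iff_within

theorem fRatMITL_eq : FRatMITL P = {φ | φ.Within (fun I => ¬ I.Punctual) fun _ => True} :=
  Set.ext fun _ => Formula.isNonPunctual_iff_within

theorem fSfrMITL_eq :
    FSfrMITL P = {φ | φ.Within (fun I => ¬ I.Punctual) HasStarFreeEquivalent} := by
  ext φ
  refine (and_congr Formula.isSfr_iff_within Formula.isNonPunctual_iff_within).trans ⟨?_, ?_⟩
  · exact fun h => (h.1.and_within h.2).mono (fun _ => And.right) fun _ => And.left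
  · exact fun h =>
      ⟨h.mono (fun _ _ => trivial) fun _ => id, h.mono (fun _ => id) fun _ _ => trivial⟩

section

variable [Finite P] {J : Interval → Prop} (hJ : ∀ I : Interval, ¬ I.Punctual → J I)
include hJ

theorem expressivelyEquivalent_cdLfr : ExpressivelyEquivalent (CDLfr P ∩ guardsIn J)
    {φ | φ.Within J fun _ => True} := by
  constructor
  · rintro A ⟨⟨hcd, hlfr⟩, hg⟩
    obtain ⟨lt, _, hlt⟩ := hlfr.exists_order
    have := A.finite_loc
    refine OneATA.exists_formula hJ (fun step _ => ?_) hg hcd hlt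
    obtain ⟨re, hre⟩ := exists_definesPath step
    exact ⟨re, fun p q => ⟨trivial, hre p q⟩⟩
  · intro φ hφ
    obtain ⟨B, init, hB, hinit, hlang⟩ := (hφ.representable (ord := False) nofun).exists_toOneATA
    exact ⟨B.toOneATA init, ⟨⟨hB.isConjunctiveDisjunctive init, hB.hasLoopFreeResets hinit⟩,
      fun s => (hB s).guards⟩, hlang⟩

theorem expressivelyEquivalent_cdPO : ExpressivelyEquivalent (CDPO P ∩ guardsIn J)
    {φ | φ.Within J HasStarFreeEquivalent} := by
  constructor
  · rintro A ⟨⟨hcd, hpo⟩, hg⟩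
    obtain ⟨lt, _, hfree, hlt⟩ := hpo.exists_order
    have := A.finite_loc
    obtain ⟨φ, hφ, hlang⟩ := OneATA.exists_formula (R := RatExp.IsLetterStar) hJ
      (fun step hstep => exists_isLetterStar_definesPath
        fun ρ k p q hpq => hfree p q (hstep ρ k p q hpq))
      hg hcd hlt
    exact ⟨φ, hφ.mono (fun _ => id) fun _ h => h.hasStarFreeEquivalent, hlang⟩
  · intro φ hφ
    obtain ⟨φ', hφ', heq⟩ :=
      Formula.Within.exists_isLetterStar (hJ _ (Interval.not_punctual_ci 0)) hφ
    obtain ⟨B, init, hB, -, hlang⟩ :=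
      (hφ'.representable (ord := True) fun _ _ h => h).exists_toOneATA
    refine ⟨B.toOneATA init, ⟨⟨hB.isConjunctiveDisjunctive init, hB.isPartiallyOrdered init⟩,
      fun s => (hB s).guards⟩, hlang ▸ ?_⟩
    ext ρ
    exact (heq ρ 0 (Nat.zero_le _)).symm

end

end ATA

theorem theorem3 {P : Type*} [Finite P] :
    ATA.ExpressivelyEquivalent (ATA.CDLfr P) (ATA.FRatMTL P) ∧
    ATA.ExpressivelyEquivalent (ATA.CDPO P) (ATA.FSfrMTL P) ∧
    ATA.ExpressivelyEquivalent (ATA.CDLfr P ∩ ATA.NPAutomata P) (ATA.FRatMITL P) ∧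
    ATA.ExpressivelyEquivalent (ATA.CDPO P ∩ ATA.NPAutomata P) (ATA.FSfrMITL P) := by
  rw [ATA.fRatMTL_eq, ATA.fSfrMTL_eq, ATA.fRatMITL_eq, ATA.fSfrMITL_eq, ATA.npAutomata_eq]
  refine ⟨?_, ?_, ATA.expressivelyEquivalent_cdLfr fun _ => id,
    ATA.expressivelyEquivalent_cdPO fun _ => id⟩
  · rw [← Set.inter_univ (ATA.CDLfr P), ← ATA.guardsIn_true]
    exact ATA.expressivelyEquivalent_cdLfr fun _ _ => trivial
  · rw [← Set.inter_univ (ATA.CDPO P), ← ATA.guardsIn_true]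
    exact ATA.expressivelyEquivalent_cdPO fun _ _ => trivial
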